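/- **Setting.** Let $X$ be a compact complex manifold of dimension $n$ (for example a smooth projective variety over $\mathbb C$), considered as an oriented real manifold of dimension $m=2n$. A current of dimension $k$ on $X$ is a continuous linear functional on the smooth $k$-forms. *De Rham data* $\mathcal U$ on $X$ consist of a finite ordered family of open sets $U_1,\dots,U_N$ with diffeomorphisms $h_i:U_i\to\mathbb R^m$ such that the sets $B_i=h_i^{-1}(B)$ ($B\subset\mathbb R^m$ the open unit ball) cover $X$; smooth functions $g_i\ge 0$ with compact support in $U_i$ that are $1$ near $\overline{B_i}$; diffeomorphisms $H_i:\mathbb R^m\to B$ such that the maps $s^i_y$, given by $H_i\circ(\text{translation by }y)\circ H_i^{-1}$ on $B$ and by the identity outside $B$, are smooth in $(y,x)\in\mathbb R^m\times\mathbb R^m$; and smooth even functions $f_i\ge 0$ on $\mathbb R^m$ supported in $B$ with $\int f_i=1$. Transport $s^i_y$ to $X$ by $h_i$ (identity outside $U_i$), and put, for $\epsilon>0$, $$R^{i*}_\epsilon\phi=g_i\int_{\mathbb R^m}\epsilon^{-m}f_i(y/\epsilon)\,(s^i_y)^*\phi\,dy+(1-g_i)\phi,\qquad (R^i_\epsilon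 T)(\phi)=T(R^{i*}_\epsilon\phi),\qquad R_\epsilon=R^1_\epsilon\cdots R^N_\epsilon .$$ The current $R_\epsilon T$ is given by a smooth form, and the intersection of $T_1,T_2$ with respect to $\mathcal U$ is the current $$[T_1\wedge T_2]_{\mathcal U}(\phi)=\lim_{\epsilon\to0^+}\int_{T_1}R_\epsilon T_2\wedge\phi ,$$ whenever this limit exists for all test forms $\phi$ and defines a current. **Theorem 3.9.** For subvarieties $T_1,T_2$ of a smooth projective variety that meet excessively (in dimension larger than the expected one), the current $[T_1\wedge T_2]_{\mathcal U}$ (with $T_i$ the currents of integration) in general depends on the de Rham data $\mathcal U$. In fact it does so for every line $T_1=T_2=\ell\subset\mathbf P^2_{\mathbb C}$: 1. there are de Rham data $\mathcal U,\mathcal U'$ on $\mathbf P^2$ for which $[\ell\wedge\ell]_{\mathcal U}$ and $[\ell\wedge\ell]_{\mathcal U'}$ both exist and are different; 2. the intersection can be concentrated near any prescribed point of $\ell$: for every point $p\in\ell$ and every neighbourhood $V$ of $p$ in $\mathbf P^2$ there are de Rham data $\mathcal U$ such that $[\ell\wedge\ell]_{\mathcal U}$ exists, is not zero, and has its support in $V\cap\ell$.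 -/

import Mathlib

open scoped Manifold ContDiff Topology LinearAlgebra.Projectivization

noncomputable section

/-! ### Complex projective space as a manifold -/

namespace ProjSpace

/-- Complex projective `n`-space. -/
abbrev CP (n : ℕ) : Type := ℙ ℂ (Fin (n + 1) → ℂ)

/-- The quotient topology of `ℂ^(n+1) ∖ {0}`. -/
instance (n : ℕ) : TopologicalSpace (CP n) :=
  inferInstanceAs (TopologicalSpace (Quotient (projectivizationSetoid ℂ (Fin (n + 1) → ℂ))))

variable {n : ℕ}

theorem isQuotientMap_mk' :
    Topology.IsQuotientMap (Projectivization.mk' ℂ : {v : Fin (n + 1) → ℂ // v ≠ 0} → CP n) :=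
  isQuotientMap_quotient_mk'

/-- The affine coordinates `(z_j / z_i)_{j ≠ i}`. -/
def affineCoord (i : Fin (n + 1)) : CP n → (Fin n → ℂ) :=
  Projectivization.lift (fun v j => v.1 (i.succAbove j) / v.1 i) (by
    rintro ⟨a, ha⟩ ⟨b, hb⟩ t h
    funext j
    have ht : t ≠ 0 := by
      rintro rfl
      exact ha (by simpa using h)
    simp only at h
    subst h
    simp [mul_div_mul_left _ _ ht])

/-- The open set `z_i ≠ 0`. -/
def affineOpen (i : Fin (n + 1)) : Set (CP n) := {p | ∀ v ∈ p.submodule, v i = 0 → v = 0}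

theorem mk_mem_affineOpen (i : Fin (n + 1)) (v : Fin (n + 1) → ℂ) (hv : v ≠ 0) :
    Projectivization.mk ℂ v hv ∈ affineOpen i ↔ v i ≠ 0 := by
  simp only [affineOpen, Set.mem_ofPred_eq, Projectivization.submodule_mk,
    Submodule.mem_span_singleton]
  constructor
  · intro h h0
    exact hv (h v ⟨1, one_smul _ _⟩ h0)
  · rintro h w ⟨c, rfl⟩ hw
    have : c = 0 := by simpa [h] using hw
    simp [this]

theorem insertNth_ne_zero (i : Fin (n + 1)) (w : Fin n → ℂ) :
    (i.insertNth (1 : ℂ) w : Fin (n + 1) → ℂ) ≠ 0 := by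
  intro h
  simpa using congrFun h i

/-- The inverse of the affine coordinates: `w ↦ [w_1 : … : 1 : … : w_n]`, with `1` in place `i`. -/
def affinePoint (i : Fin (n + 1)) (w : Fin n → ℂ) : CP n :=
  Projectivization.mk ℂ (i.insertNth (1 : ℂ) w) (insertNth_ne_zero i w)

theorem isOpen_affineOpen (i : Fin (n + 1)) : IsOpen (affineOpen i : Set (CP n)) := by
  rw [← isQuotientMap_mk'.isOpen_preimage]
  have : (Projectivization.mk' ℂ : {v : Fin (n + 1) → ℂ // v ≠ 0} → CP n) ⁻¹' affineOpen i =
      {v | v.1 i ≠ 0} := by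
    ext ⟨v, hv⟩
    exact mk_mem_affineOpen i v hv
  rw [this]
  exact isOpen_ne_fun ((continuous_apply i).comp continuous_subtype_val) continuous_const

/-- The standard affine chart `{z_i ≠ 0} ≃ ℂⁿ`. -/
def affineChart (i : Fin (n + 1)) : OpenPartialHomeomorph (CP n) (Fin n → ℂ) where
  toFun := affineCoord i
  invFun := affinePoint i
  source := affineOpen i
  target := Set.univ
  map_source' _ _ := Set.mem_univ _
  map_target' w _ := by
    simp [affinePoint, mk_mem_affineOpen]
  left_inv' p hp := by
    induction p using Projectivization.ind with
    | h v hv =>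
      have hi := (mk_mem_affineOpen i v hv).1 hp
      refine (Projectivization.mk_eq_mk_iff' ℂ _ _ _ _).2 ⟨(v i)⁻¹, ?_⟩
      funext j
      refine Fin.succAboveCases i ?_ (fun j => ?_) j
      · simp [hi]
      · simp [affineCoord, div_eq_inv_mul]
  right_inv' w _ := by
    funext j
    simp [affinePoint, affineCoord]
  open_source := isOpen_affineOpen i
  open_target := isOpen_univ
  continuousOn_toFun := by
    rw [isQuotientMap_mk'.continuousOn_isOpen_iff (isOpen_affineOpen i)]
    refine continuousOn_pi.2 fun j => ?_
    refine ContinuousOn.div (f := fun v : {v : Fin (n + 1) → ℂ // v ≠ 0} => v.1 (i.succAbove j))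
      (g := fun v => v.1 i) ((continuous_apply _).comp continuous_subtype_val).continuousOn
      ((continuous_apply i).comp continuous_subtype_val).continuousOn ?_
    rintro ⟨v, hv⟩ h
    exact (mk_mem_affineOpen i v hv).1 h
  continuousOn_invFun := by
    refine Continuous.continuousOn ?_
    refine isQuotientMap_mk'.continuous.comp
      (g := Projectivization.mk' ℂ)
      (f := fun w : Fin n → ℂ => ⟨i.insertNth (1 : ℂ) w, insertNth_ne_zero i w⟩) ?_
    refine Continuous.subtype_mk (continuous_pi fun j => ?_) _
    refine Fin.succAboveCases i ?_ (fun j => ?_) j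
    · simpa using continuous_const
    · simpa using continuous_apply j

theorem exists_mem_affineOpen (p : CP n) : ∃ i, p ∈ affineOpen i := by
  induction p using Projectivization.ind with
  | h v hv =>
    obtain ⟨i, hi⟩ := Function.ne_iff.1 hv
    exact ⟨i, (mk_mem_affineOpen i v hv).2 hi⟩

instance : ChartedSpace (Fin n → ℂ) (CP n) where
  atlas := Set.range affineChart
  chartAt p := affineChart (exists_mem_affineOpen p).choose
  mem_chart_source p := (exists_mem_affineOpen p).choose_spec
  chart_mem_atlas _ := ⟨_, rfl⟩

theorem contDiffOn_transition (i j : Fin (n + 1)) :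
    ContDiffOn ℂ ω (affineCoord j ∘ affinePoint i : (Fin n → ℂ) → (Fin n → ℂ))
      (affinePoint i ⁻¹' affineOpen j) := by
  have h : ∀ k : Fin (n + 1), ContDiff ℂ ω
      (fun w : Fin n → ℂ => (i.insertNth (1 : ℂ) w : Fin (n + 1) → ℂ) k) := by
    intro k
    refine Fin.succAboveCases i ?_ (fun k => ?_) k
    · simpa using contDiff_const
    · simpa using contDiff_apply ℂ ℂ k
  refine contDiffOn_pi.2 fun k => ?_
  refine ContDiffOn.div (h (j.succAbove k)).contDiffOn (h j).contDiffOn fun w hw => ?_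
  exact (mk_mem_affineOpen j _ _).1 hw

/-- Projective space is a complex manifold. -/
instance : IsManifold 𝓘(ℂ, Fin n → ℂ) ω (CP n) := by
  refine isManifold_of_contDiffOn _ _ _ ?_
  rintro _ _ ⟨i, rfl⟩ ⟨j, rfl⟩
  refine (contDiffOn_transition i j).mono ?_ |>.congr ?_
  · rintro w hw
    have h : w ∈ (affineChart i).symm.source ∩ (affineChart i).symm ⁻¹' (affineChart j).source := by
      simpa using hw
    exact h.2
  · intro w hw
    rfl

/-- Projective space is a smooth real manifold. -/
instance : IsManifold 𝓘(ℝ, Fin n → ℂ) ∞ (CP n) := by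
  refine isManifold_of_contDiffOn _ _ _ ?_
  rintro _ _ ⟨i, rfl⟩ ⟨j, rfl⟩
  refine (((contDiffOn_transition i j).restrict_scalars ℝ).of_le (by simp)).mono ?_ |>.congr ?_
  · rintro w hw
    have h : w ∈ (affineChart i).symm.source ∩ (affineChart i).symm ⁻¹' (affineChart j).source := by
      simpa using hw
    exact h.2
  · intro w hw
    rfl

theorem add_smul_ne_zero {a b : Fin (n + 1) → ℂ} (hab : LinearIndependent ℂ ![a, b]) (t : ℂ) :
    a + t • b ≠ 0 := by
  intro h
  have := (LinearIndependent.pair_iff.1 hab 1 t (by simpa using h)).1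
  exact one_ne_zero this

/-- The affine parametrization `t ↦ [a + t b]` of the projective line through `[a]` and `[b]`; it
omits only the point `[b]`. -/
def lineParam (a b : Fin (n + 1) → ℂ) (hab : LinearIndependent ℂ ![a, b]) (t : ℂ) : CP n :=
  Projectivization.mk ℂ (a + t • b) (add_smul_ne_zero hab t)

/-- The projective line through `[a]` and `[b]`. -/
def line (a b : Fin (n + 1) → ℂ) : Set (CP n) := {p | p.submodule ≤ Submodule.span ℂ {a, b}}

end ProjSpace

/-! ### Forms and currents on a complex manifold `M` of dimension `n`, modelled on `Fin n → ℂ` -/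

namespace DeRham

/-- Real-valued `k`-forms, without regularity. The value at `x` is a form on the tangent space
`TangentSpace 𝓘(ℝ, Fin n → ℂ) x`, which is by definition `Fin n → ℂ`. -/
abbrev Form (n : ℕ) (M : Type*) (k : ℕ) : Type _ := M → (Fin n → ℂ) [⋀^Fin k]→L[ℝ] ℝ

section Forms

variable {n : ℕ} {M : Type*} [TopologicalSpace M] [ChartedSpace (Fin n → ℂ) M] {k l : ℕ}

/-- The real derivative of a map between manifolds, `TangentSpace` being written out as
`Fin n → ℂ`. -/
def realDeriv {N : Type*} [TopologicalSpace N] [ChartedSpace (Fin n → ℂ) N]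
    (f : N → M) (x : N) : (Fin n → ℂ) →L[ℝ] (Fin n → ℂ) :=
  mfderiv 𝓘(ℝ, Fin n → ℂ) 𝓘(ℝ, Fin n → ℂ) f x

/-- The pullback of a form under a map. -/
def pullback {N : Type*} [TopologicalSpace N] [ChartedSpace (Fin n → ℂ) N]
    (f : N → M) (η : Form n M k) : Form n N k := fun x =>
  (η (f x)).compContinuousLinearMap (realDeriv f x)

/-- A form is smooth if its expression in every chart is smooth. -/
def IsSmooth (η : Form n M k) : Prop :=
  ∀ e ∈ atlas (Fin n → ℂ) M, ContDiffOn ℝ ∞ (pullback e.symm η) e.target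

/-- The wedge product
`(a ∧ b)(v) = ∑ sign(σ) a(v_{σ(1)}, …, v_{σ(k)}) b(v_{σ(k+1)}, …, v_{σ(k+l)})`
over the `(k, l)`-shuffles `σ`. -/
def wedgeAlt {E : Type*} [NormedAddCommGroup E] [NormedSpace ℝ E]
    (a : E [⋀^Fin k]→L[ℝ] ℝ) (b : E [⋀^Fin l]→L[ℝ] ℝ) : E [⋀^Fin (k + l)]→L[ℝ] ℝ :=
  { ((LinearMap.mul' ℝ ℝ).compAlternatingMap
      (a.toAlternatingMap.domCoprod b.toAlternatingMap)).domDomCongr finSumFinEquiv with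
    cont := by
      change Continuous fun v : Fin (k + l) → E =>
        LinearMap.mul' ℝ ℝ ((a.toAlternatingMap.domCoprod b.toAlternatingMap)
          (fun i => v (finSumFinEquiv i)))
      simp only [AlternatingMap.domCoprod_apply, sum_apply, map_sum]
      refine continuous_finsetSum _ fun σ _ => ?_
      induction σ using Quotient.inductionOn' with | _ σ
      simp only [AlternatingMap.domCoprod.summand_mk'', smul_apply,
        MultilinearMap.domDomCongr_apply, MultilinearMap.domCoprod_apply]
      have ha : Continuous fun v : Fin (k + l) → E =>
          a fun i => v (finSumFinEquiv (σ (Sum.inl i))) :=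
        a.cont.comp (continuous_pi fun i => continuous_apply _)
      have hb : Continuous fun v : Fin (k + l) → E =>
          b fun i => v (finSumFinEquiv (σ (Sum.inr i))) :=
        b.cont.comp (continuous_pi fun i => continuous_apply _)
      rcases Int.units_eq_one_or (Equiv.Perm.sign σ) with h | h
      · simp only [h, one_smul, LinearMap.mul'_apply]
        exact ha.mul hb
      · simp only [h, Units.neg_smul, one_smul, map_neg, LinearMap.mul'_apply]
        exact (ha.mul hb).neg }

/-- The wedge product of forms. -/
def wedge (α : Form n M k) (β : Form n M l) : Form n M (k + l) := fun x => wedgeAlt (α x) (β x)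

variable (n M k) in
/-- The space of test forms: smooth forms with compact support. -/
def testForms : Submodule ℝ (Form n M k) where
  carrier := {η | IsSmooth η ∧ HasCompactSupport η}
  zero_mem' := ⟨fun e _ => by
    have : pullback e.symm (0 : Form n M k) = 0 := by
      funext x; ext v; simp [pullback]
    rw [this]; exact contDiffOn_const, HasCompactSupport.zero⟩
  add_mem' {α β} hα hβ := ⟨fun e he => by
    have : pullback e.symm (α + β) = pullback e.symm α + pullback e.symm β := by
      funext x; ext v; simp [pullback]
    rw [this]; exact (hα.1 e he).add (hβ.1 e he), hα.2.add hβ.2⟩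
  smul_mem' c α hα := ⟨fun e he => by
    have : pullback e.symm (c • α) = c • pullback e.symm α := by
      funext x; ext v; simp [pullback]
    rw [this]; exact (hα.1 e he).const_smul c, hα.2.smul_left (f := fun _ => c)⟩

end Forms

variable (n : ℕ) (M : Type*) [TopologicalSpace M] [ChartedSpace (Fin n → ℂ) M]

/-- Currents of dimension `k`: linear functionals on the test `k`-forms that are continuous, that
is, on the forms supported in a compact subset of a chart they are bounded by a constant times a
bound for finitely many derivatives of the coefficients. -/
@[ext]
structure Current (k : ℕ) where
  toLinearMap : testForms n M k →ₗ[ℝ] ℝ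
  continuous' : ∀ e ∈ atlas (Fin n → ℂ) M, ∀ K ⊆ e.target, IsCompact K →
    ∃ (r : ℕ) (C : ℝ), ∀ φ : testForms n M k, tsupport φ.1 ⊆ e.symm '' K →
      ∀ B : ℝ, (∀ j ≤ r, ∀ y ∈ K, ‖iteratedFDeriv ℝ j (pullback e.symm φ.1) y‖ ≤ B) →
        |toLinearMap φ| ≤ C * B

open Classical in
/-- The action `s_y` of `y ∈ ℝ^d` on `ℝ^d`: the translation by `y`, carried over to the unit ball
by `H`, and the identity outside of the ball. -/
def ballAct {d : ℕ} (H : OpenPartialHomeomorph (EuclideanSpace ℝ (Fin d))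
    (EuclideanSpace ℝ (Fin d))) (y x : EuclideanSpace ℝ (Fin d)) : EuclideanSpace ℝ (Fin d) :=
  if x ∈ Metric.ball 0 1 then H (H.symm x + y) else x

/-- De Rham data on a compact complex manifold, with its underlying real structure of dimension
`2 n`: a finite ordered cover by balls, with all the choices that enter the smoothing operator.
(On a compact manifold a locally finite cover by nonempty sets is finite.) -/
structure DeRhamData where
  /-- The number of balls; the order is that of `Fin N`. -/
  N : ℕ
  /-- The diffeomorphism `h_i` from the open set `U_i` onto `ℝ^{2n}`. -/
  chart : Fin N → OpenPartialHomeomorph M (EuclideanSpace ℝ (Fin (2 * n)))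
  chart_target : ∀ i, (chart i).target = Set.univ
  chart_smooth : ∀ i, ContMDiffOn 𝓘(ℝ, Fin n → ℂ) 𝓘(ℝ, EuclideanSpace ℝ (Fin (2 * n))) ∞
    (chart i) (chart i).source
  chart_symm_smooth : ∀ i, ContMDiff 𝓘(ℝ, EuclideanSpace ℝ (Fin (2 * n))) 𝓘(ℝ, Fin n → ℂ) ∞
    (chart i).symm
  /-- The sets `B_i`, the preimages of the unit ball under the `h_i`, cover the manifold. -/
  cover : ∀ x, ∃ i, x ∈ (chart i).source ∧ chart i x ∈ Metric.ball 0 1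
  /-- The cut-off function `g_i`: compactly supported in `U_i`, equal to `1` near the closure of
  `B_i`. -/
  cutoff : Fin N → M → ℝ
  cutoff_smooth : ∀ i, ContMDiff 𝓘(ℝ, Fin n → ℂ) 𝓘(ℝ, ℝ) ∞ (cutoff i)
  cutoff_nonneg : ∀ i x, 0 ≤ cutoff i x
  cutoff_compact : ∀ i, HasCompactSupport (cutoff i)
  cutoff_support : ∀ i, tsupport (cutoff i) ⊆ (chart i).source
  cutoff_one : ∀ i, ∀ x ∈ (chart i).symm '' Metric.closedBall 0 1, cutoff i =ᶠ[𝓝 x] 1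
  /-- The diffeomorphism from `ℝ^{2n}` onto the unit ball. -/
  shrink : Fin N → OpenPartialHomeomorph (EuclideanSpace ℝ (Fin (2 * n)))
    (EuclideanSpace ℝ (Fin (2 * n)))
  shrink_source : ∀ i, (shrink i).source = Set.univ
  shrink_target : ∀ i, (shrink i).target = Metric.ball 0 1
  shrink_smooth : ∀ i, ContDiff ℝ ∞ (shrink i)
  shrink_symm_smooth : ∀ i, ContDiffOn ℝ ∞ (shrink i).symm (Metric.ball 0 1)
  /-- `s_y x` is smooth in both variables. -/
  act_smooth : ∀ i, ContDiff ℝ ∞ fun p : EuclideanSpace ℝ (Fin (2 * n)) ×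
    EuclideanSpace ℝ (Fin (2 * n)) => ballAct (shrink i) p.1 p.2
  /-- The bump function `f_i`. -/
  bump : Fin N → EuclideanSpace ℝ (Fin (2 * n)) → ℝ
  bump_smooth : ∀ i, ContDiff ℝ ∞ (bump i)
  bump_nonneg : ∀ i y, 0 ≤ bump i y
  bump_support : ∀ i, tsupport (bump i) ⊆ Metric.ball 0 1
  bump_even : ∀ i y, bump i (-y) = bump i y
  bump_integral : ∀ i, ∫ y, bump i y = 1

variable {n M} {k l j : ℕ}

namespace Current

instance : CoeFun (Current n M k) fun _ => testForms n M k → ℝ := ⟨fun T => T.toLinearMap⟩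

open Classical in
/-- The value of a current on a form; it is used only for test forms (and is `0` otherwise). -/
def eval (T : Current n M k) (η : Form n M k) : ℝ :=
  if h : η ∈ testForms n M k then T ⟨η, h⟩ else 0

/-- The support of a current: the complement of the largest open set on which it vanishes. -/
def support (T : Current n M k) : Set M :=
  {x | ∀ V : Set M, IsOpen V → x ∈ V → ∃ φ : testForms n M k, tsupport φ.1 ⊆ V ∧ T φ ≠ 0}

end Current

/-- The positively oriented real frame `e_1, i e_1, e_2, i e_2, …` of `ℂⁿ`. -/
def stdFrame {d : ℕ} (h : d = 2 * n) (i : Fin d) : Fin n → ℂ :=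
  Pi.single ⟨i / 2, by omega⟩ (if (i : ℕ) % 2 = 0 then 1 else Complex.I)

/-- The smooth form `α` represents the functional `L`, that is, `L φ = ∫_M α ∧ φ` for all test
forms `φ`. It is enough to say so for the `φ` supported in one chart, where the integral is
computed in that chart, with the complex orientation. -/
def IsRepresentedBy (h : k + j = 2 * n) (L : Form n M j → ℝ) (α : Form n M k) : Prop :=
  IsSmooth α ∧ ∀ e ∈ atlas (Fin n → ℂ) M, ∀ φ ∈ testForms n M j, tsupport φ ⊆ e.source →
    L φ = ∫ y in e.target, pullback e.symm (wedge α φ) y (stdFrame h)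

namespace DeRhamData

variable (U : DeRhamData n M)

open Classical in
/-- The action `s_y` in the `i`-th ball, as a transformation of the whole manifold. -/
def move (i : Fin U.N) (y : EuclideanSpace ℝ (Fin (2 * n))) (x : M) : M :=
  if x ∈ (U.chart i).source then (U.chart i).symm (ballAct (U.shrink i) y (U.chart i x)) else x

/-- The rescaled bump function `ε^{-2n} f_i(y / ε)`. -/
def scaledBump (i : Fin U.N) (ε : ℝ) (y : EuclideanSpace ℝ (Fin (2 * n))) : ℝ :=
  (ε ^ (2 * n))⁻¹ * U.bump i (ε⁻¹ • y)

/-- The action on forms dual to the local smoothing operator `R^i_ε`: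
`η ↦ g_i ∫ f_i^ε(y) s_y^* η dy + (1 - g_i) η`. -/
def localDual (i : Fin U.N) (ε : ℝ) (η : Form n M k) : Form n M k := fun x =>
  U.cutoff i x • (∫ y, U.scaledBump i ε y • pullback (U.move i y) η x) +
    (1 - U.cutoff i x) • η x

/-- The action on forms dual to `R_ε = R^1_ε R^2_ε ⋯ R^N_ε`; on forms the first operator acts
first. -/
def dual (ε : ℝ) (η : Form n M k) : Form n M k :=
  (List.finRange U.N).foldl (fun β i => U.localDual i ε β) η

/-- The smoothing operator `R_ε`: `(R_ε T)(φ) = T(R_ε^* φ)`. -/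
def smoothing (ε : ℝ) (T : Current n M k) (φ : Form n M k) : ℝ := T.eval (U.dual ε φ)

/-- `S = [T₁ ∧ T₂]` with respect to the de Rham data `U`: for small `ε > 0` the current `R_ε T₂`
is given by a smooth form `α ε` of degree `k`, the codimension of `T₂`, and
`S(φ) = lim_{ε → 0} ∫_{T₁} R_ε T₂ ∧ φ` for all test forms `φ`. -/
def IsIntersection (h : k + j = 2 * n) (T₁ : Current n M (k + l)) (T₂ : Current n M j)
    (S : Current n M l) : Prop :=
  ∃ α : ℝ → Form n M k,
    (∀ᶠ ε in 𝓝[>] (0 : ℝ), IsRepresentedBy h (U.smoothing ε T₂) (α ε)) ∧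
    ∀ φ : testForms n M l,
      Filter.Tendsto (fun ε => T₁.eval (wedge (α ε) φ.1)) (𝓝[>] 0) (𝓝 (S φ))

end DeRhamData

end DeRham

namespace ProjSpace

/-- `T` is the current of integration over the line through `[a]` and `[b]`. The integral is
computed in the parametrization `t ↦ [a + t b]`, `t ∈ ℂ`. -/
def IsLineCurrent {n : ℕ} {a b : Fin (n + 1) → ℂ} (hab : LinearIndependent ℂ ![a, b])
    (T : DeRham.Current n (CP n) 2) : Prop :=
  ∀ φ : DeRham.testForms n (CP n) 2, T φ = ∫ t : ℂ, φ.1 (lineParam a b hab t)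
    ![mfderiv 𝓘(ℝ, ℂ) 𝓘(ℝ, Fin n → ℂ) (lineParam a b hab) t (1 : ℂ),
      mfderiv 𝓘(ℝ, ℂ) 𝓘(ℝ, Fin n → ℂ) (lineParam a b hab) t Complex.I]

end ProjSpace

end

open scoped RealInnerProductSpace

noncomputable section

/-! ### Wedge products of alternating forms in low degrees -/

namespace DeRham

/-! Smoothing replaces the line ℓ by an average of slightly displaced surfaces, and the intersection
records where these surfaces meet ℓ. That place is dictated by the position of the balls, so moving
the balls moves the intersection.

Take a basis `B` of ℂ³ such that ℓ passes through [B₀] and [B₁], with affine coordinate t of [B₀ + t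
B₁]. The data `planeData B` use affine charts at [B₁], [B₀] and [B₂], scaled so that the three unit
balls cover the plane and cut ℓ in |t| > 1/2, in |t| < 1 and not at all. The radial diffeomorphism
`toBall` identifies each ball with ℝ⁴ = ℂ² and keeps ℓ a coordinate line. In the ball coordinates
smoothing is an average over translations of size less than ε. On forms the chart at [B₁] acts
first, so on currents it acts last: ℓ is first translated by y in the ball at [B₀], and the result
by x in the ball at [B₁].

Where |t| < 1/2 only the first translation acts. It moves a coordinate line parallel to itself, so
the smoothed form restricts to zero on ℓ there. In the ball at [B₁], the line at height b of the
first ball (b the second complex coordinate of y) becomes a graph over the second coordinate ζ ≠ 0,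
with first coordinate `reach (‖b‖ ^ 2) (ζ / b)`; this is `pivotBall_eq` with `slope_injOn` and
`image_slope`. A translate of this graph by a vector with nonzero second coordinate meets ℓ in
exactly one point of the ball. Hence ∫_ℓ R_ε ℓ ∧ φ is the expectation of φ at that point, for
independent x and y distributed by the scaled bump function (`lineInt_wedge_eq`).

The ratio ζ / b does not change when x and y are scaled by ε. Therefore the meeting point converges
almost surely to the point with coordinate `reach 0 (ζ / b)`, and dominated convergence yields the
limit `meetCurrent B`, a probability measure. It is carried by the two closed balls, that is, by the
annulus 1/2 ≤ |t| ≤ 1 (`exists_linePoint_eq`).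

Replacing B₀, B₁ by B₀ + t₀ B₁, c B₁ does not change the current of ℓ (`lineInt_eq_of_affine`) but
carries the annulus to its image under u ↦ t₀ + c u. A small c concentrates the intersection near
t₀; t₀ = 0 and c = 1/8 give an annulus disjoint from the original one.

Three points need work. The translations, conjugated to the ball, must be smooth across the sphere
(`act_eq_boundary`, `contDiff_act`). The smoothed line must be given by a smooth form on the whole
plane (`eventually_exists_form`), for which ℓ is cut at |t| = 1/√2 and smearing is self-adjoint
(`formInt_wedge_smear`). The inverse `slopeRoot` of the radial slope function must exist and be
continuous up to height zero (`exists_slopeSq_eq`, `continuousOn_slopeRoot`). -/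

theorem sum_perm_fin_succ {n : ℕ} (f : Equiv.Perm (Fin (n+1)) → ℝ) :
    ∑ σ, f σ = ∑ p : Fin (n+1), ∑ σ : Equiv.Perm (Fin n),
      f (Equiv.Perm.decomposeFin.symm (p, σ)) := by
  rw [← Equiv.sum_comp Equiv.Perm.decomposeFin.symm, Fintype.sum_prod_type]

theorem sum_perm_fin_three (F : Fin 3 → Fin 3 → Fin 3 → ℝ) :
    ∑ σ : Equiv.Perm (Fin 3), ((Equiv.Perm.sign σ : ℤ) : ℝ) * F (σ 0) (σ 1) (σ 2) =
      F 0 1 2 - F 0 2 1 - F 1 0 2 + F 1 2 0 + F 2 0 1 - F 2 1 0 := by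
  rw [sum_perm_fin_succ (n := 2)]
  simp only [sum_perm_fin_succ (n := 1), sum_perm_fin_succ (n := 0)]
  have h1 : (1 : Fin 3) = Fin.succ 0 := rfl
  have h2 : (2 : Fin 3) = Fin.succ (Fin.succ 0) := rfl
  simp only [Fin.sum_univ_succ, Equiv.Perm.decomposeFin.symm_sign, Finset.univ_unique,
    Finset.sum_singleton, h2, h1, Equiv.Perm.decomposeFin_symm_apply_zero,
    Equiv.Perm.decomposeFin_symm_apply_succ, Finset.univ_eq_empty, Finset.sum_empty]
  simp [Equiv.swap_apply_def, Fin.ext_iff]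
  ring

theorem sum_perm_fin_four (F : Fin 4 → Fin 4 → Fin 4 → Fin 4 → ℝ) :
    ∑ σ : Equiv.Perm (Fin 4), ((Equiv.Perm.sign σ : ℤ) : ℝ) * F (σ 0) (σ 1) (σ 2) (σ 3) =
      (F 0 1 2 3 - F 0 1 3 2 - F 0 2 1 3 + F 0 2 3 1 + F 0 3 1 2 - F 0 3 2 1) -
      (F 1 0 2 3 - F 1 0 3 2 - F 1 2 0 3 + F 1 2 3 0 + F 1 3 0 2 - F 1 3 2 0) -
      (F 2 1 0 3 - F 2 1 3 0 - F 2 0 1 3 + F 2 0 3 1 + F 2 3 1 0 - F 2 3 0 1) -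
      (F 3 1 2 0 - F 3 1 0 2 - F 3 2 1 0 + F 3 2 0 1 + F 3 0 1 2 - F 3 0 2 1) := by
  rw [sum_perm_fin_succ (n := 3)]
  have h1 : (1 : Fin 4) = Fin.succ 0 := rfl
  have h2 : (2 : Fin 4) = Fin.succ 1 := rfl
  have h3 : (3 : Fin 4) = Fin.succ 2 := rfl
  have key : ∀ p : Fin 4, ∑ σ : Equiv.Perm (Fin 3),
      ((Equiv.Perm.sign (Equiv.Perm.decomposeFin.symm (p, σ)) : ℤ) : ℝ) *
        F (Equiv.Perm.decomposeFin.symm (p, σ) 0) (Equiv.Perm.decomposeFin.symm (p, σ) 1)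
          (Equiv.Perm.decomposeFin.symm (p, σ) 2) (Equiv.Perm.decomposeFin.symm (p, σ) 3) =
      (if p = 0 then 1 else -1) * ∑ σ : Equiv.Perm (Fin 3), ((Equiv.Perm.sign σ : ℤ) : ℝ) *
        F p (Equiv.swap 0 p (Fin.succ (σ 0))) (Equiv.swap 0 p (Fin.succ (σ 1)))
          (Equiv.swap 0 p (Fin.succ (σ 2))) := by
    intro p
    rw [Finset.mul_sum]
    refine Finset.sum_congr rfl fun σ _ => ?_
    rw [Equiv.Perm.decomposeFin.symm_sign, h1, h2, h3]
    simp only [Equiv.Perm.decomposeFin_symm_apply_zero, Equiv.Perm.decomposeFin_symm_apply_succ]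
    split_ifs <;> simp
  have key' := fun p : Fin 4 => (key p).trans (congrArg _ (sum_perm_fin_three
    (fun i j k => F p (Equiv.swap 0 p (Fin.succ i)) (Equiv.swap 0 p (Fin.succ j))
          (Equiv.swap 0 p (Fin.succ k)))))
  rw [Finset.sum_congr rfl fun p _ => key' p, Fin.sum_univ_four]
  have e : ∀ p : Fin 4, Equiv.swap 0 p (Fin.succ 0) = (if p = 1 then 0 else 1) ∧
    Equiv.swap 0 p (Fin.succ 1) = (if p = 2 then 0 else 2) ∧
    Equiv.swap 0 p (Fin.succ 2) = (if p = 3 then 0 else 3) := by decide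
  simp only [fun p => (e p).1, fun p => (e p).2.1, fun p => (e p).2.2]
  simp [Fin.ext_iff]
  ring

variable {E : Type*} [NormedAddCommGroup E] [NormedSpace ℝ E]

theorem alt_two_apply (a : E [⋀^Fin 2]→L[ℝ] ℝ) (w : Fin 2 → E) : a w = a ![w 0, w 1] := by
  congr 1; ext i; fin_cases i <;> rfl

theorem alt_two_swap (a : E [⋀^Fin 2]→L[ℝ] ℝ) (x y : E) : a ![x, y] = - a ![y, x] := by
  have := a.toAlternatingMap.map_swap ![y, x] (i := 0) (j := 1) (by decide)
  refine Eq.trans ?_ this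
  refine congrArg a ?_
  ext i; fin_cases i <;> rfl

/-- Every shuffle class has k! l! representatives, all contributing the same term. Summing over all
permutations avoids the quotient, and the wedge is computed from this form below. -/
theorem mul_wedgeAlt_eq_sum {k l : ℕ} (a : E [⋀^Fin k]→L[ℝ] ℝ) (b : E [⋀^Fin l]→L[ℝ] ℝ)
    (v : Fin (k + l) → E) :
    ((k.factorial * l.factorial : ℕ) : ℝ) * wedgeAlt a b v =
      ∑ σ : Equiv.Perm (Fin k ⊕ Fin l), ((Equiv.Perm.sign σ : ℤ) : ℝ) *
        (a (fun i => v (finSumFinEquiv (σ (Sum.inl i)))) *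
          b (fun i => v (finSumFinEquiv (σ (Sum.inr i))))) := by
  have := MultilinearMap.domCoprod_alternization_eq a.toAlternatingMap b.toAlternatingMap
  have := congrArg (fun f => LinearMap.mul' ℝ ℝ (f (fun i => v (finSumFinEquiv i)))) this
  simp only [MultilinearMap.alternatization_apply, map_sum, AlternatingMap.smul_apply,
    map_nsmul] at this
  have h2 : LinearMap.mul' ℝ ℝ ((a.toAlternatingMap.domCoprod b.toAlternatingMap)
      (fun i => v (finSumFinEquiv i))) = wedgeAlt a b v := rfl
  rw [h2] at this
  simp only [Fintype.card_fin, nsmul_eq_mul] at this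
  rw [← this]
  refine Finset.sum_congr rfl fun σ _ => ?_
  rcases Int.units_eq_one_or (Equiv.Perm.sign σ) with h | h <;> rw [h] <;> simp

theorem wedgeAlt_two_two (a b : E [⋀^Fin 2]→L[ℝ] ℝ) (v : Fin (2 + 2) → E) :
    wedgeAlt a b v = a ![v 0, v 1] * b ![v 2, v 3] - a ![v 0, v 2] * b ![v 1, v 3]
      + a ![v 0, v 3] * b ![v 1, v 2] + a ![v 1, v 2] * b ![v 0, v 3]
      - a ![v 1, v 3] * b ![v 0, v 2] + a ![v 2, v 3] * b ![v 0, v 1] := by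
  have key := mul_wedgeAlt_eq_sum a b v
  rw [← Equiv.sum_comp (Equiv.permCongr finSumFinEquiv.symm)] at key
  simp only [Equiv.Perm.sign_permCongr, Equiv.permCongr_apply, Equiv.symm_symm,
    Equiv.apply_symm_apply] at key
  have h4 := sum_perm_fin_four (fun i j k l => a ![v i, v j] * b ![v k, v l])
  rw [Finset.sum_congr (g := fun σ : Equiv.Perm (Fin 4) => ((Equiv.Perm.sign σ : ℤ) : ℝ) *
    (a ![v (σ 0), v (σ 1)] * b ![v (σ 2), v (σ 3)])) rfl fun σ _ => by
      rw [alt_two_apply a, alt_two_apply b]; rfl] at key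
  rw [h4] at key
  simp only [alt_two_swap a (v 1) (v 0), alt_two_swap a (v 2) (v 0), alt_two_swap a (v 3) (v 0),
    alt_two_swap a (v 2) (v 1), alt_two_swap a (v 3) (v 1), alt_two_swap a (v 3) (v 2),
    alt_two_swap b (v 1) (v 0), alt_two_swap b (v 2) (v 0), alt_two_swap b (v 3) (v 0),
    alt_two_swap b (v 2) (v 1), alt_two_swap b (v 3) (v 1), alt_two_swap b (v 3) (v 2)] at key
  -- After reordering arguments, the 24 terms are the six shuffles, each occurring 2! · 2! = 4
  -- times.
  norm_num [Nat.factorial] at key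
  linarith

theorem wedgeAlt_two_zero (a : E [⋀^Fin 2]→L[ℝ] ℝ) (b : E [⋀^Fin 0]→L[ℝ] ℝ) (v : Fin 2 → E) :
    wedgeAlt a b v = a v * b ![] := by
  have key := mul_wedgeAlt_eq_sum a b v
  rw [← Equiv.sum_comp (Equiv.permCongr finSumFinEquiv.symm)] at key
  simp only [Equiv.Perm.sign_permCongr, Equiv.permCongr_apply, Equiv.symm_symm,
    Equiv.apply_symm_apply] at key
  have hb : ∀ w : Fin 0 → E, b w = b ![] := fun w => congrArg b (Subsingleton.elim _ _)
  rw [Finset.sum_congr (g := fun σ : Equiv.Perm (Fin 2) => ((Equiv.Perm.sign σ : ℤ) : ℝ) *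
    (a ![v (σ 0), v (σ 1)] * b ![])) rfl fun σ _ => by rw [alt_two_apply a, hb]; rfl] at key
  simp only [sum_perm_fin_succ (n := 1), sum_perm_fin_succ (n := 0)] at key
  have h1 : (1 : Fin 2) = Fin.succ 0 := rfl
  simp [Fin.sum_univ_succ, Equiv.Perm.decomposeFin.symm_sign, Equiv.swap_apply_def] at key
  rw [alt_two_swap a (v 1) (v 0)] at key
  rw [alt_two_apply a v]
  linarith

theorem wedgeAlt_compContinuousLinearMap {F : Type*} [NormedAddCommGroup F] [NormedSpace ℝ F]
    {k l : ℕ} (a : E [⋀^Fin k]→L[ℝ] ℝ) (b : E [⋀^Fin l]→L[ℝ] ℝ) (L : F →L[ℝ] E) :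
    (wedgeAlt a b).compContinuousLinearMap L =
      wedgeAlt (a.compContinuousLinearMap L) (b.compContinuousLinearMap L) := by
  ext v
  have hne : ((k.factorial * l.factorial : ℕ) : ℝ) ≠ 0 := by positivity
  refine mul_left_cancel₀ hne ?_
  rw [mul_wedgeAlt_eq_sum]
  change _ * wedgeAlt a b (fun i => L (v i)) = _
  rw [mul_wedgeAlt_eq_sum]
  rfl

end DeRham
end
noncomputable section

/-! ### Smoothness of functions with values in alternating forms -/

namespace DeRham

section AltValued

variable {E F P : Type*} [NormedAddCommGroup E] [NormedSpace ℝ E] [NormedAddCommGroup F]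
  [NormedSpace ℝ F] [NormedAddCommGroup P] [NormedSpace ℝ P] {k : ℕ}

/-- Evaluation of alternating forms at a fixed family of vectors. -/
def altEval (v : Fin k → E) : (E [⋀^Fin k]→L[ℝ] ℝ) →L[ℝ] ℝ :=
  (ContinuousMultilinearMap.apply ℝ (fun _ : Fin k => E) ℝ v).comp
    (ContinuousAlternatingMap.toContinuousMultilinearMapCLM ℝ)

@[simp] theorem altEval_apply (v : Fin k → E) (a : E [⋀^Fin k]→L[ℝ] ℝ) : altEval v a = a v := rfl

/-- The values on tuples of basis vectors determine an alternating form, so evaluation on them is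
injective and has a linear left inverse. This reduces regularity of form-valued maps to that of
their scalar values. -/
theorem exists_leftInverse_altEval [FiniteDimensional ℝ E] :
    ∃ (ι : Type) (_ : Fintype ι) (w : ι → Fin k → E) (R : (ι → ℝ) →L[ℝ] (E [⋀^Fin k]→L[ℝ] ℝ)),
      ∀ a : E [⋀^Fin k]→L[ℝ] ℝ, R (fun i => a (w i)) = a := by
  let b := Module.finBasis ℝ E
  let Φ : (E [⋀^Fin k]→L[ℝ] ℝ) →ₗ[ℝ] ((Fin k → Fin (Module.finrank ℝ E)) → ℝ) :=
    { toFun := fun a f => a (fun i => b (f i))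
      map_add' := fun _ _ => rfl
      map_smul' := fun _ _ => rfl }
  have hinj : LinearMap.ker Φ = ⊥ := by
    refine LinearMap.ker_eq_bot.2 fun a a' h => ?_
    have : a.toAlternatingMap = a'.toAlternatingMap := by
      refine AlternatingMap.coe_multilinearMap_injective (Module.Basis.ext_multilinear (fun _ => b) fun f => ?_)
      exact congrFun h f
    exact ContinuousAlternatingMap.toAlternatingMap_injective this
  obtain ⟨R, hR⟩ := Φ.exists_leftInverse_of_injective hinj
  refine ⟨_, inferInstance, fun f i => b (f i), LinearMap.toContinuousLinearMap R, fun a => ?_⟩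
  exact LinearMap.congr_fun hR a

theorem contDiffAt_alt_iff [FiniteDimensional ℝ E] {A : P → E [⋀^Fin k]→L[ℝ] ℝ} {x : P} {n : WithTop ℕ∞} :
    ContDiffAt ℝ n A x ↔ ∀ v, ContDiffAt ℝ n (fun p => A p v) x := by
  refine ⟨fun h v => (altEval v).contDiff.contDiffAt.comp x h, fun h => ?_⟩
  obtain ⟨ι, _, w, R, hR⟩ := exists_leftInverse_altEval (E := E) (k := k)
  have : A = fun p => R (fun i => A p (w i)) := funext fun p => (hR _).symm
  rw [this]
  exact R.contDiff.contDiffAt.comp x (contDiffAt_pi.2 fun i => h (w i))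

theorem contDiff_alt_iff [FiniteDimensional ℝ E] {A : P → E [⋀^Fin k]→L[ℝ] ℝ} {n : WithTop ℕ∞} :
    ContDiff ℝ n A ↔ ∀ v, ContDiff ℝ n (fun p => A p v) := by
  simp only [contDiff_iff_contDiffAt, contDiffAt_alt_iff]
  exact forall_comm

theorem continuous_alt_iff [FiniteDimensional ℝ E] {X : Type*} [TopologicalSpace X]
    {A : X → E [⋀^Fin k]→L[ℝ] ℝ} : Continuous A ↔ ∀ v, Continuous (fun p => A p v) := by
  refine ⟨fun h v => (altEval v).continuous.comp h, fun h => ?_⟩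
  obtain ⟨ι, _, w, R, hR⟩ := exists_leftInverse_altEval (E := E) (k := k)
  have : A = fun p => R (fun i => A p (w i)) := funext fun p => (hR _).symm
  rw [this]
  exact R.continuous.comp (continuous_pi fun i => h (w i))

/-- Precomposition is linear in the form and multilinear in the k copies of the linear map. -/
theorem contDiffAt_altComp [FiniteDimensional ℝ F] {A : P → E [⋀^Fin k]→L[ℝ] ℝ} {L : P → F →L[ℝ] E} {x : P} {n : WithTop ℕ∞}
    (hA : ContDiffAt ℝ n A x) (hL : ContDiffAt ℝ n L x) :
    ContDiffAt ℝ n (fun p => (A p).compContinuousLinearMap (L p)) x := by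
  refine contDiffAt_alt_iff.2 fun v => ?_
  have h1 : ContDiffAt ℝ n (fun p => ContinuousAlternatingMap.toContinuousMultilinearMapCLM ℝ (A p)) x :=
    (ContinuousLinearMap.contDiff _).contDiffAt.comp x hA
  have h3 : ContDiff ℝ n (fun L : Fin k → F →L[ℝ] E =>
      ContinuousMultilinearMap.compContinuousLinearMapContinuousMultilinear ℝ
        (fun _ : Fin k => F) (fun _ => E) ℝ L) := ContinuousMultilinearMap.contDiff _
  have h2 := h3.contDiffAt.comp x (contDiffAt_pi.2 fun _ : Fin k => hL)
  exact (ContinuousLinearMap.contDiff (ContinuousMultilinearMap.apply ℝ (fun _ : Fin k => F) ℝ v)).contDiffAt.comp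
    x (h2.clm_apply h1)

end AltValued

/-! ### Pullback of forms to normed spaces -/

section Mpull

variable {n : ℕ} {M : Type*} [TopologicalSpace M] [ChartedSpace (Fin n → ℂ) M] {k l : ℕ}
variable {F G : Type*} [NormedAddCommGroup F] [NormedSpace ℝ F] [NormedAddCommGroup G]
  [NormedSpace ℝ G]

/-- The derivative of a map from a normed space to `M`. -/
def mderiv (g : F → M) (x : F) : F →L[ℝ] (Fin n → ℂ) :=
  mfderiv 𝓘(ℝ, F) 𝓘(ℝ, Fin n → ℂ) g x

/-- The pullback of a form to a normed space. -/
def mpull (g : F → M) (η : Form n M k) (x : F) : F [⋀^Fin k]→L[ℝ] ℝ :=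
  (η (g x)).compContinuousLinearMap (mderiv g x)

theorem mpull_apply (g : F → M) (η : Form n M k) (x : F) (v : Fin k → F) :
    mpull g η x v = η (g x) (fun i => mderiv g x (v i)) := rfl

theorem pullback_eq_mpull (g : (Fin n → ℂ) → M) (η : Form n M k) : pullback g η = mpull g η := rfl

theorem mpull_congr {g g' : F → M} {x : F} (h : g =ᶠ[𝓝 x] g') (η : Form n M k) :
    mpull g η x = mpull g' η x := by
  unfold mpull mderiv
  rw [h.eq_of_nhds, h.mfderiv_eq]

theorem mderiv_comp {g : F → M} {h : G → F} {x : G}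
    (hg : MDifferentiableAt 𝓘(ℝ, F) 𝓘(ℝ, Fin n → ℂ) g (h x)) (hh : DifferentiableAt ℝ h x) :
    mderiv (n := n) (fun y => g (h y)) x = (mderiv g (h x)).comp (fderiv ℝ h x) := by
  have := mfderiv_comp x hg hh.mdifferentiableAt
  rw [mfderiv_eq_fderiv] at this
  exact this

theorem mpull_comp {g : F → M} {h : G → F} {x : G}
    (hg : MDifferentiableAt 𝓘(ℝ, F) 𝓘(ℝ, Fin n → ℂ) g (h x)) (hh : DifferentiableAt ℝ h x)
    (η : Form n M k) :
    mpull (fun y => g (h y)) η x = (mpull g η (h x)).compContinuousLinearMap (fderiv ℝ h x) := by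
  unfold mpull
  rw [mderiv_comp hg hh]
  rfl

theorem mpull_pullback {s : M → M} {g : F → M} {x : F}
    (hs : MDifferentiableAt 𝓘(ℝ, Fin n → ℂ) 𝓘(ℝ, Fin n → ℂ) s (g x))
    (hg : MDifferentiableAt 𝓘(ℝ, F) 𝓘(ℝ, Fin n → ℂ) g x) (η : Form n M k) :
    mpull g (pullback s η) x = mpull (fun y => s (g y)) η x := by
  have := mfderiv_comp x hs hg
  unfold mpull pullback mderiv realDeriv
  change _ = ContinuousAlternatingMap.compContinuousLinearMap _ (mfderiv 𝓘(ℝ, F) 𝓘(ℝ, Fin n → ℂ) (s ∘ g) x)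
  rw [this]
  rfl

theorem mpull_wedge (g : F → M) (α : Form n M k) (β : Form n M l) (x : F) :
    mpull g (wedge α β) x = wedgeAlt (mpull g α x) (mpull g β x) :=
  wedgeAlt_compContinuousLinearMap _ _ _

variable [IsManifold 𝓘(ℝ, Fin n → ℂ) ∞ M]

/-- Factor g locally through the chart at g x: the pullback is the chart expression of the form,
composed with the derivative of the chart expression of g. -/
theorem contDiffAt_mpull [FiniteDimensional ℝ F] {η : Form n M k} (hη : IsSmooth η) {g : F → M} {x : F}
    (hg : ∀ᶠ y in 𝓝 x, ContMDiffAt 𝓘(ℝ, F) 𝓘(ℝ, Fin n → ℂ) ∞ g y) :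
    ContDiffAt ℝ ∞ (mpull g η) x := by
  let e := chartAt (Fin n → ℂ) (g x)
  have hx : g x ∈ e.source := mem_chart_source _ _
  have hsrc : ∀ᶠ y in 𝓝 x, g y ∈ e.source := hg.self_of_nhds.continuousAt (e.open_source.mem_nhds hx)
  have heg : ∀ᶠ y in 𝓝 x, ContDiffAt ℝ ∞ (fun z => e (g z)) y := by
    filter_upwards [hg, hsrc] with y hy hy'
    rw [← contMDiffAt_iff_contDiffAt]
    exact ContMDiffAt.comp y (contMDiffAt_of_mem_maximalAtlas
      (IsManifold.chart_mem_maximalAtlas _) hy') hy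
  have hesymm : ∀ w ∈ e.target, ContMDiffAt 𝓘(ℝ, Fin n → ℂ) 𝓘(ℝ, Fin n → ℂ) ∞ e.symm w := fun w hw =>
    contMDiffAt_symm_of_mem_maximalAtlas (IsManifold.chart_mem_maximalAtlas _) hw
  have heq : mpull g η =ᶠ[𝓝 x] fun y =>
      (mpull e.symm η (e (g y))).compContinuousLinearMap (fderiv ℝ (fun z => e (g z)) y) := by
    filter_upwards [hsrc.eventually_nhds, heg] with y hy hy'
    rw [← mpull_comp (h := fun z => e (g z)) ((hesymm _ (e.map_source hy.self_of_nhds)).mdifferentiableAt (by simp)) (hy'.differentiableAt (by simp))]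
    refine mpull_congr ?_ η
    filter_upwards [hy] with z hz using (e.left_inv hz).symm
  refine ContDiffAt.congr_of_eventuallyEq ?_ heq
  refine contDiffAt_altComp ?_ ?_
  · refine ContDiffAt.comp x (g := mpull e.symm η) ?_ heg.self_of_nhds
    exact (hη e (chart_mem_atlas _ _)).contDiffAt (e.open_target.mem_nhds (e.map_source hx))
  · exact heg.self_of_nhds.fderiv_right (m := ∞) (by simp)

/-- The charts Q need not belong to the atlas and may be modelled on any F, so smoothness can be
tested in linear charts and in ball coordinates. -/
theorem isSmooth_of_forall_exists [FiniteDimensional ℝ F] {η : Form n M k}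
    (h : ∀ p, ∃ Q : OpenPartialHomeomorph M F, p ∈ Q.source ∧
      ContMDiffOn 𝓘(ℝ, Fin n → ℂ) 𝓘(ℝ, F) ∞ Q Q.source ∧
      ContMDiffOn 𝓘(ℝ, F) 𝓘(ℝ, Fin n → ℂ) ∞ Q.symm Q.target ∧
      ContDiffAt ℝ ∞ (mpull Q.symm η) (Q p)) : IsSmooth η := by
  intro e he x hx
  refine ContDiffAt.contDiffWithinAt ?_
  obtain ⟨Q, hp, hQ, hQ', hd⟩ := h (e.symm x)
  have hmem : ∀ᶠ y in 𝓝 x, e.symm y ∈ Q.source :=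
    (e.continuousAt_symm hx) (Q.open_source.mem_nhds hp)
  have hQe : ∀ᶠ y in 𝓝 x, ContDiffAt ℝ ∞ (fun z => Q (e.symm z)) y := by
    filter_upwards [hmem, e.open_target.mem_nhds hx] with y hy hy'
    rw [← contMDiffAt_iff_contDiffAt]
    exact ContMDiffAt.comp y (hQ.contMDiffAt (Q.open_source.mem_nhds hy))
      (contMDiffAt_symm_of_mem_maximalAtlas (IsManifold.subset_maximalAtlas he) hy')
  have heq : pullback e.symm η =ᶠ[𝓝 x] fun y =>
      (mpull Q.symm η (Q (e.symm y))).compContinuousLinearMap (fderiv ℝ (fun z => Q (e.symm z)) y) := by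
    filter_upwards [hmem.eventually_nhds, hQe] with y hy hy'
    rw [← mpull_comp (h := fun z => Q (e.symm z)) ((hQ'.contMDiffAt (Q.open_target.mem_nhds (Q.map_source hy.self_of_nhds))).mdifferentiableAt (by simp)) (hy'.differentiableAt (by simp)), pullback_eq_mpull]
    refine mpull_congr ?_ η
    filter_upwards [hy] with z hz using (Q.left_inv hz).symm
  refine ContDiffAt.congr_of_eventuallyEq ?_ heq
  exact contDiffAt_altComp (ContDiffAt.comp x (g := mpull Q.symm η) hd hQe.self_of_nhds)
    (hQe.self_of_nhds.fderiv_right (m := ∞) (by simp))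

end Mpull
end DeRham
end
noncomputable section

/-! ### Smoothness of parametric integrals -/

namespace DeRham

open MeasureTheory

/-- Since f and its derivative are bounded, a multiple of |w| dominates the derivative; the shift C
p therefore only has to be measurable in p. -/
theorem hasFDerivAt_integral_smul_comp_sub {E : Type} [NormedAddCommGroup E] [NormedSpace ℝ E]
    {P G : Type} [MeasurableSpace P] [NormedAddCommGroup G] [NormedSpace ℝ G]
    {μ : Measure P} {f : E → G} (hf : ContDiff ℝ ∞ f) (hc : HasCompactSupport f)
    {C : P → E} (hC : AEStronglyMeasurable C μ) {w : P → ℝ} (hw : Integrable w μ) (x : E) :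
    HasFDerivAt (fun x => ∫ p, w p • f (x - C p) ∂μ) (∫ p, w p • fderiv ℝ f (x - C p) ∂μ) x := by
  have hf1 : ContDiff ℝ 1 f := hf.of_le (by simp)
  have hcont : Continuous (fderiv ℝ f) := hf1.continuous_fderiv (by simp)
  obtain ⟨B, hB⟩ := hf.continuous.bounded_above_of_compact_support hc
  obtain ⟨B', hB'⟩ := hcont.bounded_above_of_compact_support (hc.fderiv (𝕜 := ℝ))
  refine hasFDerivAt_integral_of_dominated_of_fderiv_le (μ := μ) (𝕜 := ℝ)
    (F := fun x p => w p • f (x - C p)) (F' := fun x p => w p • fderiv ℝ f (x - C p))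
    (s := Set.univ) (bound := fun p => ‖w p‖ * B') (x₀ := x)
    Filter.univ_mem ?_ ?_ ?_ ?_ ?_ ?_
  · refine Filter.Eventually.of_forall fun y => ?_
    exact hw.1.smul (hf.continuous.comp_aestronglyMeasurable (aestronglyMeasurable_const.sub hC))
  · refine Integrable.mono' (hw.norm.mul_const B) (hw.1.smul (hf.continuous.comp_aestronglyMeasurable
      (aestronglyMeasurable_const.sub hC))) (Filter.Eventually.of_forall fun p => ?_)
    rw [norm_smul]
    exact mul_le_mul_of_nonneg_left (hB _) (norm_nonneg _)
  · exact hw.1.smul (hcont.comp_aestronglyMeasurable (aestronglyMeasurable_const.sub hC))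
  · refine Filter.Eventually.of_forall fun p y _ => ?_
    rw [norm_smul]
    exact mul_le_mul_of_nonneg_left (hB' _) (norm_nonneg _)
  · exact hw.norm.mul_const _
  · refine Filter.Eventually.of_forall fun p y _ => ?_
    have h1 : HasFDerivAt f (fderiv ℝ f (y - C p)) (y - C p) :=
      (hf1.differentiable (by simp) _).hasFDerivAt
    have h2 : HasFDerivAt (fun y => y - C p) (ContinuousLinearMap.id ℝ E) y :=
      (hasFDerivAt_id y).sub_const _
    have h3 := (h1.comp y h2).const_smul (w p)
    rw [ContinuousLinearMap.comp_id] at h3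
    exact h3

/-- The derivative is an integral of the same shape with f replaced by its derivative, so induction
on the order works once the target space G is allowed to vary. -/
theorem contDiff_integral_smul_comp_sub {E : Type} [NormedAddCommGroup E] [NormedSpace ℝ E]
    {P G : Type} [MeasurableSpace P] [NormedAddCommGroup G] [NormedSpace ℝ G]
    {μ : Measure P} {f : E → G} (hf : ContDiff ℝ ∞ f) (hc : HasCompactSupport f)
    {C : P → E} (hC : AEStronglyMeasurable C μ) {w : P → ℝ} (hw : Integrable w μ) :
    ContDiff ℝ ∞ (fun x => ∫ p, w p • f (x - C p) ∂μ) := by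
  rw [contDiff_infty]
  intro n
  induction n generalizing G with
  | zero =>
    refine contDiff_zero.2 ?_
    exact continuous_iff_continuousAt.2 fun x =>
      (hasFDerivAt_integral_smul_comp_sub hf hc hC hw x).continuousAt
  | succ n ih =>
    push_cast
    rw [contDiff_succ_iff_hasFDerivAt]
    refine ⟨fun x => ∫ p, w p • fderiv ℝ f (x - C p) ∂μ, ih (hf.fderiv_right (m := ∞) (by simp)) (hc.fderiv (𝕜 := ℝ)),
      fun x => hasFDerivAt_integral_smul_comp_sub hf hc hC hw x⟩

/-- The integral is the value at 0 of the convolution of the constant 1 with the parameter-dependent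
function t ↦ f (-t) G (-t, x). The compact support of f gives a support condition uniform in x. -/
theorem contDiffOn_integral_mul {Y X : Type*} [NormedAddCommGroup Y] [NormedSpace ℝ Y]
    [FiniteDimensional ℝ Y] [MeasurableSpace Y] [BorelSpace Y] (μ : Measure Y) [μ.IsAddHaarMeasure]
    [NormedAddCommGroup X] [NormedSpace ℝ X] {Ω : Set X} (hΩ : IsOpen Ω) {f : Y → ℝ}
    (hf : ContDiff ℝ ∞ f) (hc : HasCompactSupport f) {G : Y × X → ℝ}
    (hG : ContDiffOn ℝ ∞ G (Set.univ ×ˢ Ω)) :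
    ContDiffOn ℝ ∞ (fun x => ∫ y, f y * G (y, x) ∂μ) Ω := by
  have h := contDiffOn_convolution_right_with_param (μ := μ) (n := ⊤) (f := fun _ : Y => (1 : ℝ))
    (ContinuousLinearMap.mul ℝ ℝ) (g := fun x t => f (-t) * G (-t, x)) hΩ
    (k := (fun y => -y) ⁻¹' tsupport f) ?_ ?_ ?_ ?_
  · have h2 := h.comp (s := Ω) (f := fun x => (x, (0 : Y))) (contDiff_id.prodMk contDiff_const).contDiffOn
      (fun x hx => ⟨hx, Set.mem_univ _⟩)
    refine h2.congr fun x _ => ?_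
    simp [convolution_def]
  · exact (Homeomorph.neg Y).isCompact_preimage.2 hc
  · intro x t _ ht
    have : f (-t) = 0 := image_eq_zero_of_notMem_tsupport ht
    simp [this]
  · exact locallyIntegrable_const 1
  · refine ContDiffOn.mul (f := fun q : X × Y => f (-q.2)) (g := fun q => G (-q.2, q.1)) ?_ ?_
    · exact (hf.comp contDiff_snd.neg).contDiffOn
    · exact hG.comp (contDiff_snd.neg.prodMk contDiff_fst).contDiffOn fun q hq => ⟨Set.mem_univ _, hq.1⟩

end DeRham

/-! ### Constant two-forms on `ℝ⁴` -/

namespace DeRham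

/-- The real space of dimension four on which the charts are modelled. -/
abbrev R4 : Type := EuclideanSpace ℝ (Fin (2 * 2))

/-- The standard basis vectors. -/
def e4 (i : Fin (2 * 2)) : R4 := EuclideanSpace.single i 1

theorem e4_apply (i j : Fin (2 * 2)) : e4 i j = if j = i then 1 else 0 := by
  simp [e4]

/-- The two-form with coefficient function `c`: `∑_{i<j} c_{ij} dx_i ∧ dx_j`. -/
def coeffForm (c : Fin 6 → ℝ) : R4 [⋀^Fin 2]→L[ℝ] ℝ :=
  { toFun := fun v => c 0 * (v 0 0 * v 1 1 - v 0 1 * v 1 0) + c 1 * (v 0 0 * v 1 2 - v 0 2 * v 1 0)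
      + c 2 * (v 0 0 * v 1 3 - v 0 3 * v 1 0) + c 3 * (v 0 1 * v 1 2 - v 0 2 * v 1 1)
      + c 4 * (v 0 1 * v 1 3 - v 0 3 * v 1 1) + c 5 * (v 0 2 * v 1 3 - v 0 3 * v 1 2)
    map_update_add' := by
      intro inst v i x y
      rw [Subsingleton.elim inst (instDecidableEqFin 2)]
      fin_cases i <;> simp [Function.update] <;> ring
    map_update_smul' := by
      intro inst v i x y
      rw [Subsingleton.elim inst (instDecidableEqFin 2)]
      fin_cases i <;> simp [Function.update] <;> ring
    map_eq_zero_of_eq' := by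
      intro v i j h hij
      have : v 0 = v 1 := by
        fin_cases i <;> fin_cases j <;> simp_all
      simp only [this]; ring
    cont := by fun_prop }

theorem coeffForm_apply (c : Fin 6 → ℝ) (v : Fin 2 → R4) : coeffForm c v =
    c 0 * (v 0 0 * v 1 1 - v 0 1 * v 1 0) + c 1 * (v 0 0 * v 1 2 - v 0 2 * v 1 0)
      + c 2 * (v 0 0 * v 1 3 - v 0 3 * v 1 0) + c 3 * (v 0 1 * v 1 2 - v 0 2 * v 1 1)
      + c 4 * (v 0 1 * v 1 3 - v 0 3 * v 1 1) + c 5 * (v 0 2 * v 1 3 - v 0 3 * v 1 2) := rfl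

/-- The two-form `v ↦ det (p, q, v_0, v_1)`. -/
def starForm (p q : R4) : R4 [⋀^Fin 2]→L[ℝ] ℝ :=
  coeffForm ![p 2 * q 3 - p 3 * q 2, -(p 1 * q 3 - p 3 * q 1), p 1 * q 2 - p 2 * q 1,
    p 0 * q 3 - p 3 * q 0, -(p 0 * q 2 - p 2 * q 0), p 0 * q 1 - p 1 * q 0]

theorem starForm_apply (p q : R4) (v : Fin 2 → R4) : starForm p q v =
    (p 2 * q 3 - p 3 * q 2) * (v 0 0 * v 1 1 - v 0 1 * v 1 0)
      - (p 1 * q 3 - p 3 * q 1) * (v 0 0 * v 1 2 - v 0 2 * v 1 0)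
      + (p 1 * q 2 - p 2 * q 1) * (v 0 0 * v 1 3 - v 0 3 * v 1 0)
      + (p 0 * q 3 - p 3 * q 0) * (v 0 1 * v 1 2 - v 0 2 * v 1 1)
      - (p 0 * q 2 - p 2 * q 0) * (v 0 1 * v 1 3 - v 0 3 * v 1 1)
      + (p 0 * q 1 - p 1 * q 0) * (v 0 2 * v 1 3 - v 0 3 * v 1 2) := by
  rw [starForm, coeffForm_apply]
  simp only [Matrix.cons_val]
  ring

/-- Exchanging two pairs of columns of a determinant is an even permutation. -/
theorem starForm_symm (p q v w : R4) : starForm p q ![v, w] = starForm v w ![p, q] := by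
  simp only [starForm_apply, Matrix.cons_val_zero, Matrix.cons_val_one]
  ring

theorem alt_eq_sum (B : R4 [⋀^Fin 2]→L[ℝ] ℝ) (p q : R4) : B ![p, q] =
    (p 0 * q 1 - p 1 * q 0) * B ![e4 0, e4 1] + (p 0 * q 2 - p 2 * q 0) * B ![e4 0, e4 2]
      + (p 0 * q 3 - p 3 * q 0) * B ![e4 0, e4 3] + (p 1 * q 2 - p 2 * q 1) * B ![e4 1, e4 2]
      + (p 1 * q 3 - p 3 * q 1) * B ![e4 1, e4 3] + (p 2 * q 3 - p 3 * q 2) * B ![e4 2, e4 3] := by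
  have hsum : ∀ p : R4, p = p 0 • e4 0 + p 1 • e4 1 + p 2 • e4 2 + p 3 • e4 3 := by
    intro p
    ext i
    fin_cases i <;> simp [e4_apply]
  have hup : ∀ x z u : R4, Function.update ![x, z] 0 u = ![u, z] := by
    intro x z u
    ext i j; fin_cases i <;> rfl
  have hadd0 : ∀ x y z : R4, B ![x + y, z] = B ![x, z] + B ![y, z] := fun x y z => by
    have := B.toAlternatingMap.map_update_add ![x, z] 0 x y
    simp only [hup] at this
    exact this
  have hadd1 : ∀ x y z : R4, B ![z, x + y] = B ![z, x] + B ![z, y] := fun x y z => by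
    rw [alt_two_swap, hadd0, alt_two_swap B x, alt_two_swap B y]; ring
  have hsm0 : ∀ (c : ℝ) (x z : R4), B ![c • x, z] = c * B ![x, z] := fun c x z => by
    have := B.toAlternatingMap.map_update_smul ![x, z] 0 c x
    simp only [hup] at this
    exact this
  have hsm1 : ∀ (c : ℝ) (x z : R4), B ![z, c • x] = c * B ![z, x] := fun c x z => by
    rw [alt_two_swap, hsm0, alt_two_swap B x]; ring
  have h0 : ∀ x : R4, B ![x, x] = 0 := fun x => by
    have := alt_two_swap B x x; linarith
  conv_lhs => rw [hsum p, hsum q]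
  simp only [hadd0, hadd1, hsm0, hsm1, h0]
  rw [alt_two_swap B (e4 1) (e4 0), alt_two_swap B (e4 2) (e4 0), alt_two_swap B (e4 3) (e4 0),
    alt_two_swap B (e4 2) (e4 1), alt_two_swap B (e4 3) (e4 1), alt_two_swap B (e4 3) (e4 2)]
  ring

/-- `starForm p q` is the Poincaré dual of the bivector p ∧ q. This identity turns integrals over
surfaces with tangent vectors p, q into integrals of four-forms. -/
theorem wedgeAlt_starForm_right (p q : R4) (B : R4 [⋀^Fin 2]→L[ℝ] ℝ) :
    wedgeAlt B (starForm p q) e4 = B ![p, q] := by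
  rw [wedgeAlt_two_two, alt_eq_sum B p q]
  simp [starForm_apply, e4_apply]
  ring

theorem alt_four_comp_eq_det (η : R4 [⋀^Fin (2 + 2)]→L[ℝ] ℝ) (L : R4 →L[ℝ] R4) :
    η (fun i => L (e4 i)) = L.det * η e4 := by
  let b : Module.Basis (Fin (2 + 2)) ℝ R4 := (EuclideanSpace.basisFun (Fin (2 * 2)) ℝ).toBasis
  have hb : (b : Fin (2 + 2) → R4) = e4 := by
    funext i; simp [b, e4]
  have h := η.toAlternatingMap.eq_smul_basis_det b
  have h2 : η (fun i => L (e4 i)) = η b * b.det (fun i => L (b i)) := by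
    rw [hb]
    have := congrArg (fun f => f (fun i => L (e4 i))) h
    simpa [hb] using this
  rw [h2, hb, mul_comm]
  congr 1
  have := b.det_comp (L : R4 →ₗ[ℝ] R4) b
  rw [b.det_self, mul_one, hb] at this
  exact this

end DeRham
end
noncomputable section

/-! ### The topology of projective space -/

namespace ProjSpace

variable {n : ℕ}

/-- Proportionality is the vanishing of the 2 × 2 minors. Being a closed condition on pairs, it
makes the quotient Hausdorff. -/
theorem mk_eq_mk_iff_forall (v w : Fin (n + 1) → ℂ) (hv : v ≠ 0) (hw : w ≠ 0) :
    Projectivization.mk ℂ v hv = Projectivization.mk ℂ w hw ↔ ∀ i j, v i * w j = v j * w i := by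
  rw [Projectivization.mk_eq_mk_iff']
  constructor
  · rintro ⟨c, rfl⟩ i j
    simp only [Pi.smul_apply, smul_eq_mul]; ring
  · intro h
    obtain ⟨i, hi⟩ := Function.ne_iff.1 hw
    refine ⟨v i / w i, funext fun j => ?_⟩
    have hi' : w i ≠ 0 := hi
    simp only [Pi.smul_apply, smul_eq_mul]
    rw [div_mul_eq_mul_div, div_eq_iff hi', h i j]

theorem isOpenMap_mk' :
    IsOpenMap (Projectivization.mk' ℂ : {v : Fin (n + 1) → ℂ // v ≠ 0} → CP n) := by
  intro U hU
  rw [← isQuotientMap_mk'.isOpen_preimage]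
  have : (Projectivization.mk' ℂ : {v : Fin (n + 1) → ℂ // v ≠ 0} → CP n) ⁻¹'
      (Projectivization.mk' ℂ '' U) =
      ⋃ c : ℂˣ, (fun v : {v : Fin (n + 1) → ℂ // v ≠ 0} =>
        (⟨c • v.1, by simpa [Units.smul_def] using v.2⟩ : {v : Fin (n + 1) → ℂ // v ≠ 0})) ⁻¹' U := by
    ext ⟨v, hv⟩
    simp only [Set.mem_preimage, Set.mem_image, Set.mem_iUnion]
    constructor
    · rintro ⟨⟨u, hu⟩, huU, h⟩
      obtain ⟨c, hc⟩ := (Projectivization.mk_eq_mk_iff ℂ u v hu hv).1 h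
      refine ⟨c, ?_⟩
      convert huU
    · rintro ⟨c, hc⟩
      refine ⟨_, hc, ?_⟩
      exact (Projectivization.mk_eq_mk_iff ℂ _ v _ hv).2 ⟨c, rfl⟩
  rw [this]
  refine isOpen_iUnion fun c => hU.preimage ?_
  exact (continuous_subtype_val.const_smul c).subtype_mk _

theorem isOpenQuotientMap_mk' :
    IsOpenQuotientMap (Projectivization.mk' ℂ : {v : Fin (n + 1) → ℂ // v ≠ 0} → CP n) :=
  ⟨isQuotientMap_mk'.surjective, isQuotientMap_mk'.continuous, isOpenMap_mk'⟩

instance : T2Space (CP n) := by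
  rw [t2Space_iff_of_isOpenQuotientMap isOpenQuotientMap_mk']
  have : {q : {v : Fin (n + 1) → ℂ // v ≠ 0} × {v : Fin (n + 1) → ℂ // v ≠ 0} |
      (Projectivization.mk' ℂ q.1 : CP n) = Projectivization.mk' ℂ q.2} =
      ⋂ i, ⋂ j, {q | q.1.1 i * q.2.1 j = q.1.1 j * q.2.1 i} := by
    ext ⟨⟨v, hv⟩, ⟨w, hw⟩⟩
    simp only [Set.mem_ofPred_eq, Set.mem_iInter]
    exact mk_eq_mk_iff_forall v w hv hw
  rw [this]
  have hc1 : ∀ i : Fin (n + 1), Continuous fun q : {v : Fin (n + 1) → ℂ // v ≠ 0} ×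
      {v : Fin (n + 1) → ℂ // v ≠ 0} => q.1.1 i := fun i =>
    (continuous_apply i).comp (continuous_subtype_val.comp continuous_fst)
  have hc2 : ∀ i : Fin (n + 1), Continuous fun q : {v : Fin (n + 1) → ℂ // v ≠ 0} ×
      {v : Fin (n + 1) → ℂ // v ≠ 0} => q.2.1 i := fun i =>
    (continuous_apply i).comp (continuous_subtype_val.comp continuous_snd)
  exact isClosed_iInter fun i => isClosed_iInter fun j =>
    isClosed_eq ((hc1 i).mul (hc2 j)) ((hc1 j).mul (hc2 i))

instance : CompactSpace (CP n) := by
  have hc : Continuous fun v : Metric.sphere (0 : Fin (n + 1) → ℂ) 1 =>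
      (Projectivization.mk' ℂ ⟨v.1, ne_zero_of_mem_unit_sphere v⟩ : CP n) :=
    isQuotientMap_mk'.continuous.comp (continuous_subtype_val.subtype_mk _)
  have := isCompact_range hc
  rw [← isCompact_univ_iff]
  convert this
  symm
  rw [Set.eq_univ_iff_forall]
  intro p
  induction p using Projectivization.ind with
  | h v hv =>
    have hn : ‖v‖ ≠ 0 := norm_ne_zero_iff.2 hv
    refine ⟨⟨((‖v‖ : ℂ)⁻¹) • v, ?_⟩, ?_⟩
    · simp [norm_smul, hn]
    · refine (Projectivization.mk_eq_mk_iff' ℂ _ v _ hv).2 ⟨(‖v‖ : ℂ)⁻¹, rfl⟩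

/-! ### Smooth maps to and from projective space -/

variable {F : Type*} [NormedAddCommGroup F] [NormedSpace ℝ F]

theorem affineChart_mem_atlas (i : Fin (n + 1)) :
    affineChart i ∈ atlas (Fin n → ℂ) (CP n) := ⟨i, rfl⟩

theorem contMDiffAt_mk {v : F → Fin (n + 1) → ℂ} (hv : ∀ x, v x ≠ 0) {x : F}
    (h : ContDiffAt ℝ ∞ v x) :
    ContMDiffAt 𝓘(ℝ, F) 𝓘(ℝ, Fin n → ℂ) ∞ (fun y => (Projectivization.mk ℂ (v y) (hv y) : CP n)) x := by
  obtain ⟨i, hi⟩ := Function.ne_iff.1 (hv x)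
  have hne : ∀ᶠ y in 𝓝 x, v y i ≠ 0 :=
    ((continuous_apply i).continuousAt.comp h.continuousAt).eventually_ne hi
  have heq : (fun y => (Projectivization.mk ℂ (v y) (hv y) : CP n)) =ᶠ[𝓝 x]
      fun y => (affineChart i).symm (fun j => v y (i.succAbove j) / v y i) := by
    filter_upwards [hne] with y hy
    exact ((affineChart i).left_inv ((mk_mem_affineOpen i _ (hv y)).2 hy)).symm
  refine ContMDiffAt.congr_of_eventuallyEq ?_ heq
  refine ContMDiffAt.comp x (g := (affineChart i).symm) (I' := 𝓘(ℝ, Fin n → ℂ)) ?_ ?_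
  · exact contMDiffAt_symm_of_mem_maximalAtlas
      (IsManifold.subset_maximalAtlas (affineChart_mem_atlas i)) (Set.mem_univ _)
  · refine ContDiffAt.contMDiffAt (contDiffAt_pi.2 fun j => ?_)
    have hj := fun k => contDiffAt_pi.1 h k
    exact (hj _).mul ((hj i).inv hi)

/-- Compose with a local section of the quotient map. The section is scaled to pass through the
chosen representative v, so that g has to be smooth only at v. -/
theorem contMDiffAt_of_comp_mk {f : CP n → F} {v : Fin (n + 1) → ℂ} (hv : v ≠ 0)
    {g : (Fin (n + 1) → ℂ) → F} (hg : ContDiffAt ℝ ∞ g v)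
    (hfg : ∀ w (hw : w ≠ 0), f (Projectivization.mk ℂ w hw) = g w) :
    ContMDiffAt 𝓘(ℝ, Fin n → ℂ) 𝓘(ℝ, F) ∞ f (Projectivization.mk ℂ v hv) := by
  obtain ⟨i, hi⟩ := Function.ne_iff.1 hv
  have hi' : v i ≠ 0 := hi
  set p : CP n := Projectivization.mk ℂ v hv with hp
  have hpi : p ∈ (affineChart i).source := (mk_mem_affineOpen i v hv).2 hi
  let s : (Fin n → ℂ) → (Fin (n + 1) → ℂ) := fun w => v i • i.insertNth (1 : ℂ) w
  have hs : ContDiff ℝ ∞ s := by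
    refine contDiff_pi.2 fun k => ?_
    refine ContDiff.mul contDiff_const ?_
    refine Fin.succAboveCases i ?_ (fun k => ?_) k
    · simpa using contDiff_const
    · simpa using contDiff_apply ℝ ℂ k
  have hsv : s (affineChart i p) = v := by
    funext k
    refine Fin.succAboveCases i ?_ (fun k => ?_) k
    · simp [s]
    · simp only [s, Pi.smul_apply, Fin.insertNth_apply_succAbove, smul_eq_mul]
      change v i * (v (i.succAbove k) / v i) = _
      field_simp
  have heq : f =ᶠ[𝓝 p] fun q => g (s (affineChart i q)) := by
    filter_upwards [(affineChart i).open_source.mem_nhds hpi] with q hqs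
    have hsq : s (affineChart i q) ≠ 0 := smul_ne_zero hi' (insertNth_ne_zero i _)
    rw [← hfg _ hsq]
    congr 1
    refine ((affineChart i).left_inv hqs).symm.trans ?_
    exact (Projectivization.mk_eq_mk_iff' ℂ _ _ (insertNth_ne_zero i _) hsq).2
      ⟨(v i)⁻¹, by simp only [s, inv_smul_smul₀ hi']⟩
  refine ContMDiffAt.congr_of_eventuallyEq ?_ heq
  have hg' : ContDiffAt ℝ ∞ (fun w => g (s w)) (affineChart i p) :=
    ContDiffAt.comp _ (by rw [hsv]; exact hg) hs.contDiffAt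
  exact hg'.contMDiffAt.comp p (contMDiffAt_of_mem_maximalAtlas
    (IsManifold.subset_maximalAtlas (affineChart_mem_atlas i)) hpi)

end ProjSpace
end
noncomputable section

/-! ### Complex coordinates on `ℝ⁴` -/

namespace DeRham

open MeasureTheory

/-- The identification of `ℝ⁴` with `ℂ²`. -/
def cxL : R4 ≃ₗ[ℝ] ℂ × ℂ where
  toFun x := (⟨x 0, x 1⟩, ⟨x 2, x 3⟩)
  invFun z := WithLp.toLp 2 ![z.1.re, z.1.im, z.2.re, z.2.im]
  map_add' x y := by apply Prod.ext <;> apply Complex.ext <;> simp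
  map_smul' c x := by apply Prod.ext <;> apply Complex.ext <;> simp
  left_inv x := by ext i; fin_cases i <;> rfl
  right_inv z := by ext <;> simp

def cx : R4 ≃L[ℝ] ℂ × ℂ := cxL.toContinuousLinearEquiv

theorem cx_apply (x : R4) : cx x = (⟨x 0, x 1⟩, ⟨x 2, x 3⟩) := rfl

theorem norm_sq_eq_cx (x : R4) : ‖x‖ ^ 2 = ‖(cx x).1‖ ^ 2 + ‖(cx x).2‖ ^ 2 := by
  rw [EuclideanSpace.norm_sq_eq, cx_apply, Complex.sq_norm, Complex.sq_norm,
    Complex.normSq_apply, Complex.normSq_apply]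
  refine (Fin.sum_univ_four (fun i : Fin 4 => ‖x i‖ ^ 2)).trans ?_
  simp only [Real.norm_eq_abs, sq_abs]
  ring

theorem norm_sq_cx_symm (z : ℂ × ℂ) : ‖cx.symm z‖ ^ 2 = ‖z.1‖ ^ 2 + ‖z.2‖ ^ 2 := by
  rw [norm_sq_eq_cx, ContinuousLinearEquiv.apply_symm_apply]

def cxIsometry : R4 ≃ₗᵢ[ℝ] WithLp 2 (ℂ × ℂ) where
  toLinearEquiv := cxL.trans (WithLp.linearEquiv 2 ℝ (ℂ × ℂ)).symm
  norm_map' x := by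
    rw [← sq_eq_sq₀ (norm_nonneg _) (norm_nonneg _), norm_sq_eq_cx, WithLp.prod_norm_sq_eq_of_L2]
    rfl

theorem measurePreserving_cx : MeasurePreserving cx :=
  (WithLp.volume_preserving_ofLp ℂ ℂ).comp cxIsometry.measurePreserving

theorem measurePreserving_cx_symm : MeasurePreserving cx.symm :=
  MeasurePreserving.symm cx.toHomeomorph.toMeasurableEquiv measurePreserving_cx

theorem cx_e4 : cx (e4 0) = (1, 0) ∧ cx (e4 1) = (Complex.I, 0) ∧ cx (e4 2) = (0, 1) ∧
    cx (e4 3) = (0, Complex.I) := by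
  refine ⟨?_, ?_, ?_, ?_⟩ <;> apply Prod.ext <;> apply Complex.ext <;>
    simp [cx_apply, e4_apply]

/-- `ℝ⁴` as `Fin 2 → ℂ`. -/
def cxPi : R4 ≃L[ℝ] (Fin 2 → ℂ) :=
  cx.trans (ContinuousLinearEquiv.finTwoArrow ℝ ℂ).symm

theorem cxPi_apply (x : R4) : cxPi x = ![(cx x).1, (cx x).2] := rfl

theorem measurePreserving_cxPi : MeasurePreserving cxPi :=
  (MeasurePreserving.symm _ (volume_preserving_finTwoArrow ℂ)).comp measurePreserving_cx

theorem cxPi_e4 (h : 2 + 2 = 2 * 2) (i : Fin (2 + 2)) : cxPi (e4 i) = stdFrame (n := 2) h i := by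
  obtain ⟨h0, h1, h2, h3⟩ := cx_e4
  rw [cxPi_apply]
  fin_cases i
  · rw [show ((⟨0, by norm_num⟩ : Fin (2+2)) : Fin (2 * 2)) = (0 : Fin (2*2)) from rfl, h0]
    ext j; fin_cases j <;> simp [stdFrame]
  · rw [show ((⟨1, by norm_num⟩ : Fin (2+2)) : Fin (2 * 2)) = (1 : Fin (2*2)) from rfl, h1]
    ext j; fin_cases j <;> simp [stdFrame]
  · rw [show ((⟨2, by norm_num⟩ : Fin (2+2)) : Fin (2 * 2)) = (2 : Fin (2*2)) from rfl, h2]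
    ext j; fin_cases j <;> simp [stdFrame]
  · rw [show ((⟨3, by norm_num⟩ : Fin (2+2)) : Fin (2 * 2)) = (3 : Fin (2*2)) from rfl, h3]
    ext j; fin_cases j <;> simp [stdFrame]

/-- A map of `ℝ⁴` that is complex differentiable in the coordinates of `ℂ²` preserves the
orientation. -/
theorem det_nonneg_of_hasFDerivAt_complex {Θ : R4 → R4} {x : R4} {g : ℂ × ℂ → ℂ × ℂ}
    {L : ℂ × ℂ →L[ℂ] ℂ × ℂ} (hg : HasFDerivAt g L (cx x)) (h : ∀ᶠ y in 𝓝 x, cx (Θ y) = g (cx y)) :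
    DifferentiableAt ℝ Θ x ∧ 0 ≤ (fderiv ℝ Θ x).det := by
  have h1 : HasFDerivAt (fun y => cx.symm (g (cx y)))
      ((cx.symm : ℂ × ℂ →L[ℝ] R4).comp ((L.restrictScalars ℝ).comp (cx : R4 →L[ℝ] ℂ × ℂ))) x :=
    cx.symm.hasFDerivAt.comp x ((hg.restrictScalars ℝ).comp x cx.hasFDerivAt)
  have h2 : Θ =ᶠ[𝓝 x] fun y => cx.symm (g (cx y)) := by
    filter_upwards [h] with y hy
    rw [← hy, cx.symm_apply_apply]
  have h3 := h1.congr_of_eventuallyEq h2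
  refine ⟨h3.differentiableAt, ?_⟩
  rw [h3.fderiv]
  have h4 : ((cx.symm : ℂ × ℂ →L[ℝ] R4).comp ((L.restrictScalars ℝ).comp
      (cx : R4 →L[ℝ] ℂ × ℂ))).det = LinearMap.det ((L : ℂ × ℂ →ₗ[ℂ] ℂ × ℂ).restrictScalars ℝ) :=
    LinearMap.det_conj ((L : ℂ × ℂ →ₗ[ℂ] ℂ × ℂ).restrictScalars ℝ) cx.symm.toLinearEquiv
  -- The real determinant of a complex linear map is the squared absolute value of its complex
  -- determinant.
  rw [h4, LinearMap.det_restrictScalars, Algebra.norm_complex_apply]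
  exact Complex.normSq_nonneg _

end DeRham

/-! ### Affine charts adapted to a basis -/

namespace ProjSpace

open DeRham MeasureTheory

/-- A basis of `ℂ³`. -/
abbrev Frame3 : Type := Module.Basis (Fin 3) ℂ (Fin 3 → ℂ)

variable (B : Frame3)

/-- The vector `B₀ + x₁ B₁ + x₂ B₂`. -/
def linVec (x : R4) : Fin 3 → ℂ := B 0 + (cx x).1 • B 1 + (cx x).2 • B 2

theorem equivFun_comb (c : Fin 3 → ℂ) :
    B.equivFun (c 0 • B 0 + c 1 • B 1 + c 2 • B 2) = c := by
  rw [← Fin.sum_univ_three (fun i => c i • B i), ← B.equivFun_symm_apply, LinearEquiv.apply_symm_apply]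

theorem comb_equivFun (v : Fin 3 → ℂ) :
    v = B.equivFun v 0 • B 0 + B.equivFun v 1 • B 1 + B.equivFun v 2 • B 2 := by
  rw [← Fin.sum_univ_three (fun i => B.equivFun v i • B i), B.sum_equivFun]

theorem equivFun_linVec (x : R4) : B.equivFun (linVec B x) = ![1, (cx x).1, (cx x).2] := by
  have := equivFun_comb B ![1, (cx x).1, (cx x).2]
  simpa [linVec] using this

theorem linVec_ne_zero (x : R4) : linVec B x ≠ 0 := by
  intro h
  have := congrFun (equivFun_linVec B x) 0
  rw [h] at this
  simp at this

/-- The point `[B₀ + x₁ B₁ + x₂ B₂]`. -/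
def linPoint (x : R4) : CP 2 := Projectivization.mk ℂ (linVec B x) (linVec_ne_zero B x)

/-- The affine coordinates with respect to the basis `B`. -/
def linCoord : CP 2 → R4 :=
  Projectivization.lift (fun v => cx.symm (B.equivFun v.1 1 / B.equivFun v.1 0,
    B.equivFun v.1 2 / B.equivFun v.1 0)) (by
    rintro ⟨a, ha⟩ ⟨b, hb⟩ t h
    have ht : t ≠ 0 := by
      rintro rfl
      exact ha (by simpa using h)
    simp only at h
    subst h
    simp [mul_div_mul_left _ _ ht])

theorem linCoord_mk (v : Fin 3 → ℂ) (hv : v ≠ 0) : linCoord B (Projectivization.mk ℂ v hv) =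
    cx.symm (B.equivFun v 1 / B.equivFun v 0, B.equivFun v 2 / B.equivFun v 0) := rfl

/-- The domain of the affine coordinates. -/
def linSource : Set (CP 2) := {p | ∀ v ∈ p.submodule, B.equivFun v 0 = 0 → v = 0}

theorem mk_mem_linSource (v : Fin 3 → ℂ) (hv : v ≠ 0) :
    Projectivization.mk ℂ v hv ∈ linSource B ↔ B.equivFun v 0 ≠ 0 := by
  simp only [linSource, Set.mem_ofPred_eq, Projectivization.submodule_mk,
    Submodule.mem_span_singleton]
  constructor
  · intro h h0
    exact hv (h v ⟨1, one_smul _ _⟩ h0)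
  · rintro h w ⟨c, rfl⟩ hw
    have : c = 0 := by
      rw [map_smul, Pi.smul_apply, smul_eq_mul] at hw
      exact (mul_eq_zero.1 hw).resolve_right h
    simp [this]

theorem contDiff_equivFun (i : Fin 3) : ContDiff ℝ ∞ fun v : Fin 3 → ℂ => B.equivFun v i := by
  have : ContDiff ℝ ∞ (LinearMap.toContinuousLinearMap
    ((B.equivFun : (Fin 3 → ℂ) →ₗ[ℂ] (Fin 3 → ℂ)).restrictScalars ℝ)) :=
    ContinuousLinearMap.contDiff _
  exact (contDiff_apply ℝ ℂ i).comp this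

theorem contDiff_linVec : ContDiff ℝ ∞ (linVec B) := by
  have h : ContDiff ℝ ∞ (fun x : R4 => cx x) := cx.contDiff
  exact (contDiff_const.add (h.fst.smul contDiff_const)).add (h.snd.smul contDiff_const)

theorem contMDiff_linPoint :
    ContMDiff 𝓘(ℝ, R4) 𝓘(ℝ, Fin 2 → ℂ) ∞ (linPoint B) := fun _ =>
  contMDiffAt_mk (linVec_ne_zero B) (contDiff_linVec B).contDiffAt

theorem contMDiffAt_linCoord {p : CP 2} (hp : p ∈ linSource B) :
    ContMDiffAt 𝓘(ℝ, Fin 2 → ℂ) 𝓘(ℝ, R4) ∞ (linCoord B) p := by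
  induction p using Projectivization.ind with
  | h v hv =>
    rw [mk_mem_linSource] at hp
    refine contMDiffAt_of_comp_mk hv ?_ (linCoord_mk B)
    refine cx.symm.contDiff.contDiffAt.comp v (ContDiffAt.prodMk ?_ ?_)
    · exact (contDiff_equivFun B 1).contDiffAt.mul ((contDiff_equivFun B 0).contDiffAt.inv hp)
    · exact (contDiff_equivFun B 2).contDiffAt.mul ((contDiff_equivFun B 0).contDiffAt.inv hp)

theorem isOpen_linSource : IsOpen (linSource B) := by
  rw [← isQuotientMap_mk'.isOpen_preimage]
  have : (Projectivization.mk' ℂ : {v : Fin 3 → ℂ // v ≠ 0} → CP 2) ⁻¹' linSource B =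
      {v | B.equivFun v.1 0 ≠ 0} := by
    ext ⟨v, hv⟩
    exact mk_mem_linSource B v hv
  rw [this]
  exact isOpen_ne_fun ((contDiff_equivFun B 0).continuous.comp continuous_subtype_val) continuous_const

theorem linPoint_mem_linSource (x : R4) : linPoint B x ∈ linSource B := by
  rw [linPoint, mk_mem_linSource, equivFun_linVec]
  simp

theorem linCoord_linPoint (x : R4) : linCoord B (linPoint B x) = x := by
  rw [linPoint, linCoord_mk, equivFun_linVec]
  simp

theorem linPoint_linCoord {p : CP 2} (hp : p ∈ linSource B) : linPoint B (linCoord B p) = p := by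
  induction p using Projectivization.ind with
  | h v hv =>
    rw [mk_mem_linSource] at hp
    refine (Projectivization.mk_eq_mk_iff' ℂ _ _ _ _).2 ⟨(B.equivFun v 0)⁻¹, ?_⟩
    rw [linCoord_mk, linVec, ContinuousLinearEquiv.apply_symm_apply]
    have h1 := congrArg (fun w => (B.equivFun v 0)⁻¹ • w) (comb_equivFun B v)
    refine h1.trans ?_
    simp only [smul_add, smul_smul, inv_mul_cancel₀ hp, one_smul, div_eq_inv_mul]

/-- The affine chart adapted to the basis `B`. -/
def linChart : OpenPartialHomeomorph (CP 2) R4 where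
  toFun := linCoord B
  invFun := linPoint B
  source := linSource B
  target := Set.univ
  map_source' _ _ := Set.mem_univ _
  map_target' x _ := linPoint_mem_linSource B x
  left_inv' _ hp := linPoint_linCoord B hp
  right_inv' x _ := linCoord_linPoint B x
  open_source := isOpen_linSource B
  open_target := isOpen_univ
  continuousOn_toFun := fun _ hp => (contMDiffAt_linCoord B hp).continuousAt.continuousWithinAt
  continuousOn_invFun := (contMDiff_linPoint B).continuous.continuousOn

/-! ### Integration of top-degree forms -/

/-- The integral of a form of degree four, computed in an affine chart. -/
def formInt (η : Form 2 (CP 2) 4) : ℝ := ∫ x : R4, mpull (linPoint B) η x e4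

/-- The complement is the zero set of a complex affine function of x. If it were everything, the
zeroth B'-coordinate would vanish on all vectors of B, hence on B' 0; so it is empty or a proper
affine subspace. -/
theorem volume_compl_linPoint_preimage (B' : Frame3) :
    volume (linPoint B ⁻¹' linSource B')ᶜ = 0 := by
  have hset : (linPoint B ⁻¹' linSource B')ᶜ = {x : R4 | B'.equivFun (linVec B x) 0 = 0} := by
    ext x
    exact (not_congr (mk_mem_linSource B' _ (linVec_ne_zero B x))).trans not_not
  rw [hset]
  let L : R4 →ₗ[ℝ] ℂ :=
    { toFun := fun x => (cx x).1 * B'.equivFun (B 1) 0 + (cx x).2 * B'.equivFun (B 2) 0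
      map_add' := fun x y => by simp only [map_add, Prod.fst_add, Prod.snd_add]; ring
      map_smul' := fun c x => by
        simp only [map_smul, Prod.smul_fst, Prod.smul_snd, RingHom.id_apply, Complex.real_smul]; ring }
  have hL : ∀ x, B'.equivFun (linVec B x) 0 = B'.equivFun (B 0) 0 + L x := fun x => by
    simp only [linVec, map_add, map_smul, Pi.add_apply, Pi.smul_apply, smul_eq_mul, L]
    exact add_assoc _ _ _
  by_cases hne : ∃ x0, B'.equivFun (linVec B x0) 0 = 0
  · obtain ⟨x0, hx0⟩ := hne
    have hsub : {x : R4 | B'.equivFun (linVec B x) 0 = 0} =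
        (AffineSubspace.mk' x0 (LinearMap.ker L) : Set R4) := by
      ext x
      rw [SetLike.mem_coe, AffineSubspace.mem_mk', LinearMap.mem_ker, vsub_eq_sub, map_sub,
        Set.mem_ofPred_eq, hL]
      rw [hL] at hx0
      constructor
      · intro h; linear_combination h - hx0
      · intro h; linear_combination h + hx0
    rw [hsub]
    refine Measure.addHaar_affineSubspace _ _ fun htop => ?_
    have hker : LinearMap.ker L = ⊤ := by
      rw [← AffineSubspace.direction_mk' x0 (LinearMap.ker L), htop, AffineSubspace.direction_top]
    have hL0 : ∀ x, L x = 0 := fun x => LinearMap.mem_ker.1 (hker ▸ Submodule.mem_top)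
    have h1 : B'.equivFun (B 1) 0 = 0 := by
      have := hL0 (cx.symm (1, 0)); simpa [L] using this
    have h2 : B'.equivFun (B 2) 0 = 0 := by
      have := hL0 (cx.symm (0, 1)); simpa [L] using this
    have h0 : B'.equivFun (B 0) 0 = 0 := by
      rw [hL, hL0] at hx0; simpa using hx0
    have : B'.equivFun (B' 0) 0 = 0 := by
      rw [comb_equivFun B (B' 0)]
      simp only [map_add, map_smul, Pi.add_apply, Pi.smul_apply, h0, h1, h2, smul_zero, add_zero]
    simp at this
  · have : {x : R4 | B'.equivFun (linVec B x) 0 = 0} = ∅ := by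
      ext x; simp only [Set.mem_ofPred_eq, Set.mem_empty_iff_false, iff_false]
      exact fun h => hne ⟨x, h⟩
    rw [this, measure_empty]

/-- The transition functions are quotients of affine functions, hence holomorphic. The sign of the
Jacobian makes forms transform exactly as the change of variables formula requires. -/
theorem hasFDerivAt_transition (B' : Frame3) {x : R4} (hx : linPoint B x ∈ linSource B') :
    DifferentiableAt ℝ (fun y => linCoord B' (linPoint B y)) x ∧
      0 ≤ (fderiv ℝ (fun y => linCoord B' (linPoint B y)) x).det := by
  let D : Fin 3 → ℂ × ℂ → ℂ := fun i z =>
    B'.equivFun (B 0) i + z.1 * B'.equivFun (B 1) i + z.2 * B'.equivFun (B 2) i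
  have hD : ∀ i y, B'.equivFun (linVec B y) i = D i (cx y) := fun i y => by
    simp only [linVec, map_add, map_smul, Pi.add_apply, Pi.smul_apply, smul_eq_mul, D]
  have hDd : ∀ i, Differentiable ℂ (D i) := fun i => by
    simp only [D]; fun_prop
  rw [linPoint, mk_mem_linSource, hD] at hx
  refine det_nonneg_of_hasFDerivAt_complex (g := fun z => (D 1 z / D 0 z, D 2 z / D 0 z)) (L := _)
    (DifferentiableAt.hasFDerivAt ?_) ?_
  · have hinv : DifferentiableAt ℂ (fun z => (D 0 z)⁻¹) (cx x) := (hDd 0 _).inv hx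
    simp only [div_eq_mul_inv]
    exact ((hDd 1 _).mul hinv).prodMk ((hDd 2 _).mul hinv)
  · refine Filter.Eventually.of_forall fun y => ?_
    rw [linPoint, linCoord_mk, ContinuousLinearEquiv.apply_symm_apply, hD, hD, hD]

theorem mpull_linPoint_transition (B' : Frame3) (η : Form 2 (CP 2) 4) {x : R4}
    (hx : linPoint B x ∈ linSource B') :
    mpull (linPoint B) η x e4 = |(fderiv ℝ (fun y => linCoord B' (linPoint B y)) x).det| •
      mpull (linPoint B') η (linCoord B' (linPoint B x)) e4 := by
  obtain ⟨hd, hdet⟩ := hasFDerivAt_transition B B' hx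
  have h1 : mpull (linPoint B) η x =
      mpull (fun y => linPoint B' (linCoord B' (linPoint B y))) η x := by
    refine mpull_congr ?_ η
    have : ∀ᶠ y in 𝓝 x, linPoint B y ∈ linSource B' :=
      (contMDiff_linPoint B).continuous.continuousAt ((isOpen_linSource B').mem_nhds hx)
    filter_upwards [this] with y hy
    exact (linPoint_linCoord B' hy).symm
  rw [h1, mpull_comp (g := linPoint B') (h := fun y => linCoord B' (linPoint B y))
    ((contMDiff_linPoint B').contMDiffAt.mdifferentiableAt (by simp)) hd, abs_of_nonneg hdet]
  exact alt_four_comp_eq_det (mpull (linPoint B') η (linCoord B' (linPoint B x)))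
    (fderiv ℝ (fun y => linCoord B' (linPoint B y)) x)

theorem injOn_transition (B' : Frame3) :
    Set.InjOn (fun y => linCoord B' (linPoint B y)) (linPoint B ⁻¹' linSource B') := by
  intro x hx y hy h
  have h2 := congrArg (linPoint B') h
  simp only [linPoint_linCoord B' hx, linPoint_linCoord B' hy] at h2
  rw [← linCoord_linPoint B x, h2, linCoord_linPoint]

theorem image_transition_inter (B' : Frame3) (s : Set (CP 2)) :
    (fun y => linCoord B' (linPoint B y)) '' (linPoint B ⁻¹' (s ∩ linSource B')) =
      linPoint B' ⁻¹' (s ∩ linSource B) := by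
  ext x
  constructor
  · rintro ⟨y, ⟨hys, hy⟩, rfl⟩
    simp only [Set.mem_preimage]
    rw [linPoint_linCoord B' hy]
    exact ⟨hys, linPoint_mem_linSource B y⟩
  · rintro ⟨hxs, hx⟩
    refine ⟨linCoord B (linPoint B' x), ?_, ?_⟩
    · simp only [Set.mem_preimage]
      rw [linPoint_linCoord B hx]
      exact ⟨hxs, linPoint_mem_linSource B' x⟩
    · simp only
      rw [linPoint_linCoord B hx, linCoord_linPoint]

theorem preimage_inter_ae_eq (B' : Frame3) (s : Set (CP 2)) :
    (linPoint B ⁻¹' (s ∩ linSource B') : Set R4) =ᵐ[volume] (linPoint B ⁻¹' s : Set R4) := by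
  rw [Set.preimage_inter]
  exact inter_ae_eq_left_of_ae_eq_univ
    (ae_eq_univ.2 (volume_compl_linPoint_preimage B B'))

theorem measurableSet_preimage_linSource (B' : Frame3) :
    MeasurableSet (linPoint B ⁻¹' linSource B') :=
  ((isOpen_linSource B').preimage (contMDiff_linPoint B).continuous).measurableSet

/-- Either chart loses only a null set when cut down to the common domain, and there the transition
is an injective orientation-preserving map. No integrability is needed. -/
theorem setIntegral_transition (B' : Frame3) (η : Form 2 (CP 2) 4) {s : Set (CP 2)}
    (hs : MeasurableSet (linPoint B ⁻¹' s)) :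
    ∫ x in linPoint B ⁻¹' s, mpull (linPoint B) η x e4 =
      ∫ x in linPoint B' ⁻¹' s, mpull (linPoint B') η x e4 := by
  rw [← setIntegral_congr_set (preimage_inter_ae_eq B B' s),
    ← setIntegral_congr_set (preimage_inter_ae_eq B' B s), ← image_transition_inter B B' s]
  have hm : MeasurableSet (linPoint B ⁻¹' (s ∩ linSource B')) :=
    hs.inter (measurableSet_preimage_linSource B B')
  rw [integral_image_eq_integral_abs_det_fderiv_smul volume hm
    (f' := fun x => fderiv ℝ (fun y => linCoord B' (linPoint B y)) x)
    (fun x hx => (hasFDerivAt_transition B B' hx.2).1.hasFDerivAt.hasFDerivWithinAt)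
    ((injOn_transition B B').mono fun x hx => hx.2)]
  exact setIntegral_congr_fun hm fun x hx => mpull_linPoint_transition B B' η hx.2

theorem integrableOn_transition (B' : Frame3) (η : Form 2 (CP 2) 4) {s : Set (CP 2)}
    (hs : MeasurableSet (linPoint B ⁻¹' s)) :
    IntegrableOn (fun x => mpull (linPoint B) η x e4) (linPoint B ⁻¹' s) ↔
      IntegrableOn (fun x => mpull (linPoint B') η x e4) (linPoint B' ⁻¹' s) := by
  rw [← integrableOn_congr_set_ae (preimage_inter_ae_eq B B' s),
    ← integrableOn_congr_set_ae (preimage_inter_ae_eq B' B s), ← image_transition_inter B B' s]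
  have hm : MeasurableSet (linPoint B ⁻¹' (s ∩ linSource B')) :=
    hs.inter (measurableSet_preimage_linSource B B')
  rw [integrableOn_image_iff_integrableOn_abs_det_fderiv_smul volume hm
    (f' := fun x => fderiv ℝ (fun y => linCoord B' (linPoint B y)) x)
    (fun x hx => (hasFDerivAt_transition B B' hx.2).1.hasFDerivAt.hasFDerivWithinAt)
    ((injOn_transition B B').mono fun x hx => hx.2)]
  exact integrableOn_congr_fun (fun x hx => mpull_linPoint_transition B B' η hx.2) hm

theorem formInt_eq (B' : Frame3) (η : Form 2 (CP 2) 4) : formInt B η = formInt B' η := by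
  have := setIntegral_transition B B' η (s := Set.univ) MeasurableSet.univ
  simpa [formInt] using this

/-- The standard basis with the `i`-th vector moved to the front. -/
def stdFrame3 (i : Fin 3) : Frame3 := (Pi.basisFun ℂ (Fin 3)).reindex i.cycleRange

theorem affinePoint_eq_linPoint (i : Fin 3) (x : R4) :
    affinePoint i (cxPi x) = linPoint (stdFrame3 i) x := by
  unfold affinePoint linPoint
  congr 1
  have h0 : stdFrame3 i 0 = Pi.single i 1 := by
    simp [stdFrame3, Fin.cycleRange_symm_zero]
  have h1 : ∀ j : Fin 2, stdFrame3 i j.succ = Pi.single (i.succAbove j) 1 := fun j => by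
    simp [stdFrame3, Fin.cycleRange_symm_succ]
  have h1' := h1 0
  have h2' := h1 1
  rw [show (0 : Fin 2).succ = (1 : Fin 3) from rfl] at h1'
  rw [show (1 : Fin 2).succ = (2 : Fin 3) from rfl] at h2'
  rw [linVec, h0, h1', h2', cxPi_apply]
  funext k
  refine Fin.succAboveCases i ?_ (fun k => ?_) k
  · simp [Pi.single_apply, Fin.succAbove_ne]
  · fin_cases k <;> simp [Pi.single_apply, Fin.succAbove_ne, Fin.succAbove_right_inj]

/-- The charts of the atlas are the linear charts of permuted standard bases, up to a
volume-preserving identification of ℝ⁴ with ℂ² that matches the oriented frames. Hence integrals may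
be computed in the linear chart of any basis. -/
theorem integral_chart_eq_formInt (h : 2 + 2 = 2 * 2) {e : OpenPartialHomeomorph (CP 2) (Fin 2 → ℂ)}
    (he : e ∈ atlas (Fin 2 → ℂ) (CP 2)) (η : Form 2 (CP 2) (2 + 2)) :
    ∫ y in e.target, pullback e.symm η y (stdFrame h) = formInt B η := by
  obtain ⟨i, rfl⟩ := he
  rw [formInt_eq B (stdFrame3 i)]
  change ∫ y in Set.univ, pullback (affinePoint i) η y (stdFrame h) = _
  rw [Measure.restrict_univ, ← measurePreserving_cxPi.integral_comp
    cxPi.toHomeomorph.measurableEmbedding]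
  refine integral_congr_ae (Filter.Eventually.of_forall fun x => ?_)
  have hfun : linPoint (stdFrame3 i) = fun x => affinePoint i (cxPi x) :=
    funext fun x => (affinePoint_eq_linPoint i x).symm
  have hs : ContMDiffAt 𝓘(ℝ, Fin 2 → ℂ) 𝓘(ℝ, Fin 2 → ℂ) ∞ (affineChart i).symm (cxPi x) :=
    contMDiffAt_symm_of_mem_maximalAtlas
      (IsManifold.subset_maximalAtlas (affineChart_mem_atlas i)) (Set.mem_univ _)
  simp only
  rw [hfun, mpull_comp (g := affinePoint i) (h := cxPi) (hs.mdifferentiableAt (by simp))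
    cxPi.differentiableAt, cxPi.fderiv, pullback_eq_mpull]
  change _ = mpull (affinePoint i) η (cxPi x) (fun j => cxPi (e4 j))
  congr 1
  funext j
  exact (cxPi_e4 h j).symm

/-! ### Integrability of smooth forms of degree four -/

/-- Dividing by the coordinate of largest absolute value leaves two coordinates of absolute value at
most 1. -/
theorem exists_norm_linCoord_le (p : CP 2) :
    ∃ i, p ∈ linSource (stdFrame3 i) ∧ ‖linCoord (stdFrame3 i) p‖ ≤ 2 := by
  induction p using Projectivization.ind with
  | h v hv =>
    obtain ⟨i, -, hi⟩ := Finset.exists_max_image Finset.univ (fun i => ‖v i‖) Finset.univ_nonempty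
    have hvi : v i ≠ 0 := by
      intro h0
      refine hv (funext fun j => norm_le_zero_iff.1 ?_)
      simpa [h0] using hi j (Finset.mem_univ _)
    have hco : ∀ j, (stdFrame3 i).equivFun v j = v (i.cycleRange.symm j) := fun j => by
      simp [stdFrame3, Module.Basis.equivFun_apply]
    have h0 : (stdFrame3 i).equivFun v 0 = v i := by rw [hco, Fin.cycleRange_symm_zero]
    refine ⟨i, (mk_mem_linSource _ v hv).2 (by rwa [h0]), ?_⟩
    have hle : ∀ j, ‖(stdFrame3 i).equivFun v j / (stdFrame3 i).equivFun v 0‖ ^ 2 ≤ 1 := fun j => by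
      rw [h0, hco, norm_div]
      exact pow_le_one₀ (by positivity)
        (div_le_one_of_le₀ (hi _ (Finset.mem_univ _)) (norm_nonneg _))
    rw [← sq_le_sq₀ (norm_nonneg _) zero_le_two, linCoord_mk, norm_sq_cx_symm]
    linarith [hle 1, hle 2]

theorem continuous_mpull_linPoint {k : ℕ} {η : Form 2 (CP 2) k} (hη : IsSmooth η) :
    Continuous (mpull (linPoint B) η) :=
  continuous_iff_continuousAt.2 fun _ => (contDiffAt_mpull hη
    (Filter.Eventually.of_forall fun y => (contMDiff_linPoint B) y)).continuousAt

/-- Three compact pieces cover the plane, and each is a closed ball in one of the standard charts,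
where the integrand is continuous. Integrability on a piece does not depend on the chart. -/
theorem integrable_mpull_linPoint {η : Form 2 (CP 2) 4} (hη : IsSmooth η) :
    Integrable (fun x => mpull (linPoint B) η x e4) := by
  rw [← integrableOn_univ]
  let S : Fin 3 → Set (CP 2) := fun i => linPoint (stdFrame3 i) '' Metric.closedBall 0 2
  have hcl : ∀ i, IsClosed (S i) := fun i =>
    ((isCompact_closedBall _ _).image (contMDiff_linPoint _).continuous).isClosed
  have hcov : (Set.univ : Set R4) = ⋃ i, linPoint B ⁻¹' (S i) := by
    symm
    rw [Set.eq_univ_iff_forall]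
    intro x
    obtain ⟨i, hi, hle⟩ := exists_norm_linCoord_le (linPoint B x)
    exact Set.mem_iUnion.2 ⟨i, linCoord (stdFrame3 i) (linPoint B x), by simpa using hle,
      linPoint_linCoord _ hi⟩
  rw [hcov, integrableOn_finite_iUnion]
  intro i
  have hpre : linPoint (stdFrame3 i) ⁻¹' (S i) = Metric.closedBall 0 2 :=
    Set.preimage_image_eq _ (Function.LeftInverse.injective (linCoord_linPoint (stdFrame3 i)))
  rw [integrableOn_transition B (stdFrame3 i) η
    ((hcl i).preimage (contMDiff_linPoint B).continuous).measurableSet, hpre]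
  refine ContinuousOn.integrableOn_compact (isCompact_closedBall _ _) (Continuous.continuousOn ?_)
  exact (altEval e4).continuous.comp (continuous_mpull_linPoint _ hη)

end ProjSpace
end
noncomputable section

/-! ### A radial diffeomorphism from `ℝ⁴` onto the ball -/

namespace DeRham

/-- The function `(e^z - 1) / z`. -/
def expSlope : ℝ → ℝ := dslope Real.exp 0

theorem mul_expSlope (z : ℝ) : z * expSlope z = Real.exp z - 1 := by
  have := sub_smul_dslope Real.exp 0 z
  simpa [expSlope] using this

theorem expSlope_zero : expSlope 0 = 1 := by
  simp [expSlope]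

theorem contDiff_expSlope : ContDiff ℝ ∞ expSlope := by
  rw [contDiff_iff_contDiffAt]
  intro z
  rcases eq_or_ne z 0 with rfl | hz
  · obtain ⟨p, hp⟩ := (analyticAt_rexp (x := 0))
    exact (hp.has_fpower_series_dslope_fslope).analyticAt.contDiffAt
  · have heq : expSlope =ᶠ[𝓝 z] fun w => (Real.exp w - 1) / w := by
      filter_upwards [isOpen_ne.mem_nhds hz] with w hw
      rw [eq_div_iff hw, mul_comm, mul_expSlope]
    refine ContDiffAt.congr_of_eventuallyEq ?_ heq
    exact ContDiffAt.div ((Real.contDiff_exp.contDiffAt).sub contDiffAt_const) contDiffAt_id hz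

theorem expSlope_pos (z : ℝ) : 0 < expSlope z := by
  rcases lt_trichotomy z 0 with hz | rfl | hz
  · have h := mul_expSlope z
    have : Real.exp z < 1 := by rw [← Real.exp_zero]; exact Real.exp_lt_exp.2 hz
    by_contra hc
    nlinarith
  · rw [expSlope_zero]; exact one_pos
  · have h := mul_expSlope z
    have : 1 < Real.exp z := Real.one_lt_exp_iff.2 hz
    by_contra hc
    nlinarith

/-- Secant slopes of the convex exponential function increase. -/
theorem expSlope_mono {z w : ℝ} (hz : 0 ≤ z) (hzw : z ≤ w) : expSlope z ≤ expSlope w := by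
  rcases eq_or_lt_of_le hz with rfl | hz'
  · rw [expSlope_zero]
    rcases eq_or_lt_of_le hzw with rfl | hw
    · rw [expSlope_zero]
    · have := mul_expSlope w
      have h2 := Real.add_one_le_exp w
      by_contra hc
      push Not at hc
      nlinarith
  · have hw : 0 < w := hz'.trans_le hzw
    have := convexOn_exp.secant_mono (a := 0) (x := z) (y := w) (Set.mem_univ _) (Set.mem_univ _)
      (Set.mem_univ _) hz'.ne' hw.ne' hzw
    have e1 : expSlope z = (Real.exp z - Real.exp 0) / (z - 0) := by
      rw [sub_zero, Real.exp_zero, eq_div_iff hz'.ne', mul_comm, mul_expSlope]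
    have e2 : expSlope w = (Real.exp w - Real.exp 0) / (w - 0) := by
      rw [sub_zero, Real.exp_zero, eq_div_iff hw.ne', mul_comm, mul_expSlope]
    rw [e1, e2]; exact this

/-- The factor by which the inverse of the radial diffeomorphism stretches at squared radius `q`. -/
def stretch (q : ℝ) : ℝ := √(expSlope (q / (1 - q)) / (1 - q))

/-- The factor by which the radial diffeomorphism contracts at squared radius `r`. -/
def contract (r : ℝ) : ℝ := √(1 / (expSlope (Real.log (1 + r)) * (1 + Real.log (1 + r))))

theorem log_one_add_nonneg {r : ℝ} (hr : 0 ≤ r) : 0 ≤ Real.log (1 + r) :=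
  Real.log_nonneg (by linarith)

theorem contract_pos {r : ℝ} (hr : 0 ≤ r) : 0 < contract r := by
  have := log_one_add_nonneg hr
  have := expSlope_pos (Real.log (1 + r))
  exact Real.sqrt_pos.2 (by positivity)

theorem stretch_pos {q : ℝ} (hq1 : q < 1) : 0 < stretch q :=
  Real.sqrt_pos.2 (div_pos (expSlope_pos _) (by linarith))

theorem stretch_sq {q : ℝ} (hq1 : q < 1) : stretch q ^ 2 = expSlope (q / (1 - q)) / (1 - q) :=
  Real.sq_sqrt (div_pos (expSlope_pos _) (by linarith)).le

/-- This is the radial law of the inverse diffeomorphism. The exponential growth makes 1 / `stretch`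
vanish to infinite order at the sphere, while writing it with `expSlope` shows smoothness at the
centre. -/
theorem mul_stretch_sq {q : ℝ} (hq1 : q < 1) : q * stretch q ^ 2 = Real.exp (q / (1 - q)) - 1 := by
  rw [stretch_sq hq1, ← mul_expSlope]
  have : (1 - q) ≠ 0 := by linarith
  field_simp

theorem contract_sq {r : ℝ} (hr : 0 ≤ r) : contract r ^ 2 =
    1 / (expSlope (Real.log (1 + r)) * (1 + Real.log (1 + r))) := by
  have := log_one_add_nonneg hr
  have := expSlope_pos (Real.log (1 + r))
  exact Real.sq_sqrt (by positivity)

theorem mul_contract_sq {r : ℝ} (hr : 0 ≤ r) : r * contract r ^ 2 =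
    Real.log (1 + r) / (1 + Real.log (1 + r)) := by
  have h1 := log_one_add_nonneg hr
  have h2 := expSlope_pos (Real.log (1 + r))
  have h3 := mul_expSlope (Real.log (1 + r))
  rw [Real.exp_log (by linarith)] at h3
  rw [contract_sq hr, mul_one_div, div_eq_div_iff (by positivity) (by positivity)]
  linear_combination (-(1 + Real.log (1 + r))) * h3

theorem contract_mul_stretch {q : ℝ} (hq0 : 0 ≤ q) (hq1 : q < 1) :
    contract (Real.exp (q / (1 - q)) - 1) * stretch q = 1 := by
  have h0 : 0 ≤ q / (1 - q) := div_nonneg hq0 (by linarith)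
  have hr : 0 ≤ Real.exp (q / (1 - q)) - 1 := by linarith [Real.one_le_exp h0]
  have h := contract_sq hr
  have hne : (1 - q) ≠ 0 := by linarith
  rw [add_sub_cancel, Real.log_exp] at h
  have h2 : (contract (Real.exp (q / (1 - q)) - 1) * stretch q) ^ 2 = 1 := by
    rw [mul_pow, h, stretch_sq hq1]
    have := (expSlope_pos (q / (1 - q))).ne'
    have e : 1 + q / (1 - q) = 1 / (1 - q) := by field_simp; ring
    rw [e]
    field_simp
  have hp := mul_pos (contract_pos hr) (stretch_pos hq1)
  nlinarith [sq_nonneg (contract (Real.exp (q / (1 - q)) - 1) * stretch q - 1)]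

theorem stretch_mul_contract {r : ℝ} (hr : 0 ≤ r) :
    stretch (Real.log (1 + r) / (1 + Real.log (1 + r))) * contract r = 1 := by
  have hl := log_one_add_nonneg hr
  set q := Real.log (1 + r) / (1 + Real.log (1 + r)) with hq
  have hq0 : 0 ≤ q := by positivity
  have hq1 : q < 1 := by rw [hq, div_lt_one (by positivity)]; linarith
  have hz : q / (1 - q) = Real.log (1 + r) := by
    rw [hq]; field_simp; ring
  have := contract_mul_stretch hq0 hq1
  rw [hz, Real.exp_log (by linarith), add_sub_cancel_left] at this
  rw [mul_comm]; exact this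

theorem contDiffAt_contract {r : ℝ} (hr : 0 ≤ r) : ContDiffAt ℝ ∞ contract r := by
  have h1 := log_one_add_nonneg hr
  have h2 := expSlope_pos (Real.log (1 + r))
  have hl : ContDiffAt ℝ ∞ (fun r : ℝ => Real.log (1 + r)) r :=
    (contDiffAt_const.add contDiffAt_id).log (by simp only [id]; linarith)
  refine ContDiffAt.sqrt ?_ (by positivity)
  refine ContDiffAt.div contDiffAt_const ?_ (by positivity)
  exact (contDiff_expSlope.contDiffAt.comp r hl).mul (contDiffAt_const.add hl)

theorem contDiffAt_stretch {q : ℝ} (hq : q < 1) : ContDiffAt ℝ ∞ stretch q := by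
  have h1 : ContDiffAt ℝ ∞ (fun q : ℝ => 1 - q) q := contDiffAt_const.sub contDiffAt_id
  have h2 : (1 - q) ≠ 0 := by linarith
  refine ContDiffAt.sqrt ?_ (div_pos (expSlope_pos _) (by linarith)).ne'
  exact (contDiff_expSlope.contDiffAt.comp q (contDiffAt_id.div h1 h2)).div h1 h2

/-- The radial diffeomorphism from `ℝ⁴` onto the unit ball. -/
def toBall (u : R4) : R4 := contract (‖u‖ ^ 2) • u

/-- The inverse of `toBall`. -/
def ofBall (x : R4) : R4 := stretch (‖x‖ ^ 2) • x

theorem norm_sq_toBall (u : R4) :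
    ‖toBall u‖ ^ 2 = Real.log (1 + ‖u‖ ^ 2) / (1 + Real.log (1 + ‖u‖ ^ 2)) := by
  rw [← mul_contract_sq (sq_nonneg _), toBall, norm_smul, mul_pow, Real.norm_eq_abs, sq_abs, mul_comm]

theorem norm_sq_ofBall {x : R4} (hx : ‖x‖ < 1) :
    ‖ofBall x‖ ^ 2 = Real.exp (‖x‖ ^ 2 / (1 - ‖x‖ ^ 2)) - 1 := by
  have h : ‖x‖ ^ 2 < 1 := by nlinarith [norm_nonneg x]
  rw [← mul_stretch_sq h, ofBall, norm_smul, mul_pow, Real.norm_eq_abs, sq_abs, mul_comm]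

theorem norm_toBall_lt (u : R4) : ‖toBall u‖ < 1 := by
  have h : ‖toBall u‖ ^ 2 < 1 := by
    have := log_one_add_nonneg (sq_nonneg ‖u‖)
    rw [norm_sq_toBall, div_lt_one (by positivity)]; linarith
  nlinarith [norm_nonneg (toBall u)]

theorem ofBall_toBall (u : R4) : ofBall (toBall u) = u := by
  rw [ofBall, norm_sq_toBall, toBall, smul_smul, stretch_mul_contract (sq_nonneg _), one_smul]

theorem toBall_ofBall {x : R4} (hx : ‖x‖ < 1) : toBall (ofBall x) = x := by
  have h : ‖x‖ ^ 2 < 1 := by nlinarith [norm_nonneg x]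
  rw [toBall, norm_sq_ofBall hx, ofBall, smul_smul, contract_mul_stretch (sq_nonneg _) h, one_smul]

theorem contDiff_toBall : ContDiff ℝ ∞ toBall := by
  rw [contDiff_iff_contDiffAt]
  intro u
  exact ((contDiffAt_contract (sq_nonneg ‖u‖)).comp u
    (contDiff_norm_sq ℝ).contDiffAt).smul contDiffAt_id

theorem contDiffAt_ofBall {x : R4} (hx : ‖x‖ < 1) : ContDiffAt ℝ ∞ ofBall x := by
  have h : ‖x‖ ^ 2 < 1 := by nlinarith [norm_nonneg x]
  exact ((contDiffAt_stretch h).comp x (contDiff_norm_sq ℝ).contDiffAt).smul contDiffAt_id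

/-- `toBall` as a diffeomorphism onto the unit ball. -/
def ballHomeo : OpenPartialHomeomorph R4 R4 where
  toFun := toBall
  invFun := ofBall
  source := Set.univ
  target := Metric.ball 0 1
  map_source' u _ := by simpa using norm_toBall_lt u
  map_target' _ _ := Set.mem_univ _
  left_inv' u _ := ofBall_toBall u
  right_inv' x hx := toBall_ofBall (by simpa using hx)
  open_source := isOpen_univ
  open_target := Metric.isOpen_ball
  continuousOn_toFun := contDiff_toBall.continuous.continuousOn
  continuousOn_invFun := fun x hx =>
    (contDiffAt_ofBall (by simpa using hx)).continuousAt.continuousWithinAt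

/-! ### Smoothness of the conjugated translations -/

/-- The translation by `y`, carried over to the ball. -/
def act (y x : R4) : R4 := ballAct ballHomeo y x

theorem act_of_lt {x : R4} (hx : ‖x‖ < 1) (y : R4) : act y x = toBall (ofBall x + y) :=
  if_pos (by simpa using hx)

theorem act_of_le {x : R4} (hx : 1 ≤ ‖x‖) (y : R4) : act y x = x :=
  if_neg (by simpa using hx)

/-- Because -q / (1 - q) = 1 - 1 / (1 - q), the exponential of -z / c with z = q / (1 - q) extends
smoothly by zero to q ≥ 1. -/
theorem expNegInvGlue_one_sub {q : ℝ} (hq : q < 1) (c : ℝ) (hc : 0 < c) :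
    Real.exp c⁻¹ * expNegInvGlue (c * (1 - q)) = Real.exp (-(q / (1 - q)) / c) := by
  have h : 0 < c * (1 - q) := mul_pos hc (by linarith)
  have h' : (1 - q) ≠ 0 := by linarith
  rw [expNegInvGlue, if_neg (not_le.2 h), ← Real.exp_add]
  congr 1
  field_simp
  ring

/-- One formula, with smooth ingredients, holds on both sides of the sphere. With q = ‖x‖², z = q /
(1 - q) and κ = `stretch q`, the translated point is κ w for w = x + κ⁻¹ y, and κ⁻¹ is flat at the
sphere. If r = ‖κ w‖², then 1 + r = e^z M with M close to 1, so log (1 + r) = z + log M, and the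
squared radius of the image becomes 1 - (1 - q) / (1 + (1 - q) log M). The functions `E` and `Eh`
extend e^{-z} and e^{-z/2}. -/
theorem act_eq_boundary : ∃ (E Eh : ℝ → ℝ), ContDiff ℝ ∞ E ∧ ContDiff ℝ ∞ Eh ∧ E 1 = 0 ∧ Eh 1 = 0 ∧
    ∀ x y : R4, 0 < ‖x‖ → E (‖x‖ ^ 2) < 1 →
      (∃ w : R4, w = x + (Eh (‖x‖ ^ 2) * √(‖x‖ ^ 2 / (1 - E (‖x‖ ^ 2)))) • y ∧ (w ≠ 0 →
      act y x = √((1 - (1 - ‖x‖ ^ 2) / (1 + (1 - ‖x‖ ^ 2) *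
        Real.log (1 + (2 * (Eh (‖x‖ ^ 2) * √((1 - E (‖x‖ ^ 2)) / ‖x‖ ^ 2)) * ⟪x, y⟫
          + E (‖x‖ ^ 2) * ‖y‖ ^ 2)))) / ‖w‖ ^ 2) • w)) := by
  refine ⟨fun q => Real.exp (1 : ℝ)⁻¹ * expNegInvGlue (1 * (1 - q)),
    fun q => Real.exp (2 : ℝ)⁻¹ * expNegInvGlue (2 * (1 - q)), ?_, ?_, ?_, ?_, ?_⟩
  · exact contDiff_const.mul (expNegInvGlue.contDiff.comp (contDiff_const.mul (contDiff_const.sub contDiff_id)))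
  · exact contDiff_const.mul (expNegInvGlue.contDiff.comp (contDiff_const.mul (contDiff_const.sub contDiff_id)))
  · simp
  · simp
  intro x y hx hE
  refine ⟨_, rfl, fun hw => ?_⟩
  rcases lt_or_ge (‖x‖) 1 with h1 | h1
  · have hq1 : ‖x‖ ^ 2 < 1 := by nlinarith [norm_nonneg x]
    have hq0 : 0 < ‖x‖ ^ 2 := by positivity
    rw [act_of_lt h1]
    simp only [expNegInvGlue_one_sub hq1 1 one_pos, expNegInvGlue_one_sub hq1 2 two_pos] at hw hE ⊢
    set q := ‖x‖ ^ 2 with hq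
    set z := q / (1 - q) with hz
    rw [div_one] at hw hE ⊢
    have hκ := mul_stretch_sq hq1
    rw [← hz] at hκ
    have hκ0 := stretch_pos hq1
    set κ := stretch q with hκd
    have h1q : (0:ℝ) < 1 - q := by linarith
    have hez : Real.exp z * Real.exp (-z) = 1 := by rw [← Real.exp_add]; simp
    have hh : Real.exp (-z / 2) ^ 2 = Real.exp (-z) := by
      rw [← Real.exp_nat_mul]; congr 1; push_cast; ring
    have hEpos := Real.exp_pos (-z)
    have hhpos := Real.exp_pos (-z / 2)
    -- From κ² = e^z (1 - e^{-z}) / q. The flat factor is taken out, so the remaining root has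
    -- argument 1 at the sphere and stays smooth.
    have hlam : Real.exp (-z / 2) * √(q / (1 - Real.exp (-z))) = κ⁻¹ := by
      have hd : 0 < 1 - Real.exp (-z) := by linarith
      have hs : (Real.exp (-z / 2) * √(q / (1 - Real.exp (-z)))) ^ 2 = (κ⁻¹) ^ 2 := by
        rw [mul_pow, hh, Real.sq_sqrt (by positivity), inv_pow]
        refine eq_inv_of_mul_eq_one_left ?_
        rw [mul_assoc, div_mul_eq_mul_div, hκ]
        field_simp
        linear_combination hez
      exact (sq_eq_sq₀ (by positivity) (by positivity)).1 hs
    have hkE : Real.exp (-z / 2) * √((1 - Real.exp (-z)) / q) = κ * Real.exp (-z) := by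
      have hd : 0 < 1 - Real.exp (-z) := by linarith
      have hs : (Real.exp (-z / 2) * √((1 - Real.exp (-z)) / q)) ^ 2 = (κ * Real.exp (-z)) ^ 2 := by
        rw [mul_pow, hh, Real.sq_sqrt (by positivity)]
        have : κ ^ 2 = (Real.exp z - 1) / q := by rw [eq_div_iff hq0.ne', ← hκ]; ring
        rw [mul_pow, this]
        field_simp
        linear_combination -hez
      exact (sq_eq_sq₀ (by positivity) (by positivity)).1 hs
    rw [hlam] at hw ⊢
    rw [hkE]
    set w := x + κ⁻¹ • y with hwd
    have huy : ofBall x + y = κ • w := by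
      rw [hwd, smul_add, smul_smul, mul_inv_cancel₀ hκ0.ne', one_smul]; rfl
    have hr : ‖ofBall x + y‖ ^ 2 = Real.exp z - 1 + 2 * κ * ⟪x, y⟫ + ‖y‖ ^ 2 := by
      rw [norm_add_sq_real, norm_sq_ofBall h1, ofBall, real_inner_smul_left]
      ring
    have hr' : ‖ofBall x + y‖ ^ 2 = κ ^ 2 * ‖w‖ ^ 2 := by
      rw [huy, norm_smul, mul_pow, Real.norm_eq_abs, sq_abs]
    set r := ‖ofBall x + y‖ ^ 2 with hrd
    have hr0 : 0 ≤ r := sq_nonneg _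
    have hM : 1 + (2 * (κ * Real.exp (-z)) * ⟪x, y⟫ + Real.exp (-z) * ‖y‖ ^ 2) =
        (1 + r) * Real.exp (-z) := by
      rw [hr]; linear_combination -hez
    rw [hM, Real.log_mul (by positivity) (by positivity), Real.log_exp]
    have hl := log_one_add_nonneg hr0
    set l := Real.log (1 + r) with hld
    -- Uses 1 + z = 1 / (1 - q).
    have hW : 1 - (1 - q) / (1 + (1 - q) * (l + -z)) = l / (1 + l) := by
      have : 1 + (1 - q) * (l + -z) = (1 - q) * (1 + l) := by
        rw [hz]; field_simp; ring
      rw [this]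
      field_simp
      ring
    have hw2 : 0 < ‖w‖ ^ 2 := by have := norm_pos_iff.2 hw; positivity
    rw [hW, ← mul_contract_sq hr0, toBall, huy, smul_smul, ← huy, ← hrd]
    congr 1
    symm
    rw [Real.sqrt_eq_iff_eq_sq (by positivity) (by have := contract_pos hr0; positivity), hr', mul_pow]
    field_simp
  -- Outside the open ball both flat functions vanish, so w = x, the logarithm is zero and the
  -- scalar factor is 1.
  · have hq1 : 1 ≤ ‖x‖ ^ 2 := by nlinarith
    rw [act_of_le h1]
    have e1 : expNegInvGlue (1 * (1 - ‖x‖ ^ 2)) = 0 := by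
      rw [expNegInvGlue, if_pos (by linarith)]
    have e2 : expNegInvGlue (2 * (1 - ‖x‖ ^ 2)) = 0 := by
      rw [expNegInvGlue, if_pos (by linarith)]
    simp only [e1, e2]
    have : ‖x‖ ≠ 0 := hx.ne'
    simp [this]

/-- Only the sphere needs an argument. There the flat functions are 0, so every denominator, root
and logarithm in the formula of `act_eq_boundary` has argument 1. -/
theorem contDiff_act : ContDiff ℝ ∞ fun p : R4 × R4 => act p.1 p.2 := by
  rw [contDiff_iff_contDiffAt]
  rintro ⟨y, x⟩
  rcases lt_trichotomy ‖x‖ 1 with h | h | h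
  · have heq : (fun p : R4 × R4 => act p.1 p.2) =ᶠ[𝓝 (y, x)]
        fun p => toBall (ofBall p.2 + p.1) := by
      filter_upwards [(isOpen_lt continuous_snd.norm continuous_const).mem_nhds
        (show ‖((y, x) : R4 × R4).2‖ < 1 from h)] with p hp
      exact act_of_lt hp _
    refine ContDiffAt.congr_of_eventuallyEq ?_ heq
    have h2 : ContDiffAt ℝ ∞ (fun p : R4 × R4 => ofBall p.2) (y, x) :=
      ContDiffAt.comp (g := ofBall) (f := fun p : R4 × R4 => p.2) (y, x) (contDiffAt_ofBall h)
        contDiffAt_snd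
    exact contDiff_toBall.contDiffAt.comp (y, x) (h2.add contDiffAt_fst)
  · obtain ⟨E, Eh, hE, hEh, hE1, hEh1, key⟩ := act_eq_boundary
    have hq : ContDiffAt ℝ ∞ (fun p : R4 × R4 => ‖p.2‖ ^ 2) (y, x) := (contDiff_snd.norm_sq ℝ).contDiffAt
    have hEc : ContDiffAt ℝ ∞ (fun p : R4 × R4 => E (‖p.2‖ ^ 2)) (y, x) := hE.contDiffAt.comp _ hq
    have hEhc : ContDiffAt ℝ ∞ (fun p : R4 × R4 => Eh (‖p.2‖ ^ 2)) (y, x) := hEh.contDiffAt.comp _ hq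
    have hx1 : ‖x‖ ^ 2 = 1 := by rw [h]; norm_num
    have hwc : ContDiffAt ℝ ∞ (fun p : R4 × R4 => p.2 +
        (Eh (‖p.2‖ ^ 2) * √(‖p.2‖ ^ 2 / (1 - E (‖p.2‖ ^ 2)))) • p.1) (y, x) := by
      refine contDiffAt_snd.add (ContDiffAt.smul (hEhc.mul (ContDiffAt.sqrt
        (hq.div (contDiffAt_const.sub hEc) ?_) ?_)) contDiffAt_fst)
      · simp [hx1, hE1]
      · simp [hx1, hE1]
    have hw0 : x + (Eh (‖x‖ ^ 2) * √(‖x‖ ^ 2 / (1 - E (‖x‖ ^ 2)))) • y ≠ 0 := by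
      rw [hx1, hEh1, zero_mul, zero_smul, add_zero]
      exact norm_ne_zero_iff.1 (by rw [h]; exact one_ne_zero)
    have heq : (fun p : R4 × R4 => act p.1 p.2) =ᶠ[𝓝 (y, x)] fun p =>
        √((1 - (1 - ‖p.2‖ ^ 2) / (1 + (1 - ‖p.2‖ ^ 2) *
        Real.log (1 + (2 * (Eh (‖p.2‖ ^ 2) * √((1 - E (‖p.2‖ ^ 2)) / ‖p.2‖ ^ 2)) * ⟪p.2, p.1⟫
          + E (‖p.2‖ ^ 2) * ‖p.1‖ ^ 2)))) /
          ‖p.2 + (Eh (‖p.2‖ ^ 2) * √(‖p.2‖ ^ 2 / (1 - E (‖p.2‖ ^ 2)))) • p.1‖ ^ 2) •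
          (p.2 + (Eh (‖p.2‖ ^ 2) * √(‖p.2‖ ^ 2 / (1 - E (‖p.2‖ ^ 2)))) • p.1) := by
      have ev1 : ∀ᶠ p : R4 × R4 in 𝓝 (y, x), 0 < ‖p.2‖ :=
        continuous_snd.norm.continuousAt.eventually (lt_mem_nhds (by simp [h]))
      have ev2 : ∀ᶠ p : R4 × R4 in 𝓝 (y, x), E (‖p.2‖ ^ 2) < 1 :=
        hEc.continuousAt.eventually (gt_mem_nhds (by simp [hx1, hE1]))
      filter_upwards [ev1, ev2, hwc.continuousAt.eventually_ne hw0] with p h1 h2 h3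
      obtain ⟨w, rfl, hw⟩ := key p.2 p.1 h1 h2
      exact hw h3
    refine ContDiffAt.congr_of_eventuallyEq ?_ heq
    refine ContDiffAt.smul (ContDiffAt.sqrt (ContDiffAt.div ?_ (hwc.norm_sq ℝ) ?_) ?_) hwc
    · have hin : ContDiffAt ℝ ∞ (fun p : R4 × R4 => ⟪p.2, p.1⟫) (y, x) := contDiffAt_snd.inner ℝ contDiffAt_fst
      have h1q : ContDiffAt ℝ ∞ (fun p : R4 × R4 => 1 - ‖p.2‖ ^ 2) (y, x) := contDiffAt_const.sub hq
      refine contDiffAt_const.sub (h1q.div (contDiffAt_const.add (h1q.mul (ContDiffAt.log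
        (contDiffAt_const.add (((contDiffAt_const.mul (hEhc.mul (ContDiffAt.sqrt
          ((contDiffAt_const.sub hEc).div hq ?_) ?_))).mul hin).add
          (hEc.mul (contDiffAt_fst.norm_sq ℝ)))) ?_))) ?_)
      · simp [hx1]
      · simp [hx1, hE1]
      · simp [hx1, hE1, hEh1]
      · simp [hx1, hE1, hEh1]
    · exact pow_ne_zero _ (norm_ne_zero_iff.2 hw0)
    · simp [hx1, hE1, hEh1, h]
  · have heq : (fun p : R4 × R4 => act p.1 p.2) =ᶠ[𝓝 (y, x)] fun p => p.2 := by
      filter_upwards [(isOpen_lt continuous_const continuous_snd.norm).mem_nhds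
        (show 1 < ‖((y, x) : R4 × R4).2‖ from h)] with p hp
      exact act_of_le (le_of_lt hp) _
    exact contDiffAt_snd.congr_of_eventuallyEq heq

end DeRham
end
noncomputable section

/-! ### Change of variables for the radial diffeomorphism -/

namespace DeRham

open MeasureTheory

theorem act_toBall (y u : R4) : act y (toBall u) = toBall (u + y) := by
  rw [act_of_lt (norm_toBall_lt u), ofBall_toBall]

theorem act_zero (x : R4) : act 0 x = x := by
  rcases lt_or_ge ‖x‖ 1 with h | h
  · rw [act_of_lt h, add_zero, toBall_ofBall h]
  · rw [act_of_le h]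

/-- The inclusion of the first complex coordinate line. -/
def pl : ℂ →L[ℝ] R4 := (cx.symm : ℂ × ℂ →L[ℝ] R4).comp (ContinuousLinearMap.inl ℝ ℂ ℂ)

theorem pl_apply (u : ℂ) : pl u = cx.symm (u, 0) := rfl

theorem cx_pl (u : ℂ) : cx (pl u) = (u, 0) := by rw [pl_apply, cx.apply_symm_apply]

theorem pl_one : pl 1 = e4 0 := by rw [pl_apply, ← cx_e4.1, cx.symm_apply_apply]

theorem pl_I : pl Complex.I = e4 1 := by rw [pl_apply, ← cx_e4.2.1, cx.symm_apply_apply]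

theorem norm_sq_pl (u : ℂ) : ‖pl u‖ ^ 2 = ‖u‖ ^ 2 := by
  rw [pl_apply, norm_sq_cx_symm]; simp

theorem norm_pl (u : ℂ) : ‖pl u‖ = ‖u‖ :=
  (sq_eq_sq₀ (norm_nonneg _) (norm_nonneg _)).1 (norm_sq_pl u)

/-- The restriction of `toBall` to the first complex coordinate line. -/
def disc (u : ℂ) : ℂ := contract (‖u‖ ^ 2) • u

theorem toBall_pl (u : ℂ) : toBall (pl u) = pl (disc u) := by
  rw [toBall, norm_sq_pl, disc, map_smul]

theorem norm_sq_disc (u : ℂ) :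
    ‖disc u‖ ^ 2 = Real.log (1 + ‖u‖ ^ 2) / (1 + Real.log (1 + ‖u‖ ^ 2)) := by
  rw [← norm_sq_pl, ← toBall_pl, norm_sq_toBall, norm_sq_pl]

theorem injective_disc : Function.Injective disc := by
  intro u v h
  have h1 : toBall (pl u) = toBall (pl v) := by rw [toBall_pl, toBall_pl, h]
  have h2 := congrArg ofBall h1
  rw [ofBall_toBall, ofBall_toBall] at h2
  have h3 := congrArg cx h2
  rw [cx_pl, cx_pl] at h3
  exact (Prod.ext_iff.1 h3).1

theorem exists_disc_eq {t : ℂ} (ht : ‖t‖ < 1) : ∃ u, disc u = t := by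
  have h : ofBall (pl t) = pl (stretch (‖t‖ ^ 2) • t) := by
    rw [ofBall, norm_sq_pl, map_smul]
  refine ⟨stretch (‖t‖ ^ 2) • t, ?_⟩
  have h2 := toBall_ofBall (x := pl t) (by rwa [norm_pl])
  rw [h, toBall_pl] at h2
  have h3 := congrArg cx h2
  rw [cx_pl, cx_pl] at h3
  exact (Prod.ext_iff.1 h3).1

theorem norm_disc_lt (u : ℂ) : ‖disc u‖ < 1 := by
  rw [← norm_pl, ← toBall_pl]; exact norm_toBall_lt _

theorem contDiff_disc : ContDiff ℝ ∞ disc := by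
  rw [contDiff_iff_contDiffAt]
  intro u
  exact ((contDiffAt_contract (sq_nonneg ‖u‖)).comp u
    (contDiff_norm_sq ℝ).contDiffAt).smul contDiffAt_id

theorem det_complex (L : ℂ →L[ℝ] ℂ) :
    L.det = (L 1).re * (L Complex.I).im - (L 1).im * (L Complex.I).re := by
  rw [ContinuousLinearMap.det, ← LinearMap.det_toMatrix Complex.basisOneI, Matrix.det_fin_two]
  simp [LinearMap.toMatrix_apply]
  ring

/-- In the plane the Jacobian of a radial map is the derivative of q ↦ q h(q)², which sends squared
radius to squared radius. Monotonicity of the radius thus decides the orientation. -/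
theorem hasFDerivAt_radial {h : ℝ → ℝ} {h' : ℝ} {u : ℂ} (hh : HasDerivAt h h' (‖u‖ ^ 2)) :
    ∃ L : ℂ →L[ℝ] ℂ, HasFDerivAt (fun u : ℂ => h (‖u‖ ^ 2) • u) L u ∧
      L.det = h (‖u‖ ^ 2) ^ 2 + ‖u‖ ^ 2 * (2 * h (‖u‖ ^ 2) * h') := by
  have h1 : HasFDerivAt (fun u : ℂ => h (‖u‖ ^ 2)) (h' • (2 • innerSL ℝ u)) u :=
    hh.comp_hasFDerivAt u (hasStrictFDerivAt_norm_sq u).hasFDerivAt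
  refine ⟨_, h1.smul (hasFDerivAt_id u), ?_⟩
  rw [det_complex, Complex.sq_norm, Complex.normSq_apply]
  simp [Complex.inner]
  ring

theorem hasDerivAt_mul_sq {h : ℝ → ℝ} {h' q : ℝ} (hh : HasDerivAt h h' q) :
    HasDerivAt (fun q => q * h q ^ 2) (h q ^ 2 + q * (2 * h q * h')) q := by
  have := (hasDerivAt_id q).mul (hh.pow 2)
  refine this.congr_deriv ?_
  simp

theorem monotoneOn_log_div : MonotoneOn (fun r : ℝ => Real.log (1 + r) / (1 + Real.log (1 + r)))
    (Set.Ici 0) := by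
  intro r hr s hs hrs
  have h1 := log_one_add_nonneg hr
  have h2 : Real.log (1 + r) ≤ Real.log (1 + s) :=
    Real.log_le_log (by have := Set.mem_Ici.1 hr; linarith) (by linarith)
  have h3 := h1.trans h2
  simp only
  rw [div_le_div_iff₀ (by linarith) (by linarith)]
  nlinarith

theorem det_fderiv_disc_nonneg (u : ℂ) : 0 ≤ (fderiv ℝ disc u).det := by
  have hc := ((contDiffAt_contract (sq_nonneg ‖u‖)).differentiableAt (by simp)).hasDerivAt
  obtain ⟨L, hL, hdet⟩ := hasFDerivAt_radial hc
  rw [show fderiv ℝ disc u = L from hL.fderiv, hdet]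
  have h2 := hasDerivAt_mul_sq hc
  have hm : MonotoneOn (fun q => q * contract q ^ 2) (Set.Ici 0) :=
    monotoneOn_log_div.congr fun r hr => (mul_contract_sq hr).symm
  refine h2.hasDerivWithinAt.nonneg_of_monotoneOn (s := Set.Ici (‖u‖ ^ 2)) ?_
    (hm.mono (Set.Ici_subset_Ici.2 (sq_nonneg _)))
  rw [accPt_principal_iff_nhdsWithin]
  have : Set.Ici (‖u‖ ^ 2) \ {‖u‖ ^ 2} = Set.Ioi (‖u‖ ^ 2) := Set.Ici_sdiff_left
  rw [this]; infer_instance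

theorem alt_two_comp_eq_det (η : ℂ [⋀^Fin 2]→L[ℝ] ℝ) (L : ℂ →L[ℝ] ℂ) :
    η ![L 1, L Complex.I] = L.det * η ![1, Complex.I] := by
  have hb : (Complex.basisOneI : Fin 2 → ℂ) = ![1, Complex.I] := Complex.coe_basisOneI
  have h := η.toAlternatingMap.eq_smul_basis_det Complex.basisOneI
  have h2 : ∀ v, η v = η Complex.basisOneI * Complex.basisOneI.det v := fun v =>
    congrArg (fun f : ℂ [⋀^Fin 2]→ₗ[ℝ] ℝ => f v) h
  have h3 : (![L 1, L Complex.I] : Fin 2 → ℂ) = L.toLinearMap ∘ Complex.basisOneI := by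
    rw [hb]; funext i; fin_cases i <;> rfl
  rw [h2 ![L 1, L Complex.I], h3, Module.Basis.det_comp, Module.Basis.det_self, hb, mul_one, mul_comm]

/-- Change of variables for the integral of a two-form over a part of `ℂ`. -/
theorem setIntegral_image_two (A : ℂ → ℂ [⋀^Fin 2]→L[ℝ] ℝ) {f : ℂ → ℂ} {s : Set ℂ}
    (hs : MeasurableSet s) (hf : ∀ u ∈ s, DifferentiableAt ℝ f u) (hdet : ∀ u ∈ s, 0 ≤ (fderiv ℝ f u).det)
    (hinj : Set.InjOn f s) :
    ∫ t in f '' s, A t ![1, Complex.I] =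
      ∫ u in s, (A (f u)).compContinuousLinearMap (fderiv ℝ f u) ![1, Complex.I] := by
  rw [integral_image_eq_integral_abs_det_fderiv_smul volume hs
    (fun u hu => (hf u hu).hasFDerivAt.hasFDerivWithinAt) hinj]
  refine setIntegral_congr_fun hs fun u hu => ?_
  rw [abs_of_nonneg (hdet u hu), smul_eq_mul, ← alt_two_comp_eq_det]
  rw [ContinuousAlternatingMap.compContinuousLinearMap_apply]
  congr 1
  funext i; fin_cases i <;> rfl

theorem integrableOn_image_two (A : ℂ → ℂ [⋀^Fin 2]→L[ℝ] ℝ) {f : ℂ → ℂ} {s : Set ℂ}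
    (hs : MeasurableSet s) (hf : ∀ u ∈ s, DifferentiableAt ℝ f u) (hdet : ∀ u ∈ s, 0 ≤ (fderiv ℝ f u).det)
    (hinj : Set.InjOn f s) :
    IntegrableOn (fun t => A t ![1, Complex.I]) (f '' s) ↔
      IntegrableOn (fun u => (A (f u)).compContinuousLinearMap (fderiv ℝ f u) ![1, Complex.I]) s := by
  rw [integrableOn_image_iff_integrableOn_abs_det_fderiv_smul volume hs
    (fun u hu => (hf u hu).hasFDerivAt.hasFDerivWithinAt) hinj]
  refine integrableOn_congr_fun (fun u hu => ?_) hs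
  rw [abs_of_nonneg (hdet u hu), smul_eq_mul, ← alt_two_comp_eq_det]
  rw [ContinuousAlternatingMap.compContinuousLinearMap_apply]
  congr 1
  funext i; fin_cases i <;> rfl

theorem fderiv_toBall_zero : fderiv ℝ toBall 0 = contract 0 • ContinuousLinearMap.id ℝ R4 := by
  have hd : HasDerivAt contract _ (‖(0 : R4)‖ ^ 2) :=
    ((contDiffAt_contract (sq_nonneg _)).differentiableAt (by simp)).hasDerivAt
  have h1 := HasDerivAt.comp_hasFDerivAt (f := fun u : R4 => ‖u‖ ^ 2)
    (0 : R4) hd (hasStrictFDerivAt_norm_sq (0 : R4)).hasFDerivAt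
  have h2 := (h1.smul (hasFDerivAt_id (0 : R4))).fderiv
  refine h2.trans ?_
  ext v
  simp

/-- The determinant is continuous, never zero because `ofBall` is a smooth left inverse, and
positive at 0; a sign change on the connected space ℝ⁴ would produce a zero. -/
theorem det_fderiv_toBall_pos (u : R4) : 0 < (fderiv ℝ toBall u).det := by
  have hc : Continuous fun u => (fderiv ℝ toBall u).det :=
    ContinuousLinearMap.continuous_det.comp (contDiff_toBall.continuous_fderiv (by simp))
  have hne : ∀ u, (fderiv ℝ toBall u).det ≠ 0 := by
    intro u h0
    have hd : DifferentiableAt ℝ toBall u := contDiff_toBall.differentiable (by simp) u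
    have hd' : DifferentiableAt ℝ ofBall (toBall u) :=
      (contDiffAt_ofBall (norm_toBall_lt u)).differentiableAt (by simp)
    have h1 : fderiv ℝ (fun u => ofBall (toBall u)) u =
        (fderiv ℝ ofBall (toBall u)).comp (fderiv ℝ toBall u) := fderiv_comp u hd' hd
    have h2 : fderiv ℝ (fun u => ofBall (toBall u)) u = ContinuousLinearMap.id ℝ R4 := by
      simp only [ofBall_toBall]; exact fderiv_fun_id
    have h3 := congrArg ContinuousLinearMap.det (h1.symm.trans h2)
    have h4 : ((fderiv ℝ ofBall (toBall u)).comp (fderiv ℝ toBall u)).det =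
        (fderiv ℝ ofBall (toBall u)).det * (fderiv ℝ toBall u).det := LinearMap.det_comp _ _
    rw [h4, h0, mul_zero] at h3
    simp [ContinuousLinearMap.det] at h3
  have h0 : 0 < (fderiv ℝ toBall 0).det := by
    rw [fderiv_toBall_zero]
    simp only [ContinuousLinearMap.det, ContinuousLinearMap.toLinearMap_smul, LinearMap.det_smul]
    have := contract_pos le_rfl
    simp
    positivity
  by_contra hneg
  push Not at hneg
  obtain ⟨v, hv⟩ := mem_range_of_exists_le_of_exists_ge hc ⟨u, hneg⟩ ⟨0, h0.le⟩
  exact hne v hv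

/-- Change of variables for the integral of a four-form over the unit ball. -/
theorem setIntegral_ball_eq (A : R4 → R4 [⋀^Fin (2 + 2)]→L[ℝ] ℝ) :
    ∫ x in Metric.ball (0 : R4) 1, A x e4 =
      ∫ u, (A (toBall u)).compContinuousLinearMap (fderiv ℝ toBall u) e4 := by
  have him : toBall '' Set.univ = Metric.ball (0 : R4) 1 := by
    ext x
    constructor
    · rintro ⟨u, -, rfl⟩; simpa using norm_toBall_lt u
    · intro hx; exact ⟨ofBall x, trivial, toBall_ofBall (by simpa using hx)⟩
  rw [← him, integral_image_eq_integral_abs_det_fderiv_smul volume MeasurableSet.univ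
    (fun u _ => (contDiff_toBall.differentiable (by simp) u).hasFDerivAt.hasFDerivWithinAt)
    (fun u _ v _ h => by rw [← ofBall_toBall u, h, ofBall_toBall]), Measure.restrict_univ]
  refine integral_congr_ae (Filter.Eventually.of_forall fun u => ?_)
  simp only
  rw [abs_of_pos (det_fderiv_toBall_pos u), smul_eq_mul, ← alt_four_comp_eq_det]
  rfl

end DeRham
end
noncomputable section

/-! ### Smoothing of forms in a linear chart -/

namespace ProjSpace

open MeasureTheory DeRham

section Chart

variable (B : Frame3) {k l : ℕ}

theorem exists_mem_linSource (p : CP 2) : ∃ B' : Frame3, p ∈ linSource B' := by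
  obtain ⟨i, hi, -⟩ := exists_norm_linCoord_le p
  exact ⟨_, hi⟩

theorem mdifferentiableAt_linPoint (x : R4) :
    MDifferentiableAt 𝓘(ℝ, R4) 𝓘(ℝ, Fin 2 → ℂ) (linPoint B) x :=
  (contMDiff_linPoint B x).mdifferentiableAt (by simp)

theorem continuous_linPoint : Continuous (linPoint B) := (contMDiff_linPoint B).continuous

/-- The derivative of the coordinates of a linear chart. -/
def coordDeriv (p : CP 2) : (Fin 2 → ℂ) →L[ℝ] R4 :=
  mfderiv 𝓘(ℝ, Fin 2 → ℂ) 𝓘(ℝ, R4) (linCoord B) p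

/-- A form is determined by its expression in a linear chart. -/
theorem eq_comp_mpull_linPoint {p : CP 2} (hp : p ∈ linSource B) (η : Form 2 (CP 2) k) :
    η p = (mpull (linPoint B) η (linCoord B p)).compContinuousLinearMap
      (coordDeriv B p) := by
  have h1 : MDifferentiableAt 𝓘(ℝ, Fin 2 → ℂ) 𝓘(ℝ, R4) (linCoord B) p :=
    (contMDiffAt_linCoord B hp).mdifferentiableAt (by simp)
  have h2 := mfderiv_comp p (mdifferentiableAt_linPoint B (linCoord B p)) h1
  have h3 : mfderiv 𝓘(ℝ, Fin 2 → ℂ) 𝓘(ℝ, Fin 2 → ℂ) (linPoint B ∘ linCoord B) p =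
      ContinuousLinearMap.id ℝ (Fin 2 → ℂ) := by
    have : linPoint B ∘ linCoord B =ᶠ[𝓝 p] id := by
      filter_upwards [(isOpen_linSource B).mem_nhds hp] with q hq using linPoint_linCoord B hq
    rw [this.mfderiv_eq]
    exact mfderiv_id
  rw [h3] at h2
  ext v
  have h4 : ∀ w : Fin 2 → ℂ, mderiv (n := 2) (linPoint B) (linCoord B p)
      (coordDeriv B p w) = w := fun w =>
    (congrArg (fun L : (Fin 2 → ℂ) →L[ℝ] (Fin 2 → ℂ) => L w) h2).symm
  rw [ContinuousAlternatingMap.compContinuousLinearMap_apply, mpull_apply, linPoint_linCoord B hp]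
  congr 1
  funext i
  exact (h4 (v i)).symm

end Chart

/-! ### Conjugated translations as smooth maps of the projective plane -/

section Move

variable (B : Frame3) {k : ℕ} {F : Type*} [NormedAddCommGroup F] [NormedSpace ℝ F]

open Classical in
/-- The conjugated translation of the unit ball of a linear chart, as a map of the plane. -/
def moveL (y : R4) (p : CP 2) : CP 2 :=
  if p ∈ linSource B then linPoint B (act y (linCoord B p)) else p

theorem moveL_linPoint (y x : R4) : moveL B y (linPoint B x) = linPoint B (act y x) := by
  rw [moveL, if_pos (linPoint_mem_linSource B x), linCoord_linPoint]

theorem moveL_of_notMem {p : CP 2} (hp : p ∉ linPoint B '' Metric.ball 0 1) (y : R4) :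
    moveL B y p = p := by
  by_cases h : p ∈ linSource B
  · rw [moveL, if_pos h, act_of_le, linPoint_linCoord B h]
    by_contra hlt
    exact hp ⟨linCoord B p, by simpa using hlt, linPoint_linCoord B h⟩
  · rw [moveL, if_neg h]

theorem isClosed_image_closedBall : IsClosed (linPoint B '' Metric.closedBall 0 1) :=
  ((isCompact_closedBall _ _).image (continuous_linPoint B)).isClosed

theorem moveL_of_notMem' {p : CP 2} (hp : p ∉ linPoint B '' Metric.closedBall 0 1) (y : R4) :
    moveL B y p = p :=
  moveL_of_notMem B (fun h => hp (Set.image_mono Metric.ball_subset_closedBall h)) y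

/-- In the affine chart this is the smoothness of `act`. At a point outside the chart the map is
locally the identity, since the closed ball is compact and hence closed in the plane. -/
theorem contMDiffAt_moveL {g : F → CP 2} {z : R4 × F}
    (hg : ContMDiffAt 𝓘(ℝ, F) 𝓘(ℝ, Fin 2 → ℂ) ∞ g z.2) :
    ContMDiffAt 𝓘(ℝ, R4 × F) 𝓘(ℝ, Fin 2 → ℂ) ∞ (fun z : R4 × F => moveL B z.1 (g z.2)) z := by
  have hs : ContMDiffAt 𝓘(ℝ, R4 × F) 𝓘(ℝ, F) ∞ (fun z : R4 × F => z.2) z :=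
    contDiffAt_snd.contMDiffAt
  have hg2 : ContMDiffAt 𝓘(ℝ, R4 × F) 𝓘(ℝ, Fin 2 → ℂ) ∞ (fun z : R4 × F => g z.2) z :=
    ContMDiffAt.comp z hg hs
  by_cases h : g z.2 ∈ linSource B
  · have heq : (fun z : R4 × F => moveL B z.1 (g z.2)) =ᶠ[𝓝 z]
        fun z => linPoint B (act z.1 (linCoord B (g z.2))) := by
      filter_upwards [hg2.continuousAt ((isOpen_linSource B).mem_nhds h)] with w hw
      exact if_pos hw
    refine ContMDiffAt.congr_of_eventuallyEq ?_ heq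
    have h1 : ContMDiffAt 𝓘(ℝ, R4 × F) 𝓘(ℝ, R4) ∞ (fun z : R4 × F => linCoord B (g z.2)) z :=
      ContMDiffAt.comp z (contMDiffAt_linCoord B h) hg2
    have h2 : ContDiffAt ℝ ∞ (fun z : R4 × F => act z.1 (linCoord B (g z.2))) z :=
      ContDiffAt.comp (g := fun p : R4 × R4 => act p.1 p.2)
        (f := fun z : R4 × F => (z.1, linCoord B (g z.2))) z
        contDiff_act.contDiffAt (contDiffAt_fst.prodMk h1.contDiffAt)
    exact ContMDiffAt.comp (g := linPoint B) (f := fun z : R4 × F => act z.1 (linCoord B (g z.2)))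
      z (contMDiff_linPoint B _) h2.contMDiffAt
  · have h' : g z.2 ∉ linPoint B '' Metric.closedBall 0 1 := by
      rintro ⟨x, -, hx⟩
      exact h (hx ▸ linPoint_mem_linSource B x)
    have heq : (fun z : R4 × F => moveL B z.1 (g z.2)) =ᶠ[𝓝 z] fun z => g z.2 := by
      filter_upwards [hg2.continuousAt ((isClosed_image_closedBall B).isOpen_compl.mem_nhds h')]
        with w hw
      exact moveL_of_notMem' B hw _
    exact hg2.congr_of_eventuallyEq heq

/-- The pullback of a form under the conjugated translations, in dependence on the translation. -/
theorem mpull_moveL {g : F → CP 2} (η : Form 2 (CP 2) k) {y : R4} {x : F}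
    (hg : ContMDiffAt 𝓘(ℝ, F) 𝓘(ℝ, Fin 2 → ℂ) ∞ g x) :
    mpull (fun x => moveL B y (g x)) η x =
      (mpull (fun z : R4 × F => moveL B z.1 (g z.2)) η (y, x)).compContinuousLinearMap
        (ContinuousLinearMap.inr ℝ R4 F) := by
  have h1 : HasFDerivAt (fun x : F => (y, x)) (ContinuousLinearMap.inr ℝ R4 F) x :=
    (hasFDerivAt_prodMk_right y x)
  rw [← h1.fderiv]
  exact mpull_comp (g := fun z : R4 × F => moveL B z.1 (g z.2)) (h := fun x => (y, x))
    ((contMDiffAt_moveL B (z := (y, x)) hg).mdifferentiableAt (by simp)) h1.differentiableAt η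

theorem contDiffAt_mpull_moveL [FiniteDimensional ℝ F] {η : Form 2 (CP 2) k} (hη : IsSmooth η)
    {g : F → CP 2} {z : R4 × F} (hg : ∀ᶠ x in 𝓝 z.2, ContMDiffAt 𝓘(ℝ, F) 𝓘(ℝ, Fin 2 → ℂ) ∞ g x) :
    ContDiffAt ℝ ∞ (fun z : R4 × F => mpull (fun x => moveL B z.1 (g x)) η z.2) z := by
  have hev : ∀ᶠ w in 𝓝 z, ContMDiffAt 𝓘(ℝ, F) 𝓘(ℝ, Fin 2 → ℂ) ∞ g w.2 :=
    continuous_snd.continuousAt.eventually hg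
  have heq : (fun z : R4 × F => mpull (fun x => moveL B z.1 (g x)) η z.2) =ᶠ[𝓝 z] fun z =>
      (mpull (fun z : R4 × F => moveL B z.1 (g z.2)) η z).compContinuousLinearMap
        (ContinuousLinearMap.inr ℝ R4 F) := by
    filter_upwards [hev] with w hw
    exact mpull_moveL B η hw
  refine ContDiffAt.congr_of_eventuallyEq ?_ heq
  refine contDiffAt_altComp (contDiffAt_mpull hη ?_) contDiffAt_const
  filter_upwards [hev] with w hw using contMDiffAt_moveL B hw

end Move

/-! ### Averages of pullbacks under the conjugated translations -/

section Smear

variable (B : Frame3) {k : ℕ} {F : Type*} [NormedAddCommGroup F] [NormedSpace ℝ F]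

/-- The average of the pullbacks of a form under the conjugated translations, with weight `w`. -/
def smear (w : R4 → ℝ) (η : Form 2 (CP 2) k) : Form 2 (CP 2) k := fun p =>
  ∫ y, w y • pullback (moveL B y) η p

theorem contMDiff_moveL (y : R4) :
    ContMDiff 𝓘(ℝ, Fin 2 → ℂ) 𝓘(ℝ, Fin 2 → ℂ) ∞ (moveL B y) := by
  intro p
  obtain ⟨B', hp⟩ := exists_mem_linSource p
  have h1 : ContMDiffAt 𝓘(ℝ, R4 × R4) 𝓘(ℝ, Fin 2 → ℂ) ∞
      (fun z : R4 × R4 => moveL B z.1 (linPoint B' z.2)) (y, linCoord B' p) :=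
    contMDiffAt_moveL B (contMDiff_linPoint B' _)
  have h2 : ContMDiffAt 𝓘(ℝ, R4) 𝓘(ℝ, R4 × R4) ∞ (fun x : R4 => (y, x)) (linCoord B' p) :=
    (contDiffAt_const.prodMk contDiffAt_id).contMDiffAt
  have h3 : ContMDiffAt 𝓘(ℝ, Fin 2 → ℂ) 𝓘(ℝ, R4 × R4) ∞ (fun q : CP 2 => (y, linCoord B' q)) p :=
    ContMDiffAt.comp p h2 (contMDiffAt_linCoord B' hp)
  have h4 : ContMDiffAt 𝓘(ℝ, Fin 2 → ℂ) 𝓘(ℝ, Fin 2 → ℂ) ∞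
      (fun q => moveL B y (linPoint B' (linCoord B' q))) p :=
    ContMDiffAt.comp p h1 h3
  refine h4.congr_of_eventuallyEq ?_
  filter_upwards [(isOpen_linSource B').mem_nhds hp] with q hq
  rw [linPoint_linCoord B' hq]

theorem mpull_pullback_moveL {g : F → CP 2} {x : F} (η : Form 2 (CP 2) k) (y : R4)
    (hg : ContMDiffAt 𝓘(ℝ, F) 𝓘(ℝ, Fin 2 → ℂ) ∞ g x) :
    mpull g (pullback (moveL B y) η) x = mpull (fun x => moveL B y (g x)) η x :=
  mpull_pullback ((contMDiff_moveL B y _).mdifferentiableAt (by simp))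
    (hg.mdifferentiableAt (by simp)) η

theorem continuous_pullback_moveL {η : Form 2 (CP 2) k} (hη : IsSmooth η) (p : CP 2) :
    Continuous fun y => pullback (moveL B y) η p := by
  obtain ⟨B', hp⟩ := exists_mem_linSource p
  have h1 : (fun y => pullback (moveL B y) η p) = fun y =>
      (mpull (fun x => moveL B y (linPoint B' x)) η (linCoord B' p)).compContinuousLinearMap
        (coordDeriv B' p) := by
    funext y
    rw [eq_comp_mpull_linPoint B' hp (pullback (moveL B y) η),
      mpull_pullback_moveL B η y (contMDiff_linPoint B' _)]
  rw [h1]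
  refine continuous_iff_continuousAt.2 fun y => ?_
  have h2 := contDiffAt_mpull_moveL B hη (g := linPoint B') (z := (y, linCoord B' p))
    (Filter.Eventually.of_forall fun x => contMDiff_linPoint B' x)
  have h3 : ContDiffAt ℝ ∞ (fun y : R4 => mpull (fun x => moveL B y (linPoint B' x)) η
      (linCoord B' p)) y :=
    ContDiffAt.comp (f := fun y : R4 => (y, linCoord B' p)) y h2
      (contDiffAt_id.prodMk contDiffAt_const)
  exact (contDiffAt_altComp (F := Fin 2 → ℂ) h3 contDiffAt_const).continuousAt

theorem integrable_smul_pullback_moveL {w : R4 → ℝ} (hw : Continuous w) (hc : HasCompactSupport w)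
    {η : Form 2 (CP 2) k} (hη : IsSmooth η) (p : CP 2) :
    Integrable fun y => w y • pullback (moveL B y) η p :=
  (hw.smul (continuous_pullback_moveL B hη p)).integrable_of_hasCompactSupport hc.smul_right

theorem mpull_smear_apply {w : R4 → ℝ} (hw : Continuous w) (hc : HasCompactSupport w)
    {η : Form 2 (CP 2) k} (hη : IsSmooth η) {g : F → CP 2} {x : F}
    (hg : ContMDiffAt 𝓘(ℝ, F) 𝓘(ℝ, Fin 2 → ℂ) ∞ g x) (v : Fin k → F) :
    mpull g (smear B w η) x v = ∫ y, w y * mpull (fun x => moveL B y (g x)) η x v := by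
  have h := (altEval (fun i => mderiv (n := 2) g x (v i))).integral_comp_comm
    (integrable_smul_pullback_moveL B hw hc hη (g x))
  rw [mpull_apply]
  refine h.symm.trans (integral_congr_ae (Filter.Eventually.of_forall fun y => ?_))
  simp only
  rw [← mpull_pullback_moveL B η y hg]
  simp only [map_smul, altEval_apply, smul_eq_mul, mpull_apply]

theorem isSmooth_smear {w : R4 → ℝ} (hw : ContDiff ℝ ∞ w) (hc : HasCompactSupport w)
    {η : Form 2 (CP 2) k} (hη : IsSmooth η) : IsSmooth (smear B w η) := by
  refine isSmooth_of_forall_exists (F := R4) fun p => ?_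
  obtain ⟨B', hp⟩ := exists_mem_linSource p
  refine ⟨linChart B', hp, fun q hq => (contMDiffAt_linCoord B' hq).contMDiffWithinAt,
    (contMDiff_linPoint B').contMDiffOn, contDiffAt_alt_iff.2 fun v => ?_⟩
  change ContDiffAt ℝ ∞ (fun x => mpull (linPoint B') (smear B w η) x v) _
  simp_rw [fun x => mpull_smear_apply B hw.continuous hc hη (contMDiff_linPoint B' x) v]
  refine ContDiffOn.contDiffAt (s := Set.univ) ?_ Filter.univ_mem
  refine contDiffOn_integral_mul volume isOpen_univ hw hc
    (G := fun z : R4 × R4 => mpull (fun x => moveL B z.1 (linPoint B' x)) η z.2 v) ?_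
  intro z _
  exact (contDiffAt_alt_iff.1 (contDiffAt_mpull_moveL B hη (g := linPoint B') (z := z)
    (Filter.Eventually.of_forall fun x => contMDiff_linPoint B' x)) v).contDiffWithinAt

theorem pullback_moveL_of_notMem (η : Form 2 (CP 2) k) {p : CP 2}
    (hp : p ∉ linPoint B '' Metric.closedBall 0 1) (y : R4) : pullback (moveL B y) η p = η p := by
  have h : moveL B y =ᶠ[𝓝 p] id := by
    filter_upwards [(isClosed_image_closedBall B).isOpen_compl.mem_nhds hp] with q hq
    exact moveL_of_notMem' B hq y
  have h2 : realDeriv (n := 2) (moveL B y) p = ContinuousLinearMap.id ℝ (Fin 2 → ℂ) := by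
    unfold realDeriv
    rw [h.mfderiv_eq]
    exact mfderiv_id
  rw [pullback, h2, h.eq_of_nhds]
  rfl

theorem smear_of_notMem {w : R4 → ℝ} (hw : ∫ y, w y = 1) (η : Form 2 (CP 2) k) {p : CP 2}
    (hp : p ∉ linPoint B '' Metric.closedBall 0 1) : smear B w η p = η p := by
  unfold smear
  simp_rw [pullback_moveL_of_notMem B η hp]
  rw [integral_smul_const, hw, one_smul]

/-- The parametrization of the unit ball of a linear chart by `ℝ⁴`. -/
def ballPoint (u : R4) : CP 2 := linPoint B (toBall u)

theorem contMDiff_ballPoint : ContMDiff 𝓘(ℝ, R4) 𝓘(ℝ, Fin 2 → ℂ) ∞ (ballPoint B) := fun u =>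
  ContMDiffAt.comp u (contMDiff_linPoint B _) contDiff_toBall.contDiffAt.contMDiffAt

theorem moveL_ballPoint (y u : R4) : moveL B y (ballPoint B u) = ballPoint B (u + y) := by
  rw [ballPoint, moveL_linPoint, act_toBall, ballPoint]

theorem mpull_comp_ballPoint {h : F → R4} {x : F} (hh : DifferentiableAt ℝ h x)
    (η : Form 2 (CP 2) k) : mpull (fun x => ballPoint B (h x)) η x =
      (mpull (ballPoint B) η (h x)).compContinuousLinearMap (fderiv ℝ h x) :=
  mpull_comp ((contMDiff_ballPoint B _).mdifferentiableAt (by simp)) hh η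

/-- In the ball coordinates the conjugated translations are honest translations with derivative the
identity, so smearing is a convolution of the coefficients. -/
theorem mpull_ballPoint_smear {w : R4 → ℝ} (hw : Continuous w) (hc : HasCompactSupport w)
    {η : Form 2 (CP 2) k} (hη : IsSmooth η) (u : R4) (v : Fin k → R4) :
    mpull (ballPoint B) (smear B w η) u v = ∫ y, w y * mpull (ballPoint B) η (u + y) v := by
  rw [mpull_smear_apply B hw hc hη (contMDiff_ballPoint B u)]
  refine integral_congr_ae (Filter.Eventually.of_forall fun y => ?_)
  simp only [moveL_ballPoint]
  rw [mpull_comp_ballPoint B (h := fun u => u + y) (differentiableAt_id.add_const y) η]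
  have : fderiv ℝ (fun u : R4 => u + y) u = ContinuousLinearMap.id ℝ R4 := by
    rw [fderiv_add_const]; exact fderiv_fun_id
  rw [this]
  rfl

theorem continuous_mpull_ballPoint {η : Form 2 (CP 2) k} (hη : IsSmooth η) :
    Continuous (mpull (ballPoint B) η) :=
  continuous_iff_continuousAt.2 fun _ => (contDiffAt_mpull hη
    (Filter.Eventually.of_forall fun y => contMDiff_ballPoint B y)).continuousAt

end Smear

end ProjSpace
end
noncomputable section

/-! ### Wedge products with smoothed forms, and pushforwards from the ball -/

namespace DeRham

section WedgeSmooth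

variable {E P : Type*} [NormedAddCommGroup E] [NormedSpace ℝ E] [NormedAddCommGroup P]
  [NormedSpace ℝ P] {k l : ℕ}

theorem contDiffAt_wedgeAlt [FiniteDimensional ℝ E] {a : P → E [⋀^Fin k]→L[ℝ] ℝ}
    {b : P → E [⋀^Fin l]→L[ℝ] ℝ} {x : P} {n : WithTop ℕ∞} (ha : ContDiffAt ℝ n a x)
    (hb : ContDiffAt ℝ n b x) : ContDiffAt ℝ n (fun p => wedgeAlt (a p) (b p)) x := by
  refine contDiffAt_alt_iff.2 fun v => ?_
  have hc : ((k.factorial * l.factorial : ℕ) : ℝ) ≠ 0 := by positivity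
  have heq : (fun p => wedgeAlt (a p) (b p) v) = fun p =>
      ((k.factorial * l.factorial : ℕ) : ℝ)⁻¹ *
      ∑ σ : Equiv.Perm (Fin k ⊕ Fin l), ((Equiv.Perm.sign σ : ℤ) : ℝ) *
        (a p (fun i => v (finSumFinEquiv (σ (Sum.inl i)))) *
          b p (fun i => v (finSumFinEquiv (σ (Sum.inr i))))) := by
    funext p
    rw [← mul_wedgeAlt_eq_sum, inv_mul_cancel_left₀ hc]
  rw [heq]
  refine contDiffAt_const.mul (ContDiffAt.sum fun σ _ => contDiffAt_const.mul ?_)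
  exact (contDiffAt_alt_iff.1 ha _).mul (contDiffAt_alt_iff.1 hb _)

/-- The wedge product with a fixed form on the left, as a functional on two-forms. -/
def wedgeRight (a : E [⋀^Fin 2]→L[ℝ] ℝ) (v : Fin (2 + 2) → E) : (E [⋀^Fin 2]→L[ℝ] ℝ) →L[ℝ] ℝ :=
  a ![v 0, v 1] • altEval ![v 2, v 3] - a ![v 0, v 2] • altEval ![v 1, v 3]
      + a ![v 0, v 3] • altEval ![v 1, v 2] + a ![v 1, v 2] • altEval ![v 0, v 3]
      - a ![v 1, v 3] • altEval ![v 0, v 2] + a ![v 2, v 3] • altEval ![v 0, v 1]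

theorem wedgeRight_apply (a b : E [⋀^Fin 2]→L[ℝ] ℝ) (v : Fin (2 + 2) → E) :
    wedgeRight a v b = wedgeAlt a b v := by
  rw [wedgeAlt_two_two]; simp [wedgeRight]

theorem wedgeAlt_comm (a b : E [⋀^Fin 2]→L[ℝ] ℝ) (v : Fin (2 + 2) → E) :
    wedgeAlt a b v = wedgeAlt b a v := by
  rw [wedgeAlt_two_two, wedgeAlt_two_two]; ring

end WedgeSmooth

section Wedge

variable {n : ℕ} {M : Type*} [TopologicalSpace M] [ChartedSpace (Fin n → ℂ) M] {k l : ℕ}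

theorem isSmooth_wedge {α : Form n M k} {β : Form n M l} (hα : IsSmooth α) (hβ : IsSmooth β) :
    IsSmooth (wedge α β) := by
  intro e he x hx
  have h : pullback e.symm (wedge α β) = fun x =>
      wedgeAlt (pullback e.symm α x) (pullback e.symm β x) := by
    funext x
    exact mpull_wedge e.symm α β x
  rw [h]
  have hn := e.open_target.mem_nhds hx
  exact (contDiffAt_wedgeAlt ((hα e he).contDiffAt hn) ((hβ e he).contDiffAt hn)).contDiffWithinAt

theorem isSmooth_add {α β : Form n M k} (hα : IsSmooth α) (hβ : IsSmooth β) : IsSmooth (α + β) := by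
  intro e he
  have : pullback e.symm (α + β) = pullback e.symm α + pullback e.symm β := by
    funext x; ext v; simp [pullback]
  rw [this]
  exact (hα e he).add (hβ e he)

theorem mem_testForms [CompactSpace M] {η : Form n M k} (h : IsSmooth η) : η ∈ testForms n M k :=
  ⟨h, HasCompactSupport.of_compactSpace η⟩

end Wedge

end DeRham

namespace ProjSpace

open MeasureTheory DeRham

variable (B : Frame3) {k : ℕ} {F : Type*} [NormedAddCommGroup F] [NormedSpace ℝ F]

theorem mpull_smear [FiniteDimensional ℝ F] {w : R4 → ℝ} (hw : Continuous w) (hc : HasCompactSupport w)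
    {η : Form 2 (CP 2) k} (hη : IsSmooth η) {g : F → CP 2} {x : F}
    (hg : ∀ᶠ x in 𝓝 x, ContMDiffAt 𝓘(ℝ, F) 𝓘(ℝ, Fin 2 → ℂ) ∞ g x) :
    Integrable (fun y => w y • mpull (fun x => moveL B y (g x)) η x) ∧
    mpull g (smear B w η) x = ∫ y, w y • mpull (fun x => moveL B y (g x)) η x := by
  have hcont : Continuous fun y => mpull (fun x => moveL B y (g x)) η x := by
    refine continuous_iff_continuousAt.2 fun y => ?_
    have h2 := contDiffAt_mpull_moveL B hη (g := g) (z := (y, x)) hg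
    exact (ContDiffAt.comp (f := fun y : R4 => (y, x)) y h2
      (contDiffAt_id.prodMk contDiffAt_const)).continuousAt
  have hi : Integrable (fun y => w y • mpull (fun x => moveL B y (g x)) η x) :=
    (hw.smul hcont).integrable_of_hasCompactSupport hc.smul_right
  refine ⟨hi, ?_⟩
  ext v
  rw [mpull_smear_apply B hw hc hη hg.self_of_nhds]
  have := (altEval v).integral_comp_comm hi
  rw [altEval_apply] at this
  rw [← this]
  simp

theorem ball_ae_eq_closedBall {E : Type*} [NormedAddCommGroup E] [NormedSpace ℝ E]
    [FiniteDimensional ℝ E] [MeasurableSpace E] [BorelSpace E] [Nontrivial E] (μ : Measure E)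
    [μ.IsAddHaarMeasure] (x : E) (r : ℝ) : Metric.ball x r =ᵐ[μ] Metric.closedBall x r := by
  rw [← Metric.ball_union_sphere]
  exact (union_ae_eq_left_of_ae_eq_empty (ae_eq_empty.2 (Measure.addHaar_sphere μ x r))).symm

theorem setIntegral_ball_mpull (η : Form 2 (CP 2) (2 + 2)) :
    ∫ x in Metric.ball (0 : R4) 1, mpull (linPoint B) η x e4 = ∫ u, mpull (ballPoint B) η u e4 := by
  rw [setIntegral_ball_eq (mpull (linPoint B) η)]
  refine integral_congr_ae (Filter.Eventually.of_forall fun u => ?_)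
  simp only
  rw [← mpull_comp (mdifferentiableAt_linPoint B _) (contDiff_toBall.differentiable (by simp) u)]
  rfl

theorem formInt_wedge_of_eq_zero (B' : Frame3) {η : Form 2 (CP 2) 2}
    (h0 : ∀ p, p ∉ linPoint B '' Metric.ball 0 1 → η p = 0) (ψ : Form 2 (CP 2) 2) :
    formInt B' (wedge η ψ) =
      ∫ u, wedgeAlt (mpull (ballPoint B) η u) (mpull (ballPoint B) ψ u) e4 := by
  have h1 : formInt B' (wedge η ψ) = ∫ x, mpull (linPoint B) (wedge η ψ) x e4 :=
    formInt_eq B' B _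
  rw [h1, ← setIntegral_eq_integral_of_forall_compl_eq_zero (s := Metric.ball (0 : R4) 1)]
  · refine (setIntegral_ball_mpull B (wedge η ψ)).trans ?_
    simp_rw [mpull_wedge]
  · intro x hx
    have hp : linPoint B x ∉ linPoint B '' Metric.ball 0 1 := by
      rintro ⟨x', hx', h⟩
      have := congrArg (linCoord B) h
      rw [linCoord_linPoint, linCoord_linPoint] at this
      exact hx (this ▸ hx')
    have h2 : mpull (linPoint B) η x = 0 := by
      rw [mpull, h0 _ hp]; rfl
    rw [mpull_wedge, h2, wedgeAlt_two_two]
    simp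

/-- Every compactly supported smooth form on `ℝ⁴` is the expression of a smooth form on the plane
that vanishes outside of the unit ball of the linear chart. -/
theorem exists_push {A : R4 → R4 [⋀^Fin k]→L[ℝ] ℝ} (hA : ContDiff ℝ ∞ A) (hc : HasCompactSupport A) :
    ∃ η : Form 2 (CP 2) k, IsSmooth η ∧ (∀ u, mpull (ballPoint B) η u = A u) ∧
      ∀ p, p ∉ linPoint B '' Metric.ball 0 1 → η p = 0 := by
  classical
  let c : CP 2 → R4 := fun p => ofBall (linCoord B p)
  let D : CP 2 → (Fin 2 → ℂ) →L[ℝ] R4 := fun p => mfderiv 𝓘(ℝ, Fin 2 → ℂ) 𝓘(ℝ, R4) c p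
  let η : Form 2 (CP 2) k := fun p =>
    if p ∈ linPoint B '' Metric.ball 0 1 then (A (c p)).compContinuousLinearMap (D p) else 0
  have hmem : ∀ u, ballPoint B u ∈ linPoint B '' Metric.ball 0 1 := fun u =>
    ⟨toBall u, by simpa using norm_toBall_lt u, rfl⟩
  have hcu : ∀ u, c (ballPoint B u) = u := fun u => by
    simp only [c, ballPoint, linCoord_linPoint, ofBall_toBall]
  have hcs : ∀ p ∈ linPoint B '' Metric.ball 0 1, ContMDiffAt 𝓘(ℝ, Fin 2 → ℂ) 𝓘(ℝ, R4) ∞ c p := by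
    rintro _ ⟨x, hx, rfl⟩
    refine ContMDiffAt.comp (g := ofBall) (f := linCoord B) _ ?_
      (contMDiffAt_linCoord B (linPoint_mem_linSource B x))
    rw [linCoord_linPoint]
    exact (contDiffAt_ofBall (by simpa using hx)).contMDiffAt
  have hpull : ∀ u, mpull (ballPoint B) η u = A u := by
    intro u
    have h1 := mfderiv_comp u ((hcs _ (hmem u)).mdifferentiableAt (by simp))
      ((contMDiff_ballPoint B u).mdifferentiableAt (by simp))
    have h2 : c ∘ ballPoint B = id := funext hcu
    rw [h2, mfderiv_id] at h1
    have h3 : ∀ w : R4, D (ballPoint B u) (mderiv (n := 2) (ballPoint B) u w) = w := fun w =>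
      (congrArg (fun L : R4 →L[ℝ] R4 => L w) h1).symm
    ext v
    rw [mpull_apply]
    simp only [η, if_pos (hmem u), hcu]
    rw [ContinuousAlternatingMap.compContinuousLinearMap_apply]
    congr 1
    funext i
    exact h3 (v i)
  refine ⟨η, isSmooth_of_forall_exists (F := R4) fun p => ?_, hpull, fun p hp => if_neg hp⟩
  by_cases hp : p ∈ linPoint B '' Metric.ball 0 1
  · have hp' := hp
    obtain ⟨x, hx, rfl⟩ := hp
    refine ⟨(linChart B).trans ballHomeo.symm, ?_, ?_, ?_, ?_⟩
    · refine ⟨linPoint_mem_linSource B x, ?_⟩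
      change linCoord B (linPoint B x) ∈ Metric.ball 0 1
      rwa [linCoord_linPoint]
    · intro q hq
      refine (hcs q ?_).contMDiffWithinAt
      exact ⟨linCoord B q, hq.2, linPoint_linCoord B hq.1⟩
    · exact (contMDiff_ballPoint B).contMDiffOn
    · have : mpull ((linChart B).trans ballHomeo.symm).symm η = A := funext hpull
      rw [this]
      exact hA.contDiffAt
  · obtain ⟨B', hp'⟩ := exists_mem_linSource p
    refine ⟨linChart B', hp', fun q hq => (contMDiffAt_linCoord B' hq).contMDiffWithinAt,
      (contMDiff_linPoint B').contMDiffOn, ?_⟩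
    -- Near the boundary of the ball the form vanishes identically, because the support of A is
    -- compact and its image is closed in the plane.
    have hcl : IsClosed (ballPoint B '' tsupport A) :=
      (hc.isCompact.image (contMDiff_ballPoint B).continuous).isClosed
    have hpn : p ∉ ballPoint B '' tsupport A := by
      rintro ⟨u, -, rfl⟩; exact hp (hmem u)
    have hz : ∀ q ∉ ballPoint B '' tsupport A, η q = 0 := by
      intro q hq
      by_cases hqb : q ∈ linPoint B '' Metric.ball 0 1
      · obtain ⟨x, hx, rfl⟩ := hqb
        have hxb : linPoint B x = ballPoint B (ofBall x) := by
          rw [ballPoint, toBall_ofBall (by simpa using hx)]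
        have : A (ofBall x) = 0 := by
          by_contra h
          exact hq ⟨ofBall x, subset_tsupport _ h, hxb.symm⟩
        simp only [η, if_pos (Set.mem_image_of_mem (linPoint B) hx)]
        rw [hxb, hcu, this]
        rfl
      · exact if_neg hqb
    have hev : mpull (linPoint B') η =ᶠ[𝓝 (linCoord B' p)] fun _ => 0 := by
      have h1 : ∀ᶠ x in 𝓝 (linCoord B' p), linPoint B' x ∉ ballPoint B '' tsupport A := by
        refine (continuous_linPoint B').continuousAt (hcl.isOpen_compl.mem_nhds ?_)
        rw [linPoint_linCoord B' hp']
        exact hpn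
      filter_upwards [h1] with x hx
      rw [mpull, hz _ hx]; rfl
    exact contDiffAt_const.congr_of_eventuallyEq hev

theorem mpull_moveL_of_notMem (η : Form 2 (CP 2) k) {x : R4} (hx : x ∉ Metric.closedBall (0 : R4) 1)
    (y : R4) : mpull (fun x => moveL B y (linPoint B x)) η x = mpull (linPoint B) η x := by
  refine mpull_congr ?_ η
  filter_upwards [Metric.isClosed_closedBall.isOpen_compl.mem_nhds hx] with z hz
  rw [moveL_linPoint, act_of_le]
  by_contra h
  exact hz (by simpa using (not_le.1 h).le)

theorem continuous_wedge_moveL {β φ : Form 2 (CP 2) 2} (hβ : IsSmooth β) (hφ : IsSmooth φ) :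
    Continuous fun z : R4 × R4 => wedgeAlt (mpull (linPoint B) β z.1)
      (mpull (fun x => moveL B z.2 (linPoint B x)) φ z.1) e4 := by
  have hlin : ∀ x, ContMDiffAt 𝓘(ℝ, R4) 𝓘(ℝ, Fin 2 → ℂ) ∞ (linPoint B) x := contMDiff_linPoint B
  refine continuous_iff_continuousAt.2 fun z => ?_
  have h1 : ContDiffAt ℝ ∞ (fun z : R4 × R4 => mpull (linPoint B) β z.1) z :=
    ContDiffAt.comp z (contDiffAt_mpull hβ (Filter.Eventually.of_forall hlin)) contDiffAt_fst
  have h2 : ContDiffAt ℝ ∞ (fun z : R4 × R4 =>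
      mpull (fun x => moveL B z.2 (linPoint B x)) φ z.1) z :=
    ContDiffAt.comp (g := fun z : R4 × R4 => mpull (fun x => moveL B z.1 (linPoint B x)) φ z.2)
      (f := fun z : R4 × R4 => (z.2, z.1)) z
      (contDiffAt_mpull_moveL B hφ (Filter.Eventually.of_forall hlin))
      (contDiffAt_snd.prodMk contDiffAt_fst)
  exact (contDiffAt_alt_iff.1 (contDiffAt_wedgeAlt h1 h2) e4).continuousAt

/-- The integral over the parametrized plane of the wedge product with a translated form. -/
theorem integrable_wedge_moveL {w : R4 → ℝ} (hw : Continuous w) (hc : HasCompactSupport w)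
    {β φ : Form 2 (CP 2) 2} (hβ : IsSmooth β) (hφ : IsSmooth φ) :
    Integrable (fun z : R4 × R4 => w z.2 * wedgeAlt (mpull (linPoint B) β z.1)
      (mpull (fun x => moveL B z.2 (linPoint B x)) φ z.1) e4) (volume.prod volume) := by
  set H : R4 × R4 → ℝ := fun z => wedgeAlt (mpull (linPoint B) β z.1)
      (mpull (fun x => moveL B z.2 (linPoint B x)) φ z.1) e4 with hH
  have hHc : Continuous H := continuous_wedge_moveL B hβ hφ
  have hF : Continuous fun z : R4 × R4 => w z.2 * H z := (hw.comp continuous_snd).mul hHc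
  rw [← integrableOn_univ, ← Set.union_compl_self (Metric.closedBall (0 : R4) 1 ×ˢ (Set.univ : Set R4)),
    integrableOn_union]
  have hm : MeasurableSet (Metric.closedBall (0 : R4) 1 ×ˢ (Set.univ : Set R4)) :=
    Metric.isClosed_closedBall.measurableSet.prod MeasurableSet.univ
  constructor
  · refine IntegrableOn.of_forall_sdiff_eq_zero
      (s := Metric.closedBall (0 : R4) 1 ×ˢ tsupport w) ?_ hm ?_
    · exact hF.continuousOn.integrableOn_compact ((isCompact_closedBall _ _).prod hc)
    · rintro z ⟨hz1, hz2⟩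
      have : z.2 ∉ tsupport w := fun h => hz2 ⟨hz1.1, h⟩
      change w z.2 * H z = 0
      rw [image_eq_zero_of_notMem_tsupport this, zero_mul]
  -- Outside the ball nothing moves, so the integrand is a product of a function of the point and
  -- the weight.
  · have h1 : Integrable (fun z : R4 × R4 => mpull (linPoint B) (wedge β φ) z.1 e4 * w z.2)
        (volume.prod volume) :=
      (integrable_mpull_linPoint B (isSmooth_wedge hβ hφ)).mul_prod
        (hw.integrable_of_hasCompactSupport hc)
    refine h1.integrableOn.congr_fun (fun z hz => ?_) hm.compl
    have hz1 : z.1 ∉ Metric.closedBall (0 : R4) 1 := fun h => hz ⟨h, trivial⟩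
    simp only
    rw [mpull_moveL_of_notMem B φ hz1, mpull_wedge, mul_comm]

theorem integral_wedge_moveL {w : R4 → ℝ} (hw : Continuous w) (hc : HasCompactSupport w)
    {β φ : Form 2 (CP 2) 2} (hβ : IsSmooth β) (hφ : IsSmooth φ) :
    formInt B (wedge β (smear B w φ)) = ∫ y, w y * ∫ x, wedgeAlt (mpull (linPoint B) β x)
      (mpull (fun x => moveL B y (linPoint B x)) φ x) e4 := by
  have h1 : ∀ x, mpull (linPoint B) (wedge β (smear B w φ)) x e4 = ∫ y, w y *
      wedgeAlt (mpull (linPoint B) β x) (mpull (fun x => moveL B y (linPoint B x)) φ x) e4 := by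
    intro x
    obtain ⟨hi, he⟩ := mpull_smear B hw hc hφ (g := linPoint B) (x := x)
      (Filter.Eventually.of_forall (contMDiff_linPoint B))
    have h2 := (wedgeRight (mpull (linPoint B) β x) e4).integral_comp_comm hi
    rw [← he] at h2
    refine (congrFun (congrArg _ (mpull_wedge _ _ _ _)) e4).trans ?_
    rw [← wedgeRight_apply, ← h2]
    refine integral_congr_ae (Filter.Eventually.of_forall fun y => ?_)
    simp only [map_smul, wedgeRight_apply, smul_eq_mul]
  have h3 : formInt B (wedge β (smear B w φ)) = ∫ x, mpull (linPoint B) (wedge β (smear B w φ)) x e4 :=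
    rfl
  rw [h3]
  simp_rw [h1]
  rw [integral_integral_swap (integrable_wedge_moveL B hw hc hβ hφ)]
  simp_rw [integral_const_mul]

theorem integrable_wedge_moveL_left {β φ : Form 2 (CP 2) 2} (hβ : IsSmooth β) (hφ : IsSmooth φ)
    (y : R4) : Integrable (fun x => wedgeAlt (mpull (linPoint B) β x)
      (mpull (fun x => moveL B y (linPoint B x)) φ x) e4) := by
  rw [← integrableOn_univ, ← Set.union_compl_self (Metric.closedBall (0 : R4) 1), integrableOn_union]
  constructor
  · exact ((continuous_wedge_moveL B hβ hφ).comp (Continuous.prodMk_left y)).continuousOn.integrableOn_compact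
      (isCompact_closedBall _ _)
  · refine (integrable_mpull_linPoint B (isSmooth_wedge hβ hφ)).integrableOn.congr_fun (fun x hx => ?_)
      Metric.isClosed_closedBall.measurableSet.compl
    rw [mpull_moveL_of_notMem B φ hx]
    change mpull (linPoint B) (wedge β φ) x e4 = _
    rw [mpull_wedge]

theorem setIntegral_ball_wedge_moveL (β φ : Form 2 (CP 2) 2) (y : R4) :
    ∫ x in Metric.closedBall (0 : R4) 1, wedgeAlt (mpull (linPoint B) β x)
      (mpull (fun x => moveL B y (linPoint B x)) φ x) e4 =
    ∫ u, wedgeAlt (mpull (ballPoint B) β u) (mpull (ballPoint B) φ (u + y)) e4 := by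
  rw [← setIntegral_congr_set (ball_ae_eq_closedBall volume (0 : R4) 1),
    setIntegral_ball_eq (fun x => wedgeAlt (mpull (linPoint B) β x)
      (mpull (fun x => moveL B y (linPoint B x)) φ x))]
  refine integral_congr_ae (Filter.Eventually.of_forall fun u => ?_)
  have hd : DifferentiableAt ℝ toBall u := contDiff_toBall.differentiable (by simp) u
  have h1 : mpull (ballPoint B) β u = (mpull (linPoint B) β (toBall u)).compContinuousLinearMap
      (fderiv ℝ toBall u) := mpull_comp (mdifferentiableAt_linPoint B _) hd β
  have h2 : mpull (ballPoint B) φ (u + y) =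
      (mpull (fun x => moveL B y (linPoint B x)) φ (toBall u)).compContinuousLinearMap
      (fderiv ℝ toBall u) := by
    rw [← mpull_comp (g := fun x => moveL B y (linPoint B x)) ?_ hd φ]
    · have h3 : (fun u => moveL B y (linPoint B (toBall u))) = fun u => ballPoint B (u + y) :=
        funext fun u => moveL_ballPoint B y u
      rw [h3, mpull_comp_ballPoint B (h := fun u => u + y) (differentiableAt_id.add_const y) φ,
        fderiv_add_const, fderiv_fun_id]
      rfl
    · exact ((contMDiff_moveL B y _).comp _ (contMDiff_linPoint B _)).mdifferentiableAt (by simp)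
  simp only
  rw [h1, h2, wedgeAlt_compContinuousLinearMap]

/-- Inside the ball substitute u ↦ u - y in the ball coordinates; outside both pullbacks are
trivial. Two-forms commute. -/
theorem integral_wedge_moveL_symm {β φ : Form 2 (CP 2) 2} (hβ : IsSmooth β) (hφ : IsSmooth φ) (y : R4) :
    ∫ x, wedgeAlt (mpull (linPoint B) β x) (mpull (fun x => moveL B y (linPoint B x)) φ x) e4 =
    ∫ x, wedgeAlt (mpull (linPoint B) φ x) (mpull (fun x => moveL B (-y) (linPoint B x)) β x) e4 := by
  have hm : MeasurableSet (Metric.closedBall (0 : R4) 1) := Metric.isClosed_closedBall.measurableSet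
  rw [← integral_add_compl hm (integrable_wedge_moveL_left B hβ hφ y),
    ← integral_add_compl hm (integrable_wedge_moveL_left B hφ hβ (-y)),
    setIntegral_ball_wedge_moveL, setIntegral_ball_wedge_moveL]
  congr 1
  · rw [← integral_sub_right_eq_self (fun u => wedgeAlt (mpull (ballPoint B) β u)
      (mpull (ballPoint B) φ (u + y)) e4) y]
    refine integral_congr_ae (Filter.Eventually.of_forall fun u => ?_)
    simp only
    rw [sub_add_cancel, wedgeAlt_comm, sub_eq_add_neg]
  · refine setIntegral_congr_fun hm.compl fun x hx => ?_
    rw [mpull_moveL_of_notMem B φ hx, mpull_moveL_of_notMem B β hx, wedgeAlt_comm]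

/-- Pulling back by a translation is adjoint to pulling back by its inverse, so an even weight makes
smearing self-adjoint. This transfers the smearing from the test form to the representing form. -/
theorem formInt_wedge_smear (B' : Frame3) {w : R4 → ℝ} (hw : ContDiff ℝ ∞ w) (hc : HasCompactSupport w)
    (he : ∀ y, w (-y) = w y) {β φ : Form 2 (CP 2) 2} (hβ : IsSmooth β) (hφ : IsSmooth φ) :
    formInt B' (wedge β (smear B w φ)) = formInt B' (wedge (smear B w β) φ) := by
  have hsymm : wedge (smear B w β) φ = wedge φ (smear B w β) := by
    funext p; ext v; exact wedgeAlt_comm _ _ _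
  rw [hsymm, formInt_eq B' B, formInt_eq B' B]
  refine (integral_wedge_moveL B hw.continuous hc hβ hφ).trans
    (Eq.trans ?_ (integral_wedge_moveL B hw.continuous hc hφ hβ).symm)
  rw [← integral_neg_eq_self]
  refine integral_congr_ae (Filter.Eventually.of_forall fun y => ?_)
  simp only
  rw [he, integral_wedge_moveL_symm B hβ hφ, neg_neg]

end ProjSpace
end
noncomputable section

/-! ### De Rham data on the projective plane -/

namespace ProjSpace

open MeasureTheory DeRham

section Ratio

variable (B : Frame3)

/-- The sum of the squares of the absolute values of the coordinates. -/
def coordSum (v : Fin 3 → ℂ) : ℝ :=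
  ‖B.equivFun v 0‖ ^ 2 + ‖B.equivFun v 1‖ ^ 2 + ‖B.equivFun v 2‖ ^ 2

theorem coordSum_pos {v : Fin 3 → ℂ} (hv : v ≠ 0) : 0 < coordSum B v := by
  have h : ∃ i, B.equivFun v i ≠ 0 := by
    by_contra hc
    push Not at hc
    exact hv (B.equivFun.map_eq_zero_iff.1 (funext hc))
  obtain ⟨i, hi⟩ := h
  have hp : 0 < ‖B.equivFun v i‖ ^ 2 := by positivity
  have h0 := sq_nonneg ‖B.equivFun v 0‖
  have h1 := sq_nonneg ‖B.equivFun v 1‖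
  have h2 := sq_nonneg ‖B.equivFun v 2‖
  unfold coordSum
  fin_cases i <;> simp only [Fin.zero_eta, Fin.mk_one, Fin.reduceFinMk] at hp <;> linarith

/-- The share of the `i`-th coordinate in the sum of squares. -/
def coordRatio (i : Fin 3) : CP 2 → ℝ :=
  Projectivization.lift (fun v => ‖B.equivFun v.1 i‖ ^ 2 / coordSum B v.1) (by
    rintro ⟨a, ha⟩ ⟨b, hb⟩ t h
    have ht : ‖t‖ ^ 2 ≠ 0 := by
      have : t ≠ 0 := by
        rintro rfl
        exact ha (by simpa using h)
      positivity
    simp only at h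
    subst h
    simp only [coordSum, map_smul, Pi.smul_apply, smul_eq_mul, norm_mul, mul_pow, ← mul_add]
    exact mul_div_mul_left _ _ ht)

theorem coordRatio_mk (i : Fin 3) (v : Fin 3 → ℂ) (hv : v ≠ 0) :
    coordRatio B i (Projectivization.mk ℂ v hv) = ‖B.equivFun v i‖ ^ 2 / coordSum B v := rfl

theorem contMDiff_coordRatio (i : Fin 3) :
    ContMDiff 𝓘(ℝ, Fin 2 → ℂ) 𝓘(ℝ, ℝ) ∞ (coordRatio B i) := by
  intro p
  induction p using Projectivization.ind with
  | h v hv =>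
    refine contMDiffAt_of_comp_mk (g := fun v => ‖B.equivFun v i‖ ^ 2 / coordSum B v) hv ?_
      (coordRatio_mk B i)
    have h : ∀ j, ContDiff ℝ ∞ fun v : Fin 3 → ℂ => ‖B.equivFun v j‖ ^ 2 := fun j =>
      (contDiff_equivFun B j).norm_sq ℝ
    exact (h i).contDiffAt.div (((h 0).add (h 1)).add (h 2)).contDiffAt (coordSum_pos B hv).ne'

theorem continuous_coordRatio (i : Fin 3) : Continuous (coordRatio B i) :=
  (contMDiff_coordRatio B i).continuous

theorem coordRatio_zero_linPoint (x : R4) :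
    coordRatio B 0 (linPoint B x) = 1 / (1 + ‖x‖ ^ 2) := by
  rw [linPoint, coordRatio_mk, coordSum, equivFun_linVec, norm_sq_eq_cx]
  simp [add_assoc]

theorem coordRatio_zero_of_notMem {p : CP 2} (hp : p ∉ linSource B) : coordRatio B 0 p = 0 := by
  induction p using Projectivization.ind with
  | h v hv =>
    rw [mk_mem_linSource, not_not] at hp
    rw [coordRatio_mk, hp]
    simp

/-- The cut-off function that is `1` near the unit ball of a linear chart. -/
def linCutoff (p : CP 2) : ℝ := Real.smoothTransition (10 * coordRatio B 0 p - 3)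

theorem contMDiff_linCutoff : ContMDiff 𝓘(ℝ, Fin 2 → ℂ) 𝓘(ℝ, ℝ) ∞ (linCutoff B) := by
  have h : ContDiff ℝ ∞ fun r : ℝ => Real.smoothTransition (10 * r - 3) :=
    Real.smoothTransition.contDiff.comp ((contDiff_const.mul contDiff_id).sub contDiff_const)
  exact h.contMDiff.comp (contMDiff_coordRatio B 0)

theorem tsupport_linCutoff : tsupport (linCutoff B) ⊆ linSource B := by
  have hcl : IsClosed {p | 3 / 10 ≤ coordRatio B 0 p} :=
    isClosed_le continuous_const (continuous_coordRatio B 0)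
  have h1 : tsupport (linCutoff B) ⊆ {p | 3 / 10 ≤ coordRatio B 0 p} := by
    refine closure_minimal (fun p hp => ?_) hcl
    by_contra h
    simp only [Set.mem_ofPred_eq, not_le] at h
    exact hp (Real.smoothTransition.zero_of_nonpos (by linarith))
  intro p hp
  by_contra h
  have h2 := h1 hp
  rw [Set.mem_ofPred_eq, coordRatio_zero_of_notMem B h] at h2
  norm_num at h2

theorem linCutoff_eventually {p : CP 2} (hp : p ∈ linPoint B '' Metric.closedBall 0 1) :
    linCutoff B =ᶠ[𝓝 p] 1 := by
  obtain ⟨x, hx, rfl⟩ := hp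
  have hx' : ‖x‖ ≤ 1 := by simpa using hx
  -- The ratio 1 / (1 + ‖x‖²) is at least 1/2 on the closed ball, and the cut-off equals 1 as soon
  -- as the ratio is at least 4/10.
  have h1 : 4 / 10 < coordRatio B 0 (linPoint B x) := by
    rw [coordRatio_zero_linPoint, lt_div_iff₀ (by positivity)]
    nlinarith [norm_nonneg x]
  filter_upwards [(continuous_coordRatio B 0).continuousAt.eventually (lt_mem_nhds h1)] with q hq
  exact Real.smoothTransition.one_of_one_le (by linarith)

end Ratio

section Frames

variable (B : Frame3)

/-- The basis whose `0`-th vector is the `j`-th of `B`, the others being doubled. -/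
def pivot (j : Fin 3) : Frame3 :=
  (B.reindex (Equiv.swap 0 j)).unitsSMul ![1, Units.mk0 2 two_ne_zero, Units.mk0 2 two_ne_zero]

theorem pivot_apply_zero (j : Fin 3) : pivot B j 0 = B j := by
  simp [pivot, Module.Basis.unitsSMul_apply]

theorem pivot_apply_one (j : Fin 3) : pivot B j 1 = (2 : ℂ) • B (Equiv.swap 0 j 1) := by
  simp [pivot, Module.Basis.unitsSMul_apply]

theorem pivot_apply_two (j : Fin 3) : pivot B j 2 = (2 : ℂ) • B (Equiv.swap 0 j 2) := by
  simp [pivot, Module.Basis.unitsSMul_apply]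

theorem equivFun_pivot (j : Fin 3) (v : Fin 3 → ℂ) : (pivot B j).equivFun v =
    ![B.equivFun v j, B.equivFun v (Equiv.swap 0 j 1) / 2, B.equivFun v (Equiv.swap 0 j 2) / 2] := by
  rw [← LinearEquiv.eq_symm_apply, Module.Basis.equivFun_symm_apply, Fin.sum_univ_three,
    pivot_apply_zero, pivot_apply_one, pivot_apply_two]
  simp only [Matrix.cons_val_zero, Matrix.cons_val_one, Matrix.cons_val, smul_smul,
    div_mul_cancel₀ _ (two_ne_zero (α := ℂ))]
  conv_lhs => rw [comb_equivFun B v]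
  fin_cases j
  · simp
  · simp [Equiv.swap_apply_def]; abel
  · simp [Equiv.swap_apply_def]; abel

/-- The linear charts of the de Rham data: the one at `[B₁]`, the one at `[B₀]` and the one at
`[B₂]`, in this order. -/
def frames : Fin 3 → Frame3 := ![pivot B 1, B, pivot B 2]

theorem norm_sq_linCoord_mk (v : Fin 3 → ℂ) (hv : v ≠ 0) :
    ‖linCoord B (Projectivization.mk ℂ v hv)‖ ^ 2 =
      (‖B.equivFun v 1‖ ^ 2 + ‖B.equivFun v 2‖ ^ 2) / ‖B.equivFun v 0‖ ^ 2 := by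
  rw [linCoord_mk, norm_sq_cx_symm]
  simp only [norm_div, div_pow, add_div]

theorem mk_mem_ball {v : Fin 3 → ℂ} (hv : v ≠ 0)
    (h : ‖B.equivFun v 1‖ ^ 2 + ‖B.equivFun v 2‖ ^ 2 < ‖B.equivFun v 0‖ ^ 2) :
    Projectivization.mk ℂ v hv ∈ linSource B ∧
      linCoord B (Projectivization.mk ℂ v hv) ∈ Metric.ball 0 1 := by
  have h0 : 0 < ‖B.equivFun v 0‖ ^ 2 := lt_of_le_of_lt (by positivity) h
  have h1 : B.equivFun v 0 ≠ 0 := by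
    intro h; simp [h] at h0
  refine ⟨(mk_mem_linSource B v hv).2 h1, ?_⟩
  have h2 := norm_sq_linCoord_mk B v hv
  have h3 : ‖linCoord B (Projectivization.mk ℂ v hv)‖ ^ 2 < 1 := by
    rw [h2, div_lt_one h0]; exact h
  rw [mem_ball_zero_iff]
  nlinarith [norm_nonneg (linCoord B (Projectivization.mk ℂ v hv))]

/-- With a, b, c the squared absolute values of the coordinates, the balls are b + c < a, a + c < 4b
and a + b < 4c. If the first two inequalities fail, then b ≤ 2c/3 and a ≤ 5c/3, so the third holds.
The doubling in `pivot` supplies the factor 4; without it the points with a = b = c would be missed.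
-/
theorem exists_mem_ball_frames (p : CP 2) :
    ∃ i, p ∈ linSource (frames B i) ∧ linCoord (frames B i) p ∈ Metric.ball 0 1 := by
  induction p using Projectivization.ind with
  | h v hv =>
    by_cases h1 : ‖B.equivFun v 1‖ ^ 2 + ‖B.equivFun v 2‖ ^ 2 < ‖B.equivFun v 0‖ ^ 2
    · exact ⟨1, mk_mem_ball B hv h1⟩
    by_cases h0 : ‖B.equivFun v 0‖ ^ 2 + ‖B.equivFun v 2‖ ^ 2 < 4 * ‖B.equivFun v 1‖ ^ 2
    · refine ⟨0, mk_mem_ball (pivot B 1) hv ?_⟩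
      rw [equivFun_pivot]
      simp [Equiv.swap_apply_def, div_pow, -Module.Basis.equivFun_apply]
      linarith
    · refine ⟨2, mk_mem_ball (pivot B 2) hv ?_⟩
      have := coordSum_pos B hv
      rw [equivFun_pivot]
      simp [Equiv.swap_apply_def, div_pow, -Module.Basis.equivFun_apply]
      unfold coordSum at this
      linarith

end Frames

/-- The bump function of the de Rham data. -/
def evenBump : ContDiffBump (0 : R4) := ⟨1 / 4, 1 / 2, by norm_num, by norm_num⟩

/-- The de Rham data belonging to a basis. -/
def planeData (B : Frame3) : DeRhamData 2 (CP 2) where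
  N := 3
  chart i := linChart (frames B i)
  chart_target _ := rfl
  chart_smooth i := fun _ hq => (contMDiffAt_linCoord (frames B i) hq).contMDiffWithinAt
  chart_symm_smooth i := contMDiff_linPoint (frames B i)
  cover := exists_mem_ball_frames B
  cutoff i := linCutoff (frames B i)
  cutoff_smooth i := contMDiff_linCutoff (frames B i)
  cutoff_nonneg _ _ := Real.smoothTransition.nonneg _
  cutoff_compact _ := HasCompactSupport.of_compactSpace _
  cutoff_support i := tsupport_linCutoff (frames B i)
  cutoff_one i _ hx := linCutoff_eventually (frames B i) hx
  shrink _ := ballHomeo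
  shrink_source _ := rfl
  shrink_target _ := rfl
  shrink_smooth _ := contDiff_toBall
  shrink_symm_smooth _ := fun x hx => (contDiffAt_ofBall (by simpa using hx)).contDiffWithinAt
  act_smooth _ := contDiff_act
  bump _ := evenBump.normed volume
  bump_smooth _ := evenBump.contDiff_normed
  bump_nonneg _ := evenBump.nonneg_normed
  bump_support _ := by
    rw [evenBump.tsupport_normed_eq]
    exact Metric.closedBall_subset_ball (by norm_num [evenBump])
  bump_even _ := evenBump.normed_neg
  bump_integral _ := evenBump.integral_normed

/-! ### The scaled bump function -/

/-- The scaled bump function `ε⁻⁴ f (y / ε)`. -/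
def epsBump (ε : ℝ) (y : R4) : ℝ := (ε ^ (2 * 2))⁻¹ * evenBump.normed volume (ε⁻¹ • y)

theorem contDiff_epsBump (ε : ℝ) : ContDiff ℝ ∞ (epsBump ε) :=
  contDiff_const.mul (evenBump.contDiff_normed.comp (contDiff_const_smul _))

theorem epsBump_neg (ε : ℝ) (y : R4) : epsBump ε (-y) = epsBump ε y := by
  rw [epsBump, smul_neg, evenBump.normed_neg, epsBump]

theorem epsBump_eq_zero {ε : ℝ} (hε : 0 < ε) {y : R4} (hy : ε ≤ ‖y‖) : epsBump ε y = 0 := by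
  have h : ε⁻¹ • y ∉ Function.support (evenBump.normed volume) := by
    rw [evenBump.support_normed_eq, mem_ball_zero_iff, not_lt, norm_smul, norm_inv,
      Real.norm_of_nonneg hε.le]
    have h1 : 1 ≤ ε⁻¹ * ‖y‖ := by
      rw [inv_mul_eq_div, one_le_div hε]; exact hy
    refine le_trans ?_ h1
    norm_num [evenBump]
  rw [epsBump, Function.notMem_support.1 h, mul_zero]

theorem hasCompactSupport_epsBump {ε : ℝ} (hε : 0 < ε) : HasCompactSupport (epsBump ε) := by
  refine HasCompactSupport.intro (isCompact_closedBall (0 : R4) ε) fun y hy => ?_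
  exact epsBump_eq_zero hε (by simpa using (not_le.1 (by simpa using hy)).le)

/-- Integrals against the scaled bump function. -/
theorem integral_epsBump_mul {ε : ℝ} (hε : 0 < ε) (g : R4 → ℝ) :
    ∫ y, epsBump ε y * g y = ∫ y, evenBump.normed volume y * g (ε • y) := by
  have h := Measure.integral_comp_smul (volume : Measure R4)
    (fun y => evenBump.normed volume (ε⁻¹ • y) * g y) ε
  have h4 : Module.finrank ℝ R4 = 2 * 2 := finrank_euclideanSpace_fin
  rw [h4, abs_of_nonneg (by positivity)] at h
  simp only [smul_smul, inv_mul_cancel₀ hε.ne', one_smul] at h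
  rw [h, smul_eq_mul, ← integral_const_mul]
  simp only [epsBump, mul_assoc]

theorem integral_epsBump {ε : ℝ} (hε : 0 < ε) : ∫ y, epsBump ε y = 1 := by
  have := integral_epsBump_mul hε fun _ => 1
  simpa [evenBump.integral_normed] using this

/-! ### The smoothing operators of the data -/

section Dual

variable (B : Frame3) {k : ℕ}

/-- The cut-off has no effect: it is 1 on the closed ball, and outside of it smearing is the
identity. -/
theorem localDual_planeData {ε : ℝ} (hε : 0 < ε) (i : Fin 3) (η : Form 2 (CP 2) k) :
    (planeData B).localDual i ε η = smear (frames B i) (epsBump ε) η := by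
  funext p
  change linCutoff (frames B i) p • smear (frames B i) (epsBump ε) η p +
    (1 - linCutoff (frames B i) p) • η p = _
  by_cases hp : p ∈ linPoint (frames B i) '' Metric.closedBall 0 1
  · rw [(linCutoff_eventually (frames B i) hp).eq_of_nhds]
    simp
  · rw [smear_of_notMem (frames B i) (integral_epsBump hε) η hp, ← add_smul]
    simp

theorem dual_planeData {ε : ℝ} (hε : 0 < ε) (η : Form 2 (CP 2) k) :
    (planeData B).dual ε η = smear (pivot B 2) (epsBump ε)
      (smear B (epsBump ε) (smear (pivot B 1) (epsBump ε) η)) := by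
  have h : (planeData B).dual ε η = (planeData B).localDual (2 : Fin 3) ε
      ((planeData B).localDual (1 : Fin 3) ε ((planeData B).localDual (0 : Fin 3) ε η)) := rfl
  rw [h, localDual_planeData B hε, localDual_planeData B hε, localDual_planeData B hε]
  rfl

theorem isSmooth_smear_epsBump {ε : ℝ} (hε : 0 < ε) {η : Form 2 (CP 2) k} (hη : IsSmooth η) :
    IsSmooth (smear B (epsBump ε) η) :=
  isSmooth_smear B (contDiff_epsBump ε) (hasCompactSupport_epsBump hε) hη

end Dual

end ProjSpace
end
noncomputable section

/-! ### The current of integration over a line -/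

namespace ProjSpace

open MeasureTheory DeRham

variable (B : Frame3)

/-- The affine parametrization of the line through `[B₀]` and `[B₁]`. -/
def linePoint (t : ℂ) : CP 2 := linPoint B (pl t)

theorem contMDiff_linePoint : ContMDiff 𝓘(ℝ, ℂ) 𝓘(ℝ, Fin 2 → ℂ) ∞ (linePoint B) := fun t =>
  ContMDiffAt.comp t (contMDiff_linPoint B _) pl.contDiff.contDiffAt.contMDiffAt

theorem continuous_mpull_linePoint {k : ℕ} {η : Form 2 (CP 2) k} (hη : IsSmooth η) :
    Continuous (mpull (linePoint B) η) :=
  continuous_iff_continuousAt.2 fun _ => (contDiffAt_mpull hη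
    (Filter.Eventually.of_forall fun y => contMDiff_linePoint B y)).continuousAt

theorem linVec_pl (t : ℂ) : linVec B (pl t) = B 0 + t • B 1 := by
  rw [linVec, cx_pl]; simp

theorem linePoint_eq_lineParam {a b : Fin 3 → ℂ} (hab : LinearIndependent ℂ ![a, b])
    (ha : B 0 = a) (hb : B 1 = b) (t : ℂ) : linePoint B t = lineParam a b hab t := by
  subst ha hb
  simp only [linePoint, linPoint, linVec_pl]
  rfl

/-- Divide B₁ + 2s B₀ by 2s. Thus the disc |s| < 1 of the pivoted chart is |t| > 1/2, together with
the point [B₁]. -/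
theorem linePoint_pivot {s : ℂ} (hs : s ≠ 0) : linePoint (pivot B 1) s = linePoint B (2 * s)⁻¹ := by
  have h2 : (2 : ℂ) ≠ 0 := two_ne_zero
  refine (Projectivization.mk_eq_mk_iff' ℂ _ _ _ _).2 ⟨2 * s, ?_⟩
  rw [linVec_pl, linVec_pl, pivot_apply_zero, pivot_apply_one, smul_add, smul_smul, smul_smul,
    mul_inv_cancel₀ (mul_ne_zero h2 hs), one_smul, Equiv.swap_apply_right, mul_comm s 2]
  exact add_comm _ _

/-- The integral of a two-form over the line. -/
def lineInt (η : Form 2 (CP 2) 2) : ℝ := ∫ t, mpull (linePoint B) η t ![1, Complex.I]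

theorem continuous_lineIntegrand {η : Form 2 (CP 2) 2} (hη : IsSmooth η) :
    Continuous fun t => mpull (linePoint B) η t ![1, Complex.I] :=
  continuous_alt_iff.1 (continuous_mpull_linePoint B hη) _

theorem det_fderiv_nonneg_of_complex {f : ℂ → ℂ} {c u : ℂ} (h : HasDerivAt f c u) :
    DifferentiableAt ℝ f u ∧ 0 ≤ (fderiv ℝ f u).det := by
  have h1 := h.hasFDerivAt.restrictScalars ℝ
  refine ⟨h1.differentiableAt, ?_⟩
  rw [h1.fderiv, det_complex]
  simp
  nlinarith [mul_self_nonneg c.re, mul_self_nonneg c.im]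

theorem image_inv_two_mul {r : ℝ} (hr : 0 < r) :
    (fun s : ℂ => (2 * s)⁻¹) '' (Metric.ball 0 (2 * r)⁻¹ \ {0}) = (Metric.closedBall (0 : ℂ) r)ᶜ := by
  ext t
  constructor
  · rintro ⟨s, ⟨hs, hs0⟩, rfl⟩
    have hs0' : 0 < ‖s‖ := norm_pos_iff.2 hs0
    rw [mem_ball_zero_iff, lt_inv_comm₀ hs0' (by positivity)] at hs
    simp only [Set.mem_compl_iff, mem_closedBall_zero_iff, not_le, norm_inv, norm_mul,
      Complex.norm_ofNat, mul_inv]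
    linarith
  · intro ht
    simp only [Set.mem_compl_iff, mem_closedBall_zero_iff, not_le] at ht
    have ht0 : t ≠ 0 := by
      rintro rfl; simp at ht; linarith
    refine ⟨(2 * t)⁻¹, ⟨?_, ?_⟩, ?_⟩
    · simp only [mem_ball_zero_iff, norm_inv, norm_mul, Complex.norm_ofNat]
      exact inv_strictAnti₀ (by positivity) (by linarith)
    · simpa using ht0
    · simp only [mul_inv, inv_inv]
      ring

theorem mpull_linePoint_pivot (η : Form 2 (CP 2) 2) {s : ℂ} (hs : s ≠ 0) :
    mpull (linePoint (pivot B 1)) η s = (mpull (linePoint B) η (2 * s)⁻¹).compContinuousLinearMap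
      (fderiv ℝ (fun s : ℂ => (2 * s)⁻¹) s) := by
  have hd : HasDerivAt (fun s : ℂ => (2 * s)⁻¹) _ s :=
    ((hasDerivAt_id s).const_mul 2).inv (mul_ne_zero two_ne_zero hs)
  rw [← mpull_comp ((contMDiff_linePoint B _).mdifferentiableAt (by simp))
    (det_fderiv_nonneg_of_complex hd).1]
  refine mpull_congr ?_ η
  filter_upwards [isOpen_ne.mem_nhds hs] with z hz using linePoint_pivot B hz

theorem inv_two_mul_data {s : ℂ} (hs : s ≠ 0) :
    DifferentiableAt ℝ (fun s : ℂ => (2 * s)⁻¹) s ∧ 0 ≤ (fderiv ℝ (fun s : ℂ => (2 * s)⁻¹) s).det :=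
  det_fderiv_nonneg_of_complex (((hasDerivAt_id s).const_mul 2).inv (mul_ne_zero two_ne_zero hs))

theorem injOn_inv_two_mul (S : Set ℂ) : Set.InjOn (fun s : ℂ => (2 * s)⁻¹) S := by
  intro s _ s' _ h
  have := inv_injective h
  exact mul_left_cancel₀ two_ne_zero this

theorem ball_diff_ae_eq (r : ℝ) : (Metric.ball (0 : ℂ) r \ {0} : Set ℂ) =ᵐ[volume] Metric.ball (0 : ℂ) r :=
  sdiff_null_ae_eq_self (measure_singleton 0)

theorem setIntegral_compl_closedBall (η : Form 2 (CP 2) 2) {r : ℝ} (hr : 0 < r) :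
    ∫ t in (Metric.closedBall (0 : ℂ) r)ᶜ, mpull (linePoint B) η t ![1, Complex.I] =
      ∫ s in Metric.ball (0 : ℂ) (2 * r)⁻¹, mpull (linePoint (pivot B 1)) η s ![1, Complex.I] := by
  have hm : MeasurableSet (Metric.ball (0 : ℂ) (2 * r)⁻¹ \ {0}) :=
    Metric.isOpen_ball.measurableSet.diff (measurableSet_singleton 0)
  rw [← image_inv_two_mul hr, setIntegral_image_two _ hm (fun s hs => (inv_two_mul_data hs.2).1)
    (fun s hs => (inv_two_mul_data hs.2).2) (injOn_inv_two_mul _),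
    ← setIntegral_congr_set (ball_diff_ae_eq _)]
  refine setIntegral_congr_fun hm fun s hs => ?_
  rw [mpull_linePoint_pivot B η hs.2]

theorem integrableOn_compl_closedBall {η : Form 2 (CP 2) 2} (hη : IsSmooth η) {r : ℝ} (hr : 0 < r) :
    IntegrableOn (fun t => mpull (linePoint B) η t ![1, Complex.I]) (Metric.closedBall (0 : ℂ) r)ᶜ := by
  have hm : MeasurableSet (Metric.ball (0 : ℂ) (2 * r)⁻¹ \ {0}) :=
    Metric.isOpen_ball.measurableSet.diff (measurableSet_singleton 0)
  rw [← image_inv_two_mul hr, integrableOn_image_two _ hm (fun s hs => (inv_two_mul_data hs.2).1)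
    (fun s hs => (inv_two_mul_data hs.2).2) (injOn_inv_two_mul _)]
  have h1 : IntegrableOn (fun t => mpull (linePoint (pivot B 1)) η t ![1, Complex.I])
      (Metric.ball (0 : ℂ) (2 * r)⁻¹ \ {0}) :=
    ((continuous_lineIntegrand (pivot B 1) hη).continuousOn.integrableOn_compact
      (isCompact_closedBall 0 (2 * r)⁻¹)).mono_set
        (Set.sdiff_subset.trans Metric.ball_subset_closedBall)
  refine h1.congr_fun (fun s hs => ?_) hm
  simp only
  rw [mpull_linePoint_pivot B η hs.2]

theorem integrable_lineIntegrand {η : Form 2 (CP 2) 2} (hη : IsSmooth η) :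
    Integrable fun t => mpull (linePoint B) η t ![1, Complex.I] := by
  rw [← integrableOn_univ, ← Set.union_compl_self (Metric.closedBall (0 : ℂ) 1), integrableOn_union]
  exact ⟨(continuous_lineIntegrand B hη).continuousOn.integrableOn_compact
    (isCompact_closedBall 0 1), integrableOn_compl_closedBall B hη one_pos⟩

/-- The integral over the line is a sum of integrals over two discs. -/
theorem lineInt_eq_add {η : Form 2 (CP 2) 2} (hη : IsSmooth η) {r : ℝ} (hr : 0 < r) :
    lineInt B η = (∫ t in Metric.closedBall (0 : ℂ) r, mpull (linePoint B) η t ![1, Complex.I]) +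
      ∫ s in Metric.ball (0 : ℂ) (2 * r)⁻¹, mpull (linePoint (pivot B 1)) η s ![1, Complex.I] := by
  rw [← setIntegral_compl_closedBall B η hr, lineInt,
    integral_add_compl Metric.isClosed_closedBall.measurableSet (integrable_lineIntegrand B hη)]

/-- On the compact set of parameters in D that g maps into the given compact part of the chart, the
derivative of g in the chart is bounded; at the other parameters in D the form vanishes. Hence
integration over the line is a current of order zero. -/
theorem exists_bound_mpull {g : ℂ → CP 2} (hg : ContMDiff 𝓘(ℝ, ℂ) 𝓘(ℝ, Fin 2 → ℂ) ∞ g) {D : Set ℂ}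
    (hD : IsCompact D) {e : OpenPartialHomeomorph (CP 2) (Fin 2 → ℂ)}
    (he : e ∈ atlas (Fin 2 → ℂ) (CP 2)) {K : Set (Fin 2 → ℂ)} (hKe : K ⊆ e.target) (hK : IsCompact K) :
    ∃ C : ℝ, ∀ φ : Form 2 (CP 2) 2, tsupport φ ⊆ e.symm '' K → ∀ b : ℝ, 0 ≤ b →
      (∀ y ∈ K, ‖pullback e.symm φ y‖ ≤ b) → ∀ t ∈ D, |mpull g φ t ![1, Complex.I]| ≤ C * b := by
  have hKs : IsCompact (e.symm '' K) := hK.image_of_continuousOn (e.continuousOn_symm.mono hKe)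
  have hD' : IsCompact (D ∩ g ⁻¹' (e.symm '' K)) :=
    hD.inter_right (hKs.isClosed.preimage hg.continuous)
  have hsrc : ∀ t, g t ∈ e.symm '' K → g t ∈ e.source := by
    rintro t ⟨y, hy, h⟩
    rw [← h]; exact e.map_target (hKe hy)
  have heg : ∀ t, g t ∈ e.source → ContDiffAt ℝ ∞ (fun t => e (g t)) t := fun t ht => by
    rw [← contMDiffAt_iff_contDiffAt]
    exact ContMDiffAt.comp t (contMDiffAt_of_mem_maximalAtlas
      (IsManifold.subset_maximalAtlas he) ht) (hg t)
  have hcont : ContinuousOn (fun t => ‖fderiv ℝ (fun t => e (g t)) t 1‖ *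
      ‖fderiv ℝ (fun t => e (g t)) t Complex.I‖) (D ∩ g ⁻¹' (e.symm '' K)) := by
    intro t ht
    have h1 : ContinuousAt (fderiv ℝ (fun t => e (g t))) t :=
      ((heg t (hsrc t ht.2)).fderiv_right (m := 0) (by simp)).continuousAt
    exact ((h1.clm_apply continuousAt_const).norm.mul
      (h1.clm_apply continuousAt_const).norm).continuousWithinAt
  obtain ⟨C, hC⟩ := hD'.bddAbove_image hcont
  refine ⟨max C 0, fun φ hφ b hb0 hb t ht => ?_⟩
  by_cases hgt : g t ∈ e.symm '' K
  · have hgs := hsrc t hgt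
    have hey : e (g t) ∈ K := by
      obtain ⟨y, hy, h⟩ := hgt
      rw [← h, e.right_inv (hKe hy)]; exact hy
    have hm : mpull g φ t = (mpull e.symm φ (e (g t))).compContinuousLinearMap
        (fderiv ℝ (fun t => e (g t)) t) := by
      rw [← mpull_comp (h := fun t => e (g t)) ((contMDiffAt_symm_of_mem_maximalAtlas
        (n := ∞) (IsManifold.subset_maximalAtlas he) (e.map_source hgs)).mdifferentiableAt (by simp))
        ((heg t hgs).differentiableAt (by simp))]
      refine mpull_congr ?_ φ
      filter_upwards [hg.continuous.continuousAt (e.open_source.mem_nhds hgs)] with z hz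
      exact (e.left_inv hz).symm
    have h1 : ‖fderiv ℝ (fun t => e (g t)) t 1‖ * ‖fderiv ℝ (fun t => e (g t)) t Complex.I‖ ≤ C :=
      hC ⟨t, ⟨ht, hgt⟩, rfl⟩
    rw [hm, ← Real.norm_eq_abs, ContinuousAlternatingMap.compContinuousLinearMap_apply]
    refine (ContinuousAlternatingMap.le_opNorm _ _).trans ?_
    rw [Fin.prod_univ_two, mul_comm]
    exact mul_le_mul (le_max_of_le_left h1) (hb _ hey) (norm_nonneg _) (le_max_right _ _)
  · have : φ (g t) = 0 := image_eq_zero_of_notMem_tsupport fun h => hgt (hφ h)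
    rw [mpull, this]
    simp
    positivity

/-- The current of integration over the line. -/
def lineCurrent : Current 2 (CP 2) 2 where
  toLinearMap :=
    { toFun := fun φ => lineInt B φ.1
      map_add' := fun φ ψ => by
        rw [lineInt, lineInt, lineInt, ← integral_add (integrable_lineIntegrand B φ.2.1)
          (integrable_lineIntegrand B ψ.2.1)]
        rfl
      map_smul' := fun c φ => by
        rw [lineInt, lineInt, RingHom.id_apply, smul_eq_mul, ← integral_const_mul]
        rfl }
  continuous' := by
    intro e he K hKe hK
    -- For empty K the hypothesis on b is void and b may be negative; the form is then zero and the
    -- constant 0 serves.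
    rcases K.eq_empty_or_nonempty with rfl | ⟨y₀, hy₀⟩
    · refine ⟨0, 0, fun φ hφ b hb => ?_⟩
      have h0 : φ.1 = 0 := tsupport_eq_empty_iff.1 (by simpa using hφ)
      have h1 : lineInt B φ.1 = 0 := by
        rw [h0, lineInt]
        exact (integral_congr_ae (Filter.Eventually.of_forall fun t => rfl)).trans
          (integral_zero ℂ ℝ)
      change |lineInt B φ.1| ≤ _
      rw [h1]
      simp
    obtain ⟨C₁, h₁⟩ := exists_bound_mpull (contMDiff_linePoint B) (isCompact_closedBall 0 1) he hKe hK
    obtain ⟨C₂, h₂⟩ := exists_bound_mpull (contMDiff_linePoint (pivot B 1))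
      (isCompact_closedBall 0 1) he hKe hK
    refine ⟨0, C₁ * volume.real (Metric.closedBall (0 : ℂ) 1) +
      C₂ * volume.real (Metric.ball (0 : ℂ) (2 * 1)⁻¹), fun φ hφ b hb => ?_⟩
    have hb' : ∀ y ∈ K, ‖pullback e.symm φ.1 y‖ ≤ b := fun y hy => by
      simpa using hb 0 le_rfl y hy
    have hb0 : 0 ≤ b := (norm_nonneg _).trans (hb' y₀ hy₀)
    change |lineInt B φ.1| ≤ _
    rw [lineInt_eq_add B φ.2.1 one_pos]
    refine (abs_add_le _ _).trans ?_
    have e1 := norm_setIntegral_le_of_norm_le_const (μ := volume) (s := Metric.closedBall (0 : ℂ) 1)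
      (f := fun t => mpull (linePoint B) φ.1 t ![1, Complex.I]) (C := C₁ * b)
      measure_closedBall_lt_top (fun t ht => h₁ φ.1 hφ b hb0 hb' t ht)
    have e2 := norm_setIntegral_le_of_norm_le_const (μ := volume)
      (s := Metric.ball (0 : ℂ) (2 * 1)⁻¹)
      (f := fun t => mpull (linePoint (pivot B 1)) φ.1 t ![1, Complex.I]) (C := C₂ * b)
      measure_ball_lt_top (fun t ht => h₂ φ.1 hφ b hb0 hb' t (by
        simp only [mem_ball_zero_iff, mem_closedBall_zero_iff] at ht ⊢
        norm_num at ht; linarith))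
    rw [Real.norm_eq_abs] at e1 e2
    linarith

theorem lineCurrent_apply (φ : testForms 2 (CP 2) 2) : lineCurrent B φ = lineInt B φ.1 := rfl

theorem eval_lineCurrent {η : Form 2 (CP 2) 2} (hη : IsSmooth η) :
    (lineCurrent B).eval η = lineInt B η := by
  rw [Current.eval, dif_pos (mem_testForms hη)]
  rfl

theorem isLineCurrent_lineCurrent {a b : Fin 3 → ℂ} (hab : LinearIndependent ℂ ![a, b])
    (ha : B 0 = a) (hb : B 1 = b) : IsLineCurrent hab (lineCurrent B) := by
  intro φ
  rw [lineCurrent_apply, lineInt]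
  have h : linePoint B = lineParam a b hab := funext (linePoint_eq_lineParam B hab ha hb)
  refine integral_congr_ae (Filter.Eventually.of_forall fun t => ?_)
  simp only [h]
  rw [mpull_apply]
  congr 1
  funext i; fin_cases i <;> rfl

/-- The integral over the line does not depend on the affine parametrization. -/
theorem lineInt_eq_of_affine (B' : Frame3) {t₀ c : ℂ} (hc : c ≠ 0)
    (h : ∀ u, linePoint B' u = linePoint B (t₀ + c * u)) (η : Form 2 (CP 2) 2) :
    lineInt B' η = lineInt B η := by
  have hd : ∀ u, HasDerivAt (fun u : ℂ => t₀ + c * u) c u := fun u => by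
    simpa using ((hasDerivAt_id u).const_mul c).const_add t₀
  have him : (fun u : ℂ => t₀ + c * u) '' Set.univ = Set.univ := by
    rw [Set.image_univ, Set.range_eq_univ]
    intro t
    refine ⟨(t - t₀) / c, ?_⟩
    field_simp
    ring
  have h1 := setIntegral_image_two (mpull (linePoint B) η) MeasurableSet.univ
    (fun u _ => (det_fderiv_nonneg_of_complex (hd u)).1)
    (fun u _ => (det_fderiv_nonneg_of_complex (hd u)).2)
    (fun u _ v _ h => mul_left_cancel₀ hc (add_left_cancel h))
  rw [him, Measure.restrict_univ] at h1
  rw [lineInt, lineInt, h1]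
  refine integral_congr_ae (Filter.Eventually.of_forall fun u => ?_)
  simp only
  rw [← mpull_comp ((contMDiff_linePoint B _).mdifferentiableAt (by simp))
    (det_fderiv_nonneg_of_complex (hd u)).1, funext h]

end ProjSpace
end
noncomputable section

/-! ### Smoothing of a parametrized surface in `ℝ⁴` -/

namespace DeRham

open MeasureTheory

theorem continuousOn_alt_apply {X : Type*} [TopologicalSpace X] {s : Set X}
    {F : X → R4 [⋀^Fin 2]→L[ℝ] ℝ} {p q : X → R4} (hF : ContinuousOn F s) (hp : ContinuousOn p s)
    (hq : ContinuousOn q s) : ContinuousOn (fun x => F x ![p x, q x]) s := by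
  have h1 : ∀ v, ContinuousOn (fun x => F x v) s := fun v =>
    (altEval (k := 2) v).continuous.comp_continuousOn hF
  have hpi : ∀ i, ContinuousOn (fun x => p x i) s := fun i =>
    (EuclideanSpace.proj (𝕜 := ℝ) i).continuous.comp_continuousOn hp
  have hqi : ∀ i, ContinuousOn (fun x => q x i) s := fun i =>
    (EuclideanSpace.proj (𝕜 := ℝ) i).continuous.comp_continuousOn hq
  simp_rw [fun x => alt_eq_sum (F x) (p x) (q x)]
  have h2 : ∀ i j v, ContinuousOn (fun x => (p x i * q x j - p x j * q x i) * F x v) s :=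
    fun i j v => (((hpi i).mul (hqi j)).sub ((hpi j).mul (hqi i))).mul (h1 v)
  exact (((((h2 _ _ _).add (h2 _ _ _)).add (h2 _ _ _)).add (h2 _ _ _)).add (h2 _ _ _)).add (h2 _ _ _)

theorem continuousOn_starForm {X : Type*} [TopologicalSpace X] {s : Set X}
    {p q : X → R4} (hp : ContinuousOn p s) (hq : ContinuousOn q s) :
    ContinuousOn (fun x => starForm (p x) (q x)) s := by
  rw [continuousOn_iff_continuous_domRestrict, continuous_alt_iff]
  intro v
  have h : ContinuousOn (fun x => starForm (v 0) (v 1) ![p x, q x]) s :=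
    continuousOn_alt_apply continuousOn_const hp hq
  rw [continuousOn_iff_continuous_domRestrict] at h
  refine h.congr fun x => ?_
  simp only [Set.domRestrict_apply]
  rw [starForm_symm, ← alt_two_apply]

section Surface

open scoped Pointwise

variable {Ω : Type} [TopologicalSpace Ω] [SecondCountableTopology Ω] [MeasurableSpace Ω]
  [BorelSpace Ω] [T2Space Ω] {μ : Measure Ω} [IsFiniteMeasureOnCompacts μ] [SFinite μ] {S K : Set Ω}
  {C p q : Ω → R4} {f : R4 → ℝ}

/-- The form that represents the smoothing with weight `f` of the surface parametrized by `C`, with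
the tangent vectors `p` and `q`. -/
def surfaceForm (μ : Measure Ω) (S : Set Ω) (C p q : Ω → R4) (f : R4 → ℝ) (x : R4) :
    R4 [⋀^Fin 2]→L[ℝ] ℝ :=
  ∫ s in S, f (x - C s) • starForm (p s) (q s) ∂μ

theorem integrable_surfaceForm (hf : Continuous f) (hK : IsCompact K) (hSK : S ⊆ K)
    (hC : ContinuousOn C K) (hp : ContinuousOn p K) (hq : ContinuousOn q K) (x : R4) :
    IntegrableOn (fun s => f (x - C s) • starForm (p s) (q s)) S μ :=
  (((hf.comp_continuousOn (continuousOn_const.sub hC)).smul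
    (continuousOn_starForm hp hq)).integrableOn_compact hK).mono_set hSK

theorem surfaceForm_apply (hf : Continuous f) (hK : IsCompact K) (hSK : S ⊆ K)
    (hC : ContinuousOn C K) (hp : ContinuousOn p K) (hq : ContinuousOn q K) (x : R4)
    (v : Fin 2 → R4) : surfaceForm μ S C p q f x v =
      ∫ s in S, f (x - C s) * starForm (v 0) (v 1) ![p s, q s] ∂μ := by
  have h := (altEval v).integral_comp_comm
    (integrable_surfaceForm (μ := μ) hf hK hSK hC hp hq x)
  refine h.symm.trans (integral_congr_ae (Filter.Eventually.of_forall fun s => ?_))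
  simp only [map_smul, altEval_apply, smul_eq_mul]
  rw [alt_two_apply, starForm_symm]

theorem contDiff_surfaceForm (hf : ContDiff ℝ ∞ f) (hc : HasCompactSupport f) (hK : IsCompact K)
    (hS : MeasurableSet S) (hSK : S ⊆ K)
    (hC : ContinuousOn C K) (hp : ContinuousOn p K) (hq : ContinuousOn q K) :
    ContDiff ℝ ∞ (surfaceForm μ S C p q f) := by
  refine contDiff_alt_iff.2 fun v => ?_
  simp_rw [fun x => surfaceForm_apply (μ := μ) hf.continuous hK hSK hC hp hq x v]
  have h1 : AEStronglyMeasurable C (μ.restrict S) := (hC.mono hSK).aestronglyMeasurable hS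
  have h2 : IntegrableOn (fun s => starForm (v 0) (v 1) ![p s, q s]) S μ :=
    ((continuousOn_alt_apply continuousOn_const hp hq).integrableOn_compact hK).mono_set hSK
  have h3 := contDiff_integral_smul_comp_sub hf hc h1 h2
  simpa only [smul_eq_mul, mul_comm] using h3

theorem surfaceForm_support (hc : HasCompactSupport f) (hK : IsCompact K)
    (hSK : S ⊆ K) (hS : MeasurableSet S) (hC : ContinuousOn C K) :
    HasCompactSupport (surfaceForm μ S C p q f) := by
  refine HasCompactSupport.intro ((hK.image_of_continuousOn hC).add hc) fun x hx => ?_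
  have h0 : ∀ s ∈ S, f (x - C s) • starForm (p s) (q s) = 0 := by
    intro s hs
    have : x - C s ∉ tsupport f := fun h => hx
      ⟨C s, ⟨s, hSK hs, rfl⟩, x - C s, h, by simp⟩
    rw [image_eq_zero_of_notMem_tsupport this, zero_smul]
  exact (setIntegral_congr_fun hS h0).trans (by simp)

/-- Wedging with `starForm (p s) (q s)` evaluates on the tangent vectors; Fubini and the
substitution x = C s + z do the rest. So `surfaceForm` represents the convolution of the
parametrized surface with f. -/
theorem integral_wedge_surfaceForm (hf : Continuous f) (hc : HasCompactSupport f) (hK : IsCompact K)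
    (hS : MeasurableSet S) (hSK : S ⊆ K)
    (hC : ContinuousOn C K) (hp : ContinuousOn p K) (hq : ContinuousOn q K)
    {F : R4 → R4 [⋀^Fin 2]→L[ℝ] ℝ} (hF : Continuous F) :
    ∫ x, wedgeAlt (surfaceForm μ S C p q f x) (F x) e4 =
      ∫ s in S, (∫ z, f z * F (C s + z) ![p s, q s]) ∂μ := by
  have h1 : ∀ x, wedgeAlt (surfaceForm μ S C p q f x) (F x) e4 =
      ∫ s in S, f (x - C s) * F x ![p s, q s] ∂μ := by
    intro x
    have h := (wedgeRight (F x) e4).integral_comp_comm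
      (integrable_surfaceForm (μ := μ) hf hK hSK hC hp hq x)
    rw [wedgeAlt_comm, ← wedgeRight_apply]
    refine h.symm.trans (integral_congr_ae (Filter.Eventually.of_forall fun s => ?_))
    simp only [map_smul, smul_eq_mul, wedgeRight_apply, wedgeAlt_starForm_right]
  simp_rw [h1]
  have hK' : IsCompact (C '' K + tsupport f) := (hK.image_of_continuousOn hC).add hc
  have hcont : ContinuousOn (fun z : R4 × Ω => f (z.1 - C z.2) * F z.1 ![p z.2, q z.2])
      ((C '' K + tsupport f) ×ˢ K) := by
    have hsnd : Set.MapsTo Prod.snd ((C '' K + tsupport f) ×ˢ K) K := fun z hz => hz.2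
    refine (hf.comp_continuousOn (continuousOn_fst.sub (hC.comp continuousOn_snd hsnd))).mul ?_
    exact continuousOn_alt_apply (hF.comp_continuousOn continuousOn_fst)
      (hp.comp continuousOn_snd hsnd) (hq.comp continuousOn_snd hsnd)
  have hint : Integrable (Function.uncurry fun (x : R4) (s : Ω) => f (x - C s) * F x ![p s, q s])
      (volume.prod (μ.restrict S)) := by
    have hr : (volume : Measure R4).prod (μ.restrict S) =
        (volume.prod μ).restrict (Set.univ ×ˢ S) := by
      rw [← Measure.prod_restrict, Measure.restrict_univ]
    rw [hr]
    refine IntegrableOn.of_forall_sdiff_eq_zero (s := (C '' K + tsupport f) ×ˢ S) ?_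
      (MeasurableSet.univ.prod hS) ?_
    · exact (hcont.integrableOn_compact (hK'.prod hK)).mono_set (Set.prod_mono_right hSK)
    · rintro ⟨x, s⟩ ⟨hz1, hz2⟩
      have : x - C s ∉ tsupport f := fun h => hz2
        ⟨⟨C s, ⟨s, hSK hz1.2, rfl⟩, x - C s, h, by simp⟩, hz1.2⟩
      simp only [Function.uncurry_apply_pair]
      rw [image_eq_zero_of_notMem_tsupport this, zero_mul]
  rw [integral_integral_swap hint]
  refine integral_congr_ae (Filter.Eventually.of_forall fun s => ?_)
  simp only
  rw [← integral_add_left_eq_self (fun x => f (x - C s) * F x ![p s, q s]) (C s)]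
  simp

end Surface

end DeRham

namespace ProjSpace

open MeasureTheory DeRham

variable (B : Frame3)

theorem ballPoint_pl (u : ℂ) : ballPoint B (pl u) = linePoint B (disc u) := by
  rw [ballPoint, toBall_pl, linePoint]

/-- The integral over a part of the line, in the coordinate of the ball. -/
theorem setIntegral_disc_image (η : Form 2 (CP 2) 2) {S : Set ℂ} (hS : MeasurableSet S) :
    ∫ t in disc '' S, mpull (linePoint B) η t ![1, Complex.I] =
      ∫ u in S, mpull (ballPoint B) η (pl u) ![e4 0, e4 1] := by
  have hd : ∀ u, DifferentiableAt ℝ disc u := fun u => contDiff_disc.differentiable (by simp) u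
  rw [setIntegral_image_two _ hS (fun u _ => hd u) (fun u _ => det_fderiv_disc_nonneg u)
    injective_disc.injOn]
  refine setIntegral_congr_fun hS fun u _ => ?_
  rw [← mpull_comp ((contMDiff_linePoint B _).mdifferentiableAt (by simp)) (hd u)]
  have h : (fun u => linePoint B (disc u)) = fun u => ballPoint B (pl u) :=
    funext fun u => (ballPoint_pl B u).symm
  rw [h, mpull_comp_ballPoint B pl.differentiableAt, pl.fderiv,
    ContinuousAlternatingMap.compContinuousLinearMap_apply]
  congr 1
  funext i; fin_cases i
  · exact pl_one
  · exact pl_I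

theorem image_disc_preimage_ball {r : ℝ} (hr : r ≤ 1) :
    disc '' (disc ⁻¹' Metric.ball 0 r) = Metric.ball 0 r := by
  refine Set.image_preimage_eq_of_subset fun t ht => ?_
  rw [mem_ball_zero_iff] at ht
  obtain ⟨u, hu⟩ := exists_disc_eq (ht.trans_le hr)
  exact ⟨u, hu⟩

theorem setIntegral_ball_line (η : Form 2 (CP 2) 2) {r : ℝ} (hr : r ≤ 1) :
    ∫ t in Metric.ball (0 : ℂ) r, mpull (linePoint B) η t ![1, Complex.I] =
      ∫ u in disc ⁻¹' Metric.ball 0 r, mpull (ballPoint B) η (pl u) ![e4 0, e4 1] := by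
  rw [← setIntegral_disc_image B η
    (Metric.isOpen_ball.preimage contDiff_disc.continuous).measurableSet, image_disc_preimage_ball hr]

theorem setIntegral_closedBall_line (η : Form 2 (CP 2) 2) {r : ℝ} (hr : r ≤ 1) :
    ∫ t in Metric.closedBall (0 : ℂ) r, mpull (linePoint B) η t ![1, Complex.I] =
      ∫ u in disc ⁻¹' Metric.ball 0 r, mpull (ballPoint B) η (pl u) ![e4 0, e4 1] := by
  rw [← setIntegral_ball_line B η hr, setIntegral_congr_set (ball_ae_eq_closedBall volume (0 : ℂ) r)]

end ProjSpace
end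
noncomputable section

/-! ### The smooth form that represents the smoothed line -/

namespace ProjSpace

open MeasureTheory DeRham

variable (B : Frame3)

theorem isOpen_image_ball : IsOpen (linPoint B '' Metric.ball 0 1) := by
  have h : linPoint B '' Metric.ball 0 1 = (linChart B).source ∩ linChart B ⁻¹' Metric.ball 0 1 := by
    ext p
    constructor
    · rintro ⟨x, hx, rfl⟩
      refine ⟨linPoint_mem_linSource B x, ?_⟩
      change linCoord B (linPoint B x) ∈ Metric.ball 0 1
      rwa [linCoord_linPoint]
    · rintro ⟨h1, h2⟩
      exact ⟨linCoord B p, h2, linPoint_linCoord B h1⟩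
  rw [h]
  exact (linChart B).isOpen_inter_preimage Metric.isOpen_ball

theorem linPoint_injective : Function.Injective (linPoint B) := fun x y h => by
  rw [← linCoord_linPoint B x, h, linCoord_linPoint]

theorem moveL_zero (p : CP 2) : moveL B 0 p = p := by
  by_cases h : p ∈ linSource B
  · rw [moveL, if_pos h, act_zero, linPoint_linCoord B h]
  · rw [moveL, if_neg h]

/-- The coordinate (2t)⁻¹ in the pivoted chart has absolute value greater than 1, and t = 0 is not
in that chart at all. -/
theorem linePoint_notMem {t : ℂ} (ht : ‖t‖ < 1 / 2) :
    linePoint B t ∉ linPoint (pivot B 1) '' Metric.closedBall 0 1 := by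
  rintro ⟨x, hx, h⟩
  rcases eq_or_ne t 0 with rfl | h0
  · have h1 := linPoint_mem_linSource (pivot B 1) x
    rw [h, linePoint, linPoint, mk_mem_linSource, equivFun_pivot, equivFun_linVec] at h1
    simp at h1
  · have h1 : linePoint B t = linePoint (pivot B 1) (2 * t)⁻¹ := by
      rw [linePoint_pivot B (inv_ne_zero (mul_ne_zero two_ne_zero h0))]
      congr 1
      field_simp
    rw [h1] at h
    have h2 := linPoint_injective _ h
    rw [h2, mem_closedBall_zero_iff, norm_pl, norm_inv, norm_mul, Complex.norm_ofNat] at hx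
    have h3 : 0 < ‖t‖ := norm_pos_iff.2 h0
    have h4 : 1 < (2 * ‖t‖)⁻¹ := (one_lt_inv₀ (by positivity)).2 (by linarith)
    linarith

theorem contMDiff_moveL_linePoint :
    ContMDiff 𝓘(ℝ, R4 × ℂ) 𝓘(ℝ, Fin 2 → ℂ) ∞
      (fun z : R4 × ℂ => moveL B z.1 (linePoint (pivot B 1) z.2)) := fun _ =>
  contMDiffAt_moveL B (contMDiff_linePoint _ _)

/-- The coordinates, in the ball of the pivoted chart, of the moved line. -/
def farCoord (z : R4 × ℂ) : R4 :=
  ofBall (linCoord (pivot B 1) (moveL B z.1 (linePoint (pivot B 1) z.2)))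

/-- The parameters for which the moved line lies in the ball of the pivoted chart. -/
def farSet : Set (R4 × ℂ) := {z | moveL B z.1 (linePoint (pivot B 1) z.2) ∈
  linPoint (pivot B 1) '' Metric.ball 0 1}

theorem isOpen_farSet : IsOpen (farSet B) :=
  (isOpen_image_ball (pivot B 1)).preimage (contMDiff_moveL_linePoint B).continuous

theorem contDiffAt_farCoord {z : R4 × ℂ} (hz : z ∈ farSet B) : ContDiffAt ℝ ∞ (farCoord B) z := by
  obtain ⟨x, hx, h⟩ := hz
  have h1 : ContMDiffAt 𝓘(ℝ, R4 × ℂ) 𝓘(ℝ, R4) ∞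
      (fun z : R4 × ℂ => linCoord (pivot B 1) (moveL B z.1 (linePoint (pivot B 1) z.2))) z := by
    refine ContMDiffAt.comp (g := linCoord (pivot B 1)) z (contMDiffAt_linCoord _ ?_)
      (contMDiff_moveL_linePoint B z)
    rw [← h]
    exact linPoint_mem_linSource _ _
  refine ContDiffAt.comp (g := ofBall) z (contDiffAt_ofBall ?_) h1.contDiffAt
  rw [← h, linCoord_linPoint]
  simpa using hx

theorem ballPoint_farCoord {z : R4 × ℂ} (hz : z ∈ farSet B) : ballPoint (pivot B 1) (farCoord B z) =
    moveL B z.1 (linePoint (pivot B 1) z.2) := by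
  obtain ⟨x, hx, h⟩ := hz
  rw [ballPoint, farCoord, ← h, linCoord_linPoint, toBall_ofBall (by simpa using hx)]

theorem mpull_moveL_linePoint (ψ : Form 2 (CP 2) 2) {y : R4} {s : ℂ} (hz : (y, s) ∈ farSet B) :
    mpull (fun s => moveL B y (linePoint (pivot B 1) s)) ψ s ![1, Complex.I] =
      mpull (ballPoint (pivot B 1)) ψ (farCoord B (y, s))
        ![fderiv ℝ (farCoord B) (y, s) (0, 1), fderiv ℝ (farCoord B) (y, s) (0, Complex.I)] := by
  have h1 : HasFDerivAt (fun s : ℂ => (y, s)) (ContinuousLinearMap.inr ℝ R4 ℂ) s :=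
    hasFDerivAt_prodMk_right y s
  have h2 : HasFDerivAt (fun s : ℂ => farCoord B (y, s))
      ((fderiv ℝ (farCoord B) (y, s)).comp (ContinuousLinearMap.inr ℝ R4 ℂ)) s :=
    ((contDiffAt_farCoord B hz).differentiableAt (by simp)).hasFDerivAt.comp s h1
  have h3 : mpull (fun s => moveL B y (linePoint (pivot B 1) s)) ψ s =
      mpull (fun s => ballPoint (pivot B 1) (farCoord B (y, s))) ψ s := by
    refine mpull_congr ?_ ψ
    filter_upwards [h1.continuousAt ((isOpen_farSet B).mem_nhds hz)] with s' hs'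
    exact (ballPoint_farCoord B hs').symm
  rw [h3, mpull_comp_ballPoint (pivot B 1) h2.differentiableAt, h2.fderiv,
    ContinuousAlternatingMap.compContinuousLinearMap_apply]
  congr 1
  funext i; fin_cases i <;> rfl

/-- For y = 0 nothing moves and the disc |s| ≤ r lies in the ball. Openness and compactness of the
disc extend this to all small y by the tube lemma. -/
theorem eventually_subset_farSet {r : ℝ} (hr : r < 1) :
    ∀ᶠ ε in 𝓝[>] (0 : ℝ), Metric.closedBall 0 ε ×ˢ Metric.closedBall 0 r ⊆ farSet B := by
  have h0 : ({0} : Set R4) ×ˢ Metric.closedBall (0 : ℂ) r ⊆ farSet B := by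
    rintro ⟨y, s⟩ ⟨rfl, hs⟩
    refine ⟨pl s, ?_, ?_⟩
    · rw [mem_ball_zero_iff, norm_pl]
      exact (mem_closedBall_zero_iff.1 hs).trans_lt hr
    · simp only [moveL_zero, linePoint]
  obtain ⟨u, v, hu, -, h0u, hv, huv⟩ := generalized_tube_lemma isCompact_singleton
    (isCompact_closedBall (0 : ℂ) r) (isOpen_farSet B) h0
  obtain ⟨δ, hδ, hball⟩ := Metric.isOpen_iff.1 hu 0 (h0u rfl)
  filter_upwards [Ioo_mem_nhdsGT hδ] with ε hε
  exact (Set.prod_mono ((Metric.closedBall_subset_ball hε.2).trans hball) hv).trans huv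

/-- The radius that is its own image under `r ↦ (2 r)⁻¹`. -/
def midRadius : ℝ := (√2)⁻¹

theorem midRadius_pos : 0 < midRadius := by unfold midRadius; positivity

theorem midRadius_sq : midRadius ^ 2 = 1 / 2 := by
  rw [midRadius, inv_pow, Real.sq_sqrt (by norm_num)]; norm_num

theorem midRadius_lt_one : midRadius < 1 := by nlinarith [midRadius_sq, midRadius_pos]

theorem inv_two_mul_midRadius : (2 * midRadius)⁻¹ = midRadius := by
  have h := midRadius_sq
  have h0 := midRadius_pos
  rw [inv_eq_iff_eq_inv, eq_comm]
  refine inv_eq_of_mul_eq_one_right ?_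
  nlinarith

/-- The part of the line close to `[B₀]`, in the coordinate of the ball. -/
def nearSet : Set ℂ := disc ⁻¹' Metric.ball 0 midRadius

theorem measurableSet_nearSet : MeasurableSet nearSet :=
  (Metric.isOpen_ball.preimage contDiff_disc.continuous).measurableSet

/-- The condition |disc u|² < 1/2 means log (1 + |u|²) < 1, that is |u|² < e - 1 < 4. A bound is
needed because the line is noncompact in the ball coordinates. -/
theorem nearSet_subset : nearSet ⊆ Metric.closedBall 0 2 := by
  intro u hu
  have h1 : ‖disc u‖ < midRadius := by simpa [nearSet] using hu
  have h2 : ‖disc u‖ ^ 2 < 1 / 2 := by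
    rw [← midRadius_sq]
    exact pow_lt_pow_left₀ h1 (norm_nonneg _) two_ne_zero
  have hl := log_one_add_nonneg (sq_nonneg ‖u‖)
  rw [norm_sq_disc, div_lt_iff₀ (by linarith)] at h2
  have h3 : 1 + ‖u‖ ^ 2 < Real.exp 1 := by
    rw [← Real.log_lt_iff_lt_exp (by positivity)]; linarith
  have h4 := Real.exp_one_lt_d9
  rw [mem_closedBall_zero_iff]
  nlinarith [norm_nonneg u]

section Parts

variable {w : R4 → ℝ} {ψ : Form 2 (CP 2) 2}

/-- The contribution of the part of the line close to `[B₀]`. -/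
theorem setIntegral_near (hw : ContDiff ℝ ∞ w) (hc : HasCompactSupport w) (hψ : IsSmooth ψ) :
    ∫ t in Metric.closedBall (0 : ℂ) midRadius, mpull (linePoint B) (smear B w ψ) t ![1, Complex.I] =
      ∫ x, wedgeAlt (surfaceForm volume nearSet pl (fun _ => e4 0) (fun _ => e4 1) w x)
        (mpull (ballPoint B) ψ x) e4 := by
  rw [setIntegral_closedBall_line B _ midRadius_lt_one.le,
    integral_wedge_surfaceForm hw.continuous hc (isCompact_closedBall 0 2) measurableSet_nearSet
      nearSet_subset pl.continuous.continuousOn continuousOn_const continuousOn_const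
      (continuous_mpull_ballPoint B hψ)]
  refine setIntegral_congr_fun measurableSet_nearSet fun u _ => ?_
  exact mpull_ballPoint_smear B hw.continuous hc hψ (pl u) _

/-- The contribution of the part of the line far from `[B₀]`. -/
theorem setIntegral_far (hw : ContDiff ℝ ∞ w) (hc : HasCompactSupport w) (hψ : IsSmooth ψ) {ε r : ℝ}
    (hwε : ∀ y, ε ≤ ‖y‖ → w y = 0) (hsub : Metric.closedBall 0 ε ×ˢ Metric.closedBall 0 r ⊆ farSet B) :
    ∫ s in Metric.ball (0 : ℂ) r,
        mpull (linePoint (pivot B 1)) (smear B w ψ) s ![1, Complex.I] =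
      ∫ z in Metric.closedBall (0 : R4) ε ×ˢ Metric.ball (0 : ℂ) r,
        mpull (ballPoint (pivot B 1)) ψ (farCoord B z)
        ![w z.1 • fderiv ℝ (farCoord B) z (0, 1), fderiv ℝ (farCoord B) z (0, Complex.I)] := by
  have hK : IsCompact (Metric.closedBall (0 : R4) ε ×ˢ Metric.closedBall (0 : ℂ) r) :=
    (isCompact_closedBall _ _).prod (isCompact_closedBall _ _)
  have hfd : ∀ c : ℂ, ContinuousOn (fun z => fderiv ℝ (farCoord B) z (0, c))
      (Metric.closedBall (0 : R4) ε ×ˢ Metric.closedBall (0 : ℂ) r) := fun c z hz =>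
    (((contDiffAt_farCoord B (hsub hz)).fderiv_right (m := 0) (by simp)).continuousAt.clm_apply
      continuousAt_const).continuousWithinAt
  have hfc : ContinuousOn (farCoord B)
      (Metric.closedBall (0 : R4) ε ×ˢ Metric.closedBall (0 : ℂ) r) := fun z hz =>
    (contDiffAt_farCoord B (hsub hz)).continuousAt.continuousWithinAt
  have hcont : ContinuousOn (fun z => mpull (ballPoint (pivot B 1)) ψ (farCoord B z)
        ![w z.1 • fderiv ℝ (farCoord B) z (0, 1), fderiv ℝ (farCoord B) z (0, Complex.I)])
      (Metric.closedBall (0 : R4) ε ×ˢ Metric.closedBall (0 : ℂ) r) :=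
    continuousOn_alt_apply ((continuous_mpull_ballPoint _ hψ).comp_continuousOn hfc)
      ((hw.continuous.comp continuous_fst).continuousOn.smul (hfd 1)) (hfd Complex.I)
  have hint := (hcont.integrableOn_compact (μ := volume) hK).mono_set
    (Set.prod_mono_right (s := Metric.closedBall (0 : R4) ε)
      (Metric.ball_subset_closedBall (x := (0 : ℂ)) (ε := r)))
  rw [IntegrableOn, Measure.volume_eq_prod, ← Measure.prod_restrict] at hint
  rw [Measure.volume_eq_prod, ← Measure.prod_restrict, integral_prod_symm _ hint]
  refine setIntegral_congr_fun Metric.isOpen_ball.measurableSet fun s hs => ?_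
  simp only
  rw [mpull_smear_apply B hw.continuous hc hψ (contMDiff_linePoint (pivot B 1) s),
    ← setIntegral_eq_integral_of_forall_compl_eq_zero (s := Metric.closedBall (0 : R4) ε)]
  · refine setIntegral_congr_fun Metric.isClosed_closedBall.measurableSet fun y hy => ?_
    -- The weight is absorbed into the first tangent vector, which puts the integral into the form
    -- handled by `surfaceForm`, with y as additional parameter.
    rw [mpull_moveL_linePoint B ψ (hsub ⟨hy, Metric.ball_subset_closedBall hs⟩),
      alt_eq_sum, alt_eq_sum _ (w y • _)]
    simp only [PiLp.smul_apply, smul_eq_mul]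
    ring
  · intro y hy
    rw [hwε y (by simpa using (not_le.1 (by simpa using hy)).le), zero_mul]

end Parts

theorem continuousOn_farCoord {K : Set (R4 × ℂ)} (hK : K ⊆ farSet B) : ContinuousOn (farCoord B) K :=
  fun _ hz => (contDiffAt_farCoord B (hK hz)).continuousAt.continuousWithinAt

theorem continuousOn_fderiv_farCoord {K : Set (R4 × ℂ)} (hK : K ⊆ farSet B) (c : ℂ) :
    ContinuousOn (fun z => fderiv ℝ (farCoord B) z (0, c)) K := fun _ hz =>
  (((contDiffAt_farCoord B (hK hz)).fderiv_right (m := 0) (by simp)).continuousAt.clm_apply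
    continuousAt_const).continuousWithinAt

/-- For small `ε`, the line smoothed in the first two charts is given by a smooth form. -/
theorem eventually_exists_form : ∀ᶠ ε in 𝓝[>] (0 : ℝ), ∃ α : Form 2 (CP 2) 2, IsSmooth α ∧
    (∀ φ : Form 2 (CP 2) 2, IsSmooth φ →
      lineInt B (smear B (epsBump ε) (smear (pivot B 1) (epsBump ε) φ)) = formInt B (wedge α φ)) ∧
    (∀ u, ‖disc u‖ < 1 / 2 → mpull (ballPoint B) α (pl u) ![e4 0, e4 1] = 0) ∧
    ∀ (x : R4) (κ : Form 2 (CP 2) 2), IsSmooth κ →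
      (∀ z, mpull (ballPoint (pivot B 1)) κ z = epsBump ε (x - z) • starForm (e4 0) (e4 1)) →
      (∀ p, p ∉ linPoint (pivot B 1) '' Metric.ball 0 1 → κ p = 0) →
      mpull (ballPoint (pivot B 1)) α x ![e4 0, e4 1] = lineInt B (smear B (epsBump ε) κ) := by
  filter_upwards [eventually_subset_farSet B midRadius_lt_one, self_mem_nhdsWithin] with ε hsub hε
  have hw := contDiff_epsBump ε
  have hc := hasCompactSupport_epsBump hε
  set w := epsBump ε with hwdef
  have hwε : ∀ y, ε ≤ ‖y‖ → w y = 0 := fun y hy => epsBump_eq_zero hε hy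
  have hS : MeasurableSet (Metric.closedBall (0 : R4) ε ×ˢ Metric.ball (0 : ℂ) midRadius) :=
    Metric.isClosed_closedBall.measurableSet.prod Metric.isOpen_ball.measurableSet
  have hK : IsCompact (Metric.closedBall (0 : R4) ε ×ˢ Metric.closedBall (0 : ℂ) midRadius) :=
    (isCompact_closedBall _ _).prod (isCompact_closedBall _ _)
  have hSK : Metric.closedBall (0 : R4) ε ×ˢ Metric.ball (0 : ℂ) midRadius ⊆
      Metric.closedBall (0 : R4) ε ×ˢ Metric.closedBall (0 : ℂ) midRadius :=
    Set.prod_mono_right Metric.ball_subset_closedBall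
  have hfc := continuousOn_farCoord B hsub
  have hf1 : ContinuousOn (fun z => w z.1 • fderiv ℝ (farCoord B) z (0, 1)) _ :=
    (hw.continuous.comp continuous_fst).continuousOn.smul (continuousOn_fderiv_farCoord B hsub 1)
  have hf2 := continuousOn_fderiv_farCoord B hsub Complex.I
  set A₁ := surfaceForm volume nearSet pl (fun _ => e4 0) (fun _ => e4 1) w with hA₁
  set A₂ := surfaceForm volume (Metric.closedBall (0 : R4) ε ×ˢ Metric.ball (0 : ℂ) midRadius)
    (farCoord B) (fun z => w z.1 • fderiv ℝ (farCoord B) z (0, 1))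
    (fun z => fderiv ℝ (farCoord B) z (0, Complex.I)) w with hA₂
  -- The near part |t| ≤ 1/√2 is already smoothed by the translations in the ball at [B₀].
  obtain ⟨β₁, hβ₁, hβ₁A, hβ₁0⟩ := exists_push B (A := A₁)
    (contDiff_surfaceForm hw hc (isCompact_closedBall 0 2) measurableSet_nearSet
      nearSet_subset pl.continuous.continuousOn continuousOn_const continuousOn_const)
    (surfaceForm_support hc (isCompact_closedBall 0 2) nearSet_subset measurableSet_nearSet
      pl.continuous.continuousOn)
  -- The far part, after its displacement by y, stays in the ball at [B₁] for small ε and is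
  -- smoothed by the translations there.
  obtain ⟨β₂, hβ₂, hβ₂A, hβ₂0⟩ := exists_push (pivot B 1) (A := A₂)
    (contDiff_surfaceForm hw hc hK hS hSK hfc hf1 hf2) (surfaceForm_support hc hK hSK hS hfc)
  have hsm : IsSmooth (smear (pivot B 1) w β₁) := isSmooth_smear _ hw hc hβ₁
  -- After the first smoothing alone, the far part is kept as an integral over displaced surfaces:
  -- nothing has smoothed it outside the ball at [B₀].
  have hsplit : ∀ ψ : Form 2 (CP 2) 2, IsSmooth ψ → lineInt B (smear B w ψ) =
      formInt B (wedge β₁ ψ) +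
      ∫ z in Metric.closedBall (0 : R4) ε ×ˢ Metric.ball (0 : ℂ) midRadius,
        mpull (ballPoint (pivot B 1)) ψ (farCoord B z)
        ![w z.1 • fderiv ℝ (farCoord B) z (0, 1), fderiv ℝ (farCoord B) z (0, Complex.I)] := by
    intro ψ hψ
    rw [lineInt_eq_add B (isSmooth_smear B hw hc hψ) midRadius_pos, inv_two_mul_midRadius,
      setIntegral_near B hw hc hψ, setIntegral_far B hw hc hψ hwε hsub,
      formInt_wedge_of_eq_zero B B hβ₁0]
    simp_rw [hβ₁A]
    rfl
  have hadd : ∀ φ : Form 2 (CP 2) 2, wedge (smear (pivot B 1) w β₁ + β₂) φ =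
      wedge (smear (pivot B 1) w β₁) φ + wedge β₂ φ := by
    intro φ
    funext p
    ext v
    change wedgeAlt _ _ v = wedgeAlt _ _ v + wedgeAlt _ _ v
    rw [wedgeAlt_two_two, wedgeAlt_two_two, wedgeAlt_two_two]
    simp only [Pi.add_apply, ContinuousAlternatingMap.add_apply]
    ring
  -- The second smoothing reaches the near part by self-adjointness of smearing, and the far part by
  -- convolution with the displaced surfaces.
  refine ⟨smear (pivot B 1) w β₁ + β₂, isSmooth_add hsm hβ₂, ?_, ?_, ?_⟩
  · intro φ hφ
    have hsφ : IsSmooth (smear (pivot B 1) w φ) := isSmooth_smear _ hw hc hφ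
    have h1 : formInt B (wedge (smear (pivot B 1) w β₁ + β₂) φ) =
        formInt B (wedge (smear (pivot B 1) w β₁) φ) + formInt B (wedge β₂ φ) := by
      rw [hadd]
      exact integral_add (integrable_mpull_linPoint B (isSmooth_wedge hsm hφ))
        (integrable_mpull_linPoint B (isSmooth_wedge hβ₂ hφ))
    rw [h1, hsplit _ hsφ, formInt_wedge_smear (pivot B 1) B hw hc (epsBump_neg ε) hβ₁ hφ,
      formInt_wedge_of_eq_zero (pivot B 1) B hβ₂0]
    congr 1
    simp_rw [hβ₂A]
    rw [integral_wedge_surfaceForm hw.continuous hc hK hS hSK hfc hf1 hf2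
      (continuous_mpull_ballPoint _ hφ)]
    refine setIntegral_congr_fun hS fun z _ => ?_
    exact mpull_ballPoint_smear (pivot B 1) hw.continuous hc hφ _ _
  -- Where |t| < 1/2 the second ball is out of reach, and the first smoothing gives multiples of
  -- `starForm (e4 0) (e4 1)`, which vanishes on the direction of the line.
  · intro u hu
    have hp := linePoint_notMem B hu
    have hp' : linePoint B (disc u) ∉ linPoint (pivot B 1) '' Metric.ball 0 1 := fun h =>
      hp (Set.image_mono Metric.ball_subset_closedBall h)
    have h1 : mpull (ballPoint B) (smear (pivot B 1) w β₁ + β₂) (pl u) =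
        mpull (ballPoint B) β₁ (pl u) := by
      unfold mpull
      rw [ballPoint_pl, Pi.add_apply, hβ₂0 _ hp', add_zero,
        smear_of_notMem _ (integral_epsBump hε) _ hp]
    rw [h1, hβ₁A, hA₁, surfaceForm_apply hw.continuous (isCompact_closedBall 0 2) nearSet_subset
      pl.continuous.continuousOn continuousOn_const continuousOn_const]
    simp [starForm_apply, e4_apply]
  -- Evaluation on (e4 0, e4 1) is the wedge with `starForm (e4 0) (e4 1)`. So κ is the point
  -- evaluation at x after the second smearing, and evenness of the weight turns f (x - z) into a
  -- translate of f.
  · intro x κ hκ hκx hκ0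
    have h1 : formInt B (wedge β₁ κ) = ∫ y, w y * mpull (ballPoint (pivot B 1)) β₁ (x + y)
        ![e4 0, e4 1] := by
      have hcomm : wedge β₁ κ = wedge κ β₁ := by
        funext p; ext v; exact wedgeAlt_comm _ _ _
      rw [hcomm, formInt_wedge_of_eq_zero (pivot B 1) B hκ0,
        ← integral_add_left_eq_self _ x]
      refine integral_congr_ae (Filter.Eventually.of_forall fun y => ?_)
      simp only
      rw [hκx, wedgeAlt_comm, ← wedgeRight_apply, map_smul, wedgeRight_apply,
        wedgeAlt_starForm_right, smul_eq_mul]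
      congr 1
      rw [sub_add_cancel_left, hwdef, epsBump_neg]
    have h2 : mpull (ballPoint (pivot B 1)) (smear (pivot B 1) w β₁ + β₂) x ![e4 0, e4 1] =
        mpull (ballPoint (pivot B 1)) (smear (pivot B 1) w β₁) x ![e4 0, e4 1] +
        mpull (ballPoint (pivot B 1)) β₂ x ![e4 0, e4 1] := rfl
    rw [h2, hsplit κ hκ, h1, mpull_ballPoint_smear (pivot B 1) hw.continuous hc hβ₁, hβ₂A, hA₂,
      surfaceForm_apply hw.continuous hK hSK hfc hf1 hf2]
    congr 1
    refine setIntegral_congr_fun hS fun z _ => ?_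
    rw [hκx]
    rfl

end ProjSpace
end
noncomputable section

/-! ### The radial function of the intersection of the moved line with the line -/

namespace DeRham

open MeasureTheory

/-- The squared radius, in the pivoted chart, of the point of the ball with coordinates `(u, v)`,
where `q = |u|²` and `s = |v|²`. -/
def farRadius (s q : ℝ) : ℝ := (1 / contract (q + s) ^ 2 + s) / (4 * q)

theorem one_div_contract_sq {r : ℝ} (hr : 0 < r) :
    1 / contract r ^ 2 = r * (1 + 1 / Real.log (1 + r)) := by
  have hl : 0 < Real.log (1 + r) := Real.log_pos (by linarith)
  have h := mul_contract_sq hr.le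
  have hc := contract_pos hr.le
  rw [eq_div_iff (by positivity)] at h
  rw [div_eq_iff (by positivity)]
  field_simp
  linarith

/-- Here every ingredient visibly decreases in q. -/
theorem farRadius_eq {s q : ℝ} (hs : 0 ≤ s) (hq : 0 < q) :
    farRadius s q = ((1 + s / q) * (1 + 1 / Real.log (1 + (q + s))) + s / q) / 4 := by
  rw [farRadius, one_div_contract_sq (by linarith)]
  field_simp

theorem farRadius_strictAntiOn {s : ℝ} (hs : 0 ≤ s) : StrictAntiOn (farRadius s) (Set.Ioi 0) := by
  intro q hq r hr hqr
  have hq0 : 0 < q := hq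
  have hr0 : 0 < r := hr
  rw [farRadius_eq hs hq, farRadius_eq hs hr]
  have h1 : s / r ≤ s / q := div_le_div_of_nonneg_left hs hq0 hqr.le
  have hl : 0 < Real.log (1 + (q + s)) := Real.log_pos (by linarith)
  have h2 : Real.log (1 + (q + s)) < Real.log (1 + (r + s)) :=
    Real.log_lt_log (by linarith) (by linarith)
  have h3 : 1 / Real.log (1 + (r + s)) < 1 / Real.log (1 + (q + s)) :=
    one_div_lt_one_div_of_lt hl h2
  have h4 : 0 < 1 / Real.log (1 + (r + s)) := one_div_pos.2 (hl.trans h2)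
  have h5 : 0 ≤ s / r := by positivity
  have h6 : (1 + s / r) * (1 + 1 / Real.log (1 + (r + s))) <
      (1 + s / q) * (1 + 1 / Real.log (1 + (q + s))) :=
    mul_lt_mul' (by linarith) (by linarith) (by linarith) (by linarith)
  linarith

theorem farRadius_pos {s q : ℝ} (hs : 0 ≤ s) (hq : 0 < q) : 0 < farRadius s q := by
  have := contract_pos (show 0 ≤ q + s by linarith)
  unfold farRadius
  positivity

theorem stretch_sq_mono {p q : ℝ} (hp : 0 ≤ p) (hpq : p ≤ q) (hq : q < 1) :
    stretch p ^ 2 ≤ stretch q ^ 2 := by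
  rw [stretch_sq (hpq.trans_lt hq), stretch_sq hq]
  have h1 : p / (1 - p) ≤ q / (1 - q) := by
    rw [div_le_div_iff₀ (by linarith) (by linarith)]; nlinarith
  have h2 := expSlope_mono (div_nonneg hp (by linarith)) h1
  exact div_le_div₀ (expSlope_pos _).le h2 (by linarith) (by linarith)

/-- The squared radius of the slope of the moved line. -/
def slopeSq (s q : ℝ) : ℝ := stretch (farRadius s q) ^ 2 / (4 * q)

theorem slopeSq_pos {s q : ℝ} (hq : 0 < q) (h : farRadius s q < 1) : 0 < slopeSq s q := by
  have := stretch_pos h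
  unfold slopeSq
  positivity

/-- As q grows the far radius decreases, so the numerator does not increase, while the denominator
strictly grows. -/
theorem slopeSq_lt {s q r : ℝ} (hs : 0 ≤ s) (hq : 0 < q) (h : farRadius s q < 1) (hqr : q < r) :
    farRadius s r < 1 ∧ slopeSq s r < slopeSq s q := by
  have hr : 0 < r := hq.trans hqr
  have h1 := farRadius_strictAntiOn hs hq hr hqr
  refine ⟨h1.trans h, ?_⟩
  have h2 := stretch_sq_mono (farRadius_pos hs hr).le h1.le h
  have h3 := stretch_pos (h1.trans h)
  unfold slopeSq
  rw [div_lt_div_iff₀ (by linarith) (by linarith)]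
  have h4 : 0 < stretch (farRadius s r) ^ 2 := by positivity
  nlinarith

theorem contDiffAt_farRadius {s q : ℝ} (hs : 0 ≤ s) (hq : 0 < q) :
    ContDiffAt ℝ ∞ (fun z : ℝ × ℝ => farRadius z.1 z.2) (s, q) := by
  have hc := contract_pos (show 0 ≤ q + s by linarith)
  have h1 : ContDiffAt ℝ ∞ (fun z : ℝ × ℝ => contract (z.2 + z.1)) (s, q) :=
    ContDiffAt.comp (g := contract) (f := fun z : ℝ × ℝ => z.2 + z.1) (s, q)
      (contDiffAt_contract (by simpa using by linarith)) (contDiffAt_snd.add contDiffAt_fst)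
  refine ((contDiffAt_const.div (h1.pow 2) ?_).add contDiffAt_fst).div
    (contDiffAt_const.mul contDiffAt_snd) ?_
  · simp only; positivity
  · simp only; positivity

theorem contDiffAt_stretch_farRadius {s q : ℝ} (hs : 0 ≤ s) (hq : 0 < q) (h : farRadius s q < 1) :
    ContDiffAt ℝ ∞ (fun z : ℝ × ℝ => stretch (farRadius z.1 z.2)) (s, q) :=
  ContDiffAt.comp (g := stretch) (f := fun z : ℝ × ℝ => farRadius z.1 z.2) (s, q)
    (contDiffAt_stretch h) (contDiffAt_farRadius hs hq)

theorem continuousAt_slopeSq {s q : ℝ} (hs : 0 ≤ s) (hq : 0 < q) (h : farRadius s q < 1) :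
    ContinuousAt (fun z : ℝ × ℝ => slopeSq z.1 z.2) (s, q) := by
  refine ContinuousAt.div ((contDiffAt_stretch_farRadius hs hq h).continuousAt.pow 2)
    (continuousAt_const.mul continuousAt_snd) ?_
  simp only; positivity

theorem continuousAt_farRadius_right {s q : ℝ} (hs : 0 ≤ s) (hq : 0 < q) :
    ContinuousAt (farRadius s) q :=
  ContinuousAt.comp (f := fun q : ℝ => (s, q)) (contDiffAt_farRadius hs hq).continuousAt
    (by fun_prop)

theorem continuousAt_slopeSq_right {s q : ℝ} (hs : 0 ≤ s) (hq : 0 < q) (h : farRadius s q < 1) :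
    ContinuousAt (slopeSq s) q :=
  ContinuousAt.comp (g := fun z : ℝ × ℝ => slopeSq z.1 z.2) (f := fun q : ℝ => (s, q))
    (continuousAt_slopeSq hs hq h) (by fun_prop)

/-- Intermediate values. At q = 1/8 the inequality log (1 + x) ≤ x gives at least 9/4; at q = 4 + 4s
one has s / q ≤ 1/4 and a logarithm of at least 1, which gives at most 11/16. -/
theorem exists_farRadius_eq_one {s : ℝ} (hs : 0 ≤ s) : ∃ q, 0 < q ∧ farRadius s q = 1 := by
  have h1 : 1 ≤ farRadius s (1 / 8) := by
    rw [farRadius_eq hs (by norm_num)]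
    have hl : 0 < Real.log (1 + (1 / 8 + s)) := Real.log_pos (by linarith)
    have h2 : Real.log (1 + (1 / 8 + s)) ≤ 1 / 8 + s := by
      have := Real.log_le_sub_one_of_pos (show 0 < 1 + (1 / 8 + s) by linarith)
      linarith
    have h3 : 1 ≤ (1 / 8 + s) * (1 / Real.log (1 + (1 / 8 + s))) := by
      rw [mul_one_div, le_div_iff₀ hl]; linarith
    have h4 : s / (1 / 8) = 8 * s := by ring
    rw [h4]
    nlinarith
  have h2 : farRadius s (4 + 4 * s) ≤ 1 := by
    have hq : 0 < 4 + 4 * s := by linarith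
    rw [farRadius_eq hs hq]
    have h3 : 1 ≤ Real.log (1 + (4 + 4 * s + s)) := by
      rw [Real.le_log_iff_exp_le (by linarith)]
      have := Real.exp_one_lt_d9
      linarith
    have h4 : 1 / Real.log (1 + (4 + 4 * s + s)) ≤ 1 := by
      rw [div_le_one (by linarith)]; exact h3
    have h5 : s / (4 + 4 * s) ≤ 1 / 4 := by
      rw [div_le_div_iff₀ hq (by norm_num)]; linarith
    have h6 : 0 ≤ s / (4 + 4 * s) := by positivity
    nlinarith
  have hcont : ContinuousOn (farRadius s) (Set.Icc (1 / 8) (4 + 4 * s)) := fun q hq =>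
    (continuousAt_farRadius_right hs (by linarith [hq.1])).continuousWithinAt
  obtain ⟨q, hq, he⟩ := intermediate_value_Icc' (by linarith) hcont ⟨h2, h1⟩
  exact ⟨q, by linarith [hq.1], he⟩

/-- The function tends to infinity where the far radius reaches 1, because `stretch p ^ 2` is at
least 1 / (1 - p), and to zero for large q, because the numerator stays bounded. Hence it takes
every positive value. -/
theorem exists_slopeSq_eq {s v : ℝ} (hs : 0 ≤ s) (hv : 0 < v) :
    ∃ q, 0 < q ∧ farRadius s q < 1 ∧ slopeSq s q = v := by
  obtain ⟨q₀, hq₀, he⟩ := exists_farRadius_eq_one hs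
  have hlt : ∀ q, q₀ < q → farRadius s q < 1 := fun q hq => by
    rw [← he]; exact farRadius_strictAntiOn hs hq₀ (hq₀.trans hq) hq
  -- close to `q₀` the slope is large
  have hsmall : ∀ᶠ q in 𝓝[>] q₀, v * (4 * q) * (1 - farRadius s q) < 1 := by
    have hc : ContinuousAt (fun q => v * (4 * q) * (1 - farRadius s q)) q₀ :=
      (continuousAt_const.mul (continuousAt_const.mul continuousAt_id)).mul
        (continuousAt_const.sub (continuousAt_farRadius_right hs hq₀))
    refine (hc.eventually (gt_mem_nhds ?_)).filter_mono nhdsWithin_le_nhds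
    simp only [he]; norm_num
  obtain ⟨q₁, h1, hq₁⟩ := (hsmall.and self_mem_nhdsWithin).exists
  have hq₁' : q₀ < q₁ := hq₁
  have hq₁0 : 0 < q₁ := hq₀.trans hq₁'
  have hbig : v ≤ slopeSq s q₁ := by
    have h2 := hlt q₁ hq₁'
    have h3 := (farRadius_pos hs hq₁0).le
    have h4 : 1 ≤ expSlope (farRadius s q₁ / (1 - farRadius s q₁)) := by
      calc (1 : ℝ) = expSlope 0 := expSlope_zero.symm
        _ ≤ _ := expSlope_mono le_rfl (div_nonneg h3 (by linarith))
    have h5 : 0 < 1 - farRadius s q₁ := by linarith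
    have h6 : 0 < 4 * q₁ := by linarith
    rw [slopeSq, stretch_sq h2, le_div_iff₀ h6, le_div_iff₀ h5]
    linarith
  -- far away the slope is small
  set m := stretch (farRadius s q₁) ^ 2 with hm
  have hm0 : 0 < m := by have := stretch_pos (hlt q₁ hq₁'); positivity
  -- At q₁ + m / v the numerator is at most m and the denominator at least 4m / v.
  have hq₂ : q₁ < q₁ + m / v := by have : 0 < m / v := by positivity
                                   linarith
  have hlow : slopeSq s (q₁ + m / v) ≤ v := by
    have h2 := slopeSq_lt hs hq₁0 (hlt q₁ hq₁') hq₂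
    have h3 := stretch_sq_mono (farRadius_pos hs (hq₁0.trans hq₂)).le
      (farRadius_strictAntiOn hs hq₁0 (hq₁0.trans hq₂) hq₂).le (hlt q₁ hq₁')
    rw [slopeSq, div_le_iff₀ (by linarith)]
    have h4 : v * (4 * (q₁ + m / v)) = 4 * (v * q₁) + 4 * m := by field_simp
    rw [h4]
    have : 0 < v * q₁ := by positivity
    linarith
  have hcont : ContinuousOn (slopeSq s) (Set.Icc q₁ (q₁ + m / v)) := fun q hq =>
    (continuousAt_slopeSq_right hs (hq₁0.trans_le hq.1)
      (hlt q (hq₁'.trans_le hq.1))).continuousWithinAt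
  obtain ⟨q, hq, hqv⟩ := intermediate_value_Icc' hq₂.le hcont ⟨hlow, hbig⟩
  exact ⟨q, hq₁0.trans_le hq.1, hlt q (hq₁'.trans_le hq.1), hqv⟩

open Classical in
/-- The inverse function of `slopeSq s`. -/
def slopeRoot (s v : ℝ) : ℝ :=
  if h : 0 ≤ s ∧ 0 < v then (exists_slopeSq_eq h.1 h.2).choose else 0

theorem slopeRoot_spec {s v : ℝ} (hs : 0 ≤ s) (hv : 0 < v) : 0 < slopeRoot s v ∧
    farRadius s (slopeRoot s v) < 1 ∧ slopeSq s (slopeRoot s v) = v := by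
  rw [slopeRoot, dif_pos ⟨hs, hv⟩]
  exact (exists_slopeSq_eq hs hv).choose_spec

theorem slopeRoot_slopeSq {s q : ℝ} (hs : 0 ≤ s) (hq : 0 < q) (h : farRadius s q < 1) :
    slopeRoot s (slopeSq s q) = q := by
  obtain ⟨h1, h2, h3⟩ := slopeRoot_spec hs (slopeSq_pos hq h)
  rcases lt_trichotomy (slopeRoot s (slopeSq s q)) q with hlt | heq | hgt
  · exact absurd h3 (slopeSq_lt hs h1 h2 hlt).2.ne'
  · exact heq
  · exact absurd h3 (slopeSq_lt hs hq h hgt).2.ne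

attribute [irreducible] farRadius slopeSq slopeRoot

/-- The strict inequalities between v and the values of the decreasing function at p and r persist
for nearby (s, v), and monotonicity traps the root between p and r. -/
theorem eventually_slopeRoot_mem {s p q r : ℝ} {v : ℝ} (hs : 0 ≤ s) (hp : 0 < p)
    (hp1 : farRadius s p < 1) (hq : 0 < q) (hq1 : farRadius s q < 1) (hv : slopeSq s q = v)
    (hpq : p < q) (hqr : q < r) :
    ∀ᶠ z : ℝ × ℝ in 𝓝 (s, v), 0 ≤ z.1 → 0 < z.2 →
      p < slopeRoot z.1 z.2 ∧ slopeRoot z.1 z.2 < r := by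
  have hr : 0 < r := hq.trans hqr
  have hlow : v < slopeSq s p := hv ▸ (slopeSq_lt hs hp hp1 hpq).2
  have hhigh := slopeSq_lt hs hq hq1 hqr
  rw [hv] at hhigh
  have hleft : ∀ x : ℝ, Filter.Tendsto (fun z : ℝ × ℝ => (z.1, x)) (𝓝 (s, v)) (𝓝 (s, x)) :=
    fun x => (continuous_fst.prodMk continuous_const).tendsto (s, v)
  have e1 : ∀ᶠ z : ℝ × ℝ in 𝓝 (s, v), farRadius z.1 p < 1 :=
    Filter.Tendsto.eventually_lt_const (f := fun z : ℝ × ℝ => farRadius z.1 p) hp1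
      ((contDiffAt_farRadius hs hp).continuousAt.tendsto.comp (hleft p))
  have e2 : ∀ᶠ z : ℝ × ℝ in 𝓝 (s, v), z.2 < slopeSq z.1 p :=
    Filter.Tendsto.eventually_lt (f := fun z : ℝ × ℝ => z.2)
      (g := fun z : ℝ × ℝ => slopeSq z.1 p) (continuous_snd.tendsto (s, v))
      ((continuousAt_slopeSq hs hp hp1).tendsto.comp (hleft p)) hlow
  have e3 : ∀ᶠ z : ℝ × ℝ in 𝓝 (s, v), slopeSq z.1 r < z.2 :=
    Filter.Tendsto.eventually_lt (g := fun z : ℝ × ℝ => z.2)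
      (f := fun z : ℝ × ℝ => slopeSq z.1 r)
      ((continuousAt_slopeSq hs hr hhigh.1).tendsto.comp (hleft r))
      (continuous_snd.tendsto (s, v)) hhigh.2
  filter_upwards [e1, e2, e3] with z hz1 hz2 hz3 hz4 hz5
  obtain ⟨k1, k2, k3⟩ := slopeRoot_spec hz4 hz5
  constructor
  · by_contra hc
    rcases eq_or_lt_of_le (not_lt.1 hc) with he | hl
    · rw [he] at k3; linarith
    · have := (slopeSq_lt hz4 k1 k2 hl).2
      linarith
  · by_contra hc
    have hr1 := (slopeSq_lt hz4 hp hz1 (hpq.trans hqr)).1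
    rcases eq_or_lt_of_le (not_lt.1 hc) with he | hl
    · rw [← he] at k3; linarith
    · have := (slopeSq_lt hz4 hr hr1 hl).2
      linarith

/-- The boundary s = 0 is included on purpose: it is reached in the limit ε → 0. -/
theorem continuousOn_slopeRoot :
    ContinuousOn (fun z : ℝ × ℝ => slopeRoot z.1 z.2) {z | 0 ≤ z.1 ∧ 0 < z.2} := by
  rintro ⟨s, v⟩ ⟨hs, hv⟩
  simp only at hs hv
  obtain ⟨h1, h2, h3⟩ := slopeRoot_spec hs hv
  obtain ⟨q, hq⟩ : ∃ q, q = slopeRoot s v := ⟨_, rfl⟩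
  rw [← hq] at h1 h2 h3
  rw [ContinuousWithinAt, Metric.tendsto_nhds]
  intro δ hδ
  have e1 : ∀ᶠ p in 𝓝[<] q, farRadius s p < 1 :=
    ((continuousAt_farRadius_right hs h1).eventually (gt_mem_nhds h2)).filter_mono
      nhdsWithin_le_nhds
  have e2 : ∀ᶠ p in 𝓝[<] q, 0 < p := (lt_mem_nhds h1).filter_mono nhdsWithin_le_nhds
  have e3 : ∀ᶠ p in 𝓝[<] q, q - δ < p :=
    (lt_mem_nhds (by linarith : q - δ < q)).filter_mono nhdsWithin_le_nhds
  obtain ⟨p, ⟨⟨hp1, hp2⟩, hp3⟩, hp4⟩ := (((e1.and e2).and e3).and self_mem_nhdsWithin).exists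
  have hp4' : p < q := hp4
  have := eventually_slopeRoot_mem hs hp2 hp1 h1 h2 h3 hp4' (show q < q + δ by linarith)
  filter_upwards [this.filter_mono nhdsWithin_le_nhds, self_mem_nhdsWithin] with z hz hz'
  obtain ⟨k1, k2⟩ := hz hz'.1 hz'.2
  rw [Real.dist_eq, abs_lt, ← hq]
  constructor <;> linarith

end DeRham
end
noncomputable section

/-! ### The smoothed line along the line -/

namespace ProjSpace

open MeasureTheory DeRham

variable (B : Frame3)

theorem linPoint_pivot {x : R4} (hx : (cx x).1 ≠ 0) : linPoint B x =
    linPoint (pivot B 1) (cx.symm ((2 * (cx x).1)⁻¹, (cx x).2 / (2 * (cx x).1))) := by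
  refine (Projectivization.mk_eq_mk_iff' ℂ _ _ _ _).2 ⟨(cx x).1, ?_⟩
  rw [linVec, linVec, cx.apply_symm_apply, pivot_apply_zero, pivot_apply_one, pivot_apply_two,
    Equiv.swap_apply_right, Equiv.swap_apply_of_ne_of_ne (by decide) (by decide)]
  simp only [smul_add, smul_smul]
  have h1 : (cx x).1 * (2 * (cx x).1)⁻¹ * 2 = 1 := by field_simp
  have h2 : (cx x).1 * ((cx x).2 / (2 * (cx x).1)) * 2 = (cx x).2 := by field_simp
  rw [← mul_assoc, h1, ← mul_assoc, h2, one_smul, add_comm (B 0)]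

/-- The coordinates, in the pivoted chart, of the point of the ball with coordinates `(u, b)`. -/
def pivotPoint (b u : ℂ) : R4 :=
  cx.symm ((2 * (contract (‖u‖ ^ 2 + ‖b‖ ^ 2) * u))⁻¹, b / (2 * u))

theorem norm_sq_pivotPoint (b : ℂ) {u : ℂ} (hu : u ≠ 0) :
    ‖pivotPoint b u‖ ^ 2 = farRadius (‖b‖ ^ 2) (‖u‖ ^ 2) := by
  have hc := contract_pos (show 0 ≤ ‖u‖ ^ 2 + ‖b‖ ^ 2 by positivity)
  have hu' : 0 < ‖u‖ := norm_pos_iff.2 hu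
  rw [pivotPoint, norm_sq_cx_symm, farRadius]
  simp only [norm_inv, norm_div, norm_mul, Complex.norm_ofNat, Complex.norm_real, Real.norm_eq_abs,
    abs_of_pos hc]
  field_simp
  norm_num

theorem ballPoint_eq_pivot (b : ℂ) {u : ℂ} (hu : u ≠ 0) :
    ballPoint B (cx.symm (u, b)) = linPoint (pivot B 1) (pivotPoint b u) := by
  have hc := contract_pos (show 0 ≤ ‖u‖ ^ 2 + ‖b‖ ^ 2 by positivity)
  have hc' : (contract (‖u‖ ^ 2 + ‖b‖ ^ 2) : ℂ) ≠ 0 := by exact_mod_cast hc.ne'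
  have h1 : cx (toBall (cx.symm (u, b))) =
      (contract (‖u‖ ^ 2 + ‖b‖ ^ 2) * u, contract (‖u‖ ^ 2 + ‖b‖ ^ 2) * b) := by
    rw [toBall, norm_sq_cx_symm, map_smul, cx.apply_symm_apply]
    simp
  rw [ballPoint, linPoint_pivot B (by rw [h1]; exact mul_ne_zero hc' hu), h1, pivotPoint]
  congr 3
  simp only
  field_simp

/-- The coordinates, in the ball of the pivoted chart, of the point with coordinates `(u, b)`. -/
def pivotBall (b u : ℂ) : R4 := ofBall (pivotPoint b u)

theorem ballPoint_pivotBall (b : ℂ) {u : ℂ} (hu : u ≠ 0) (h : farRadius (‖b‖ ^ 2) (‖u‖ ^ 2) < 1) :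
    ballPoint (pivot B 1) (pivotBall b u) = ballPoint B (cx.symm (u, b)) := by
  rw [ballPoint_eq_pivot B b hu, ballPoint, pivotBall, toBall_ofBall]
  rw [← norm_sq_pivotPoint b hu] at h
  nlinarith [norm_nonneg (pivotPoint b u)]

theorem ballPoint_notMem (b : ℂ) {u : ℂ} (hu : u ≠ 0) (h : 1 ≤ farRadius (‖b‖ ^ 2) (‖u‖ ^ 2)) :
    ballPoint B (cx.symm (u, b)) ∉ linPoint (pivot B 1) '' Metric.ball 0 1 := by
  rintro ⟨x, hx, hxe⟩
  rw [ballPoint_eq_pivot B b hu] at hxe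
  rw [linPoint_injective _ hxe, mem_ball_zero_iff] at hx
  rw [← norm_sq_pivotPoint b hu] at h
  nlinarith [norm_nonneg (pivotPoint b u)]

/-- The domain of the slope map. -/
def slopeDomain (b : ℂ) : Set ℂ := {u | u ≠ 0 ∧ farRadius (‖b‖ ^ 2) (‖u‖ ^ 2) < 1}

theorem contDiffAt_pivotPoint (b : ℂ) {u : ℂ} (hu : u ≠ 0) : ContDiffAt ℝ ∞ (pivotPoint b) u := by
  have hc := contract_pos (show 0 ≤ ‖u‖ ^ 2 + ‖b‖ ^ 2 by positivity)
  have h1 : ContDiffAt ℝ ∞ (fun u : ℂ => contract (‖u‖ ^ 2 + ‖b‖ ^ 2)) u :=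
    ContDiffAt.comp (g := contract) (f := fun u : ℂ => ‖u‖ ^ 2 + ‖b‖ ^ 2) u
      (contDiffAt_contract (by positivity)) ((contDiff_norm_sq ℝ).contDiffAt.add contDiffAt_const)
  have h2 : ContDiffAt ℝ ∞ (fun u : ℂ => (contract (‖u‖ ^ 2 + ‖b‖ ^ 2) : ℂ)) u :=
    Complex.ofRealCLM.contDiff.contDiffAt.comp u h1
  refine cx.symm.contDiff.contDiffAt.comp u (ContDiffAt.prodMk ?_ ?_)
  · refine (contDiffAt_const.mul (h2.mul contDiffAt_id)).inv ?_
    exact mul_ne_zero two_ne_zero (mul_ne_zero (by exact_mod_cast hc.ne') hu)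
  · exact contDiffAt_const.mul ((contDiffAt_const.mul contDiffAt_id).inv (mul_ne_zero two_ne_zero hu))

theorem isOpen_slopeDomain (b : ℂ) : IsOpen (slopeDomain b) := by
  rw [isOpen_iff_mem_nhds]
  rintro u ⟨hu, h⟩
  have h1 : ContinuousAt (fun u => ‖pivotPoint b u‖ ^ 2) u :=
    (contDiffAt_pivotPoint b hu).continuousAt.norm.pow 2
  rw [← norm_sq_pivotPoint b hu] at h
  filter_upwards [isOpen_ne.mem_nhds hu, h1.eventually (gt_mem_nhds h)] with v hv hv'
  exact ⟨hv, by rwa [← norm_sq_pivotPoint b hv]⟩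

theorem contDiffAt_pivotBall (b : ℂ) {u : ℂ} (hu : u ∈ slopeDomain b) :
    ContDiffAt ℝ ∞ (pivotBall b) u := by
  refine ContDiffAt.comp (g := ofBall) (f := pivotPoint b) u (contDiffAt_ofBall ?_)
    (contDiffAt_pivotPoint b hu.1)
  have h := hu.2
  rw [← norm_sq_pivotPoint b hu.1] at h
  nlinarith [norm_nonneg (pivotPoint b u)]

/-- The second coordinate of `pivotBall b`. -/
def slope (b u : ℂ) : ℂ := (cx (pivotBall b u)).2

theorem cx_pivotBall (b : ℂ) {u : ℂ} (hu : u ≠ 0) : cx (pivotBall b u) =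
    (stretch (farRadius (‖b‖ ^ 2) (‖u‖ ^ 2)) * (2 * (contract (‖u‖ ^ 2 + ‖b‖ ^ 2) * u))⁻¹,
      stretch (farRadius (‖b‖ ^ 2) (‖u‖ ^ 2)) * (b / (2 * u))) := by
  rw [pivotBall, ofBall, norm_sq_pivotPoint b hu, map_smul, pivotPoint, cx.apply_symm_apply]
  simp

theorem norm_sq_slope_div {b u : ℂ} (hb : b ≠ 0) (hu : u ∈ slopeDomain b) :
    ‖slope b u / b‖ ^ 2 = slopeSq (‖b‖ ^ 2) (‖u‖ ^ 2) := by
  rw [slope, cx_pivotBall b hu.1, slopeSq]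
  have h1 := norm_pos_iff.2 hb
  have h2 := norm_pos_iff.2 hu.1
  simp only [norm_div, norm_mul, Complex.norm_ofNat, Complex.norm_real, Real.norm_eq_abs]
  rw [div_pow, mul_pow, sq_abs]
  field_simp
  norm_num

/-- The first coordinate of the point of the moved line, as a function of the slope. -/
def reach (s : ℝ) (w : ℂ) : ℂ := w / contract (slopeRoot s (‖w‖ ^ 2) + s)

/-- The line at height b is a graph over its second coordinate in the pivoted ball. With ζ = `slope
b u`, the number |ζ / b|² determines |u|² through `slopeRoot`, and the first coordinate is ζ / b
divided by the contraction factor. -/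
theorem pivotBall_eq {b u : ℂ} (hb : b ≠ 0) (hu : u ∈ slopeDomain b) :
    pivotBall b u = cx.symm (reach (‖b‖ ^ 2) (slope b u / b), slope b u) := by
  rw [ContinuousLinearEquiv.eq_symm_apply]
  refine Prod.ext ?_ rfl
  simp only
  rw [reach, norm_sq_slope_div hb hu, slopeRoot_slopeSq (sq_nonneg _)
    (pow_pos (norm_pos_iff.2 hu.1) 2) hu.2, slope, cx_pivotBall b hu.1]
  have hc := contract_pos (show 0 ≤ ‖u‖ ^ 2 + ‖b‖ ^ 2 by positivity)
  have hc' : (contract (‖u‖ ^ 2 + ‖b‖ ^ 2) : ℂ) ≠ 0 := by exact_mod_cast hc.ne'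
  have := hu.1
  field_simp

/-- The modulus of u is recovered by `slopeRoot`. Then the stretching factors agree, and u is
recovered from b / (2u). -/
theorem slope_injOn {b : ℂ} (hb : b ≠ 0) : Set.InjOn (slope b) (slopeDomain b) := by
  intro u hu v hv h
  have h1 : pivotBall b u = pivotBall b v := by rw [pivotBall_eq hb hu, pivotBall_eq hb hv, h]
  have h2 := norm_sq_slope_div hb hu
  rw [h, norm_sq_slope_div hb hv] at h2
  have h3 : ‖u‖ ^ 2 = ‖v‖ ^ 2 := by
    rw [← slopeRoot_slopeSq (sq_nonneg ‖b‖) (pow_pos (norm_pos_iff.2 hu.1) 2) hu.2, ← h2,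
      slopeRoot_slopeSq (sq_nonneg ‖b‖) (pow_pos (norm_pos_iff.2 hv.1) 2) hv.2]
  rw [slope, slope, cx_pivotBall b hu.1, cx_pivotBall b hv.1, h3] at h
  have hs : (stretch (farRadius (‖b‖ ^ 2) (‖v‖ ^ 2)) : ℂ) ≠ 0 := by
    exact_mod_cast (stretch_pos hv.2).ne'
  have h4 := mul_left_cancel₀ hs h
  rw [div_eq_div_iff (mul_ne_zero two_ne_zero hu.1) (mul_ne_zero two_ne_zero hv.1)] at h4
  exact (mul_left_cancel₀ two_ne_zero (mul_left_cancel₀ hb h4)).symm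

theorem image_slope {b : ℂ} (hb : b ≠ 0) : slope b '' slopeDomain b = {0}ᶜ := by
  ext ζ
  constructor
  · rintro ⟨u, hu, rfl⟩
    have h := norm_sq_slope_div hb hu
    have h1 := slopeSq_pos (pow_pos (norm_pos_iff.2 hu.1) 2) hu.2
    rw [← h] at h1
    intro h0
    rw [Set.mem_singleton_iff.1 h0] at h1
    simp at h1
  · intro hζ
    have hζ' : ζ ≠ 0 := hζ
    have hw : ζ / b ≠ 0 := div_ne_zero hζ' hb
    obtain ⟨h1, h2, h3⟩ := slopeRoot_spec (sq_nonneg ‖b‖) (pow_pos (norm_pos_iff.2 hw) 2)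
    obtain ⟨q, hq⟩ : ∃ q, q = slopeRoot (‖b‖ ^ 2) (‖ζ / b‖ ^ 2) := ⟨_, rfl⟩
    rw [← hq] at h1 h2 h3
    have hs := stretch_pos h2
    obtain ⟨σ, hσ⟩ : ∃ σ, σ = stretch (farRadius (‖b‖ ^ 2) q) := ⟨_, rfl⟩
    rw [← hσ] at hs
    have hs' : (σ : ℂ) ≠ 0 := by exact_mod_cast hs.ne'
    have hu : (σ : ℂ) / (2 * (ζ / b)) ≠ 0 := div_ne_zero hs' (mul_ne_zero two_ne_zero hw)
    have hn : ‖(σ : ℂ) / (2 * (ζ / b))‖ ^ 2 = q := by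
      rw [slopeSq, ← hσ] at h3
      rw [norm_div, norm_mul, Complex.norm_ofNat, Complex.norm_real, Real.norm_eq_abs, div_pow,
        sq_abs, mul_pow, ← h3]
      field_simp
      norm_num
    -- This solves ζ = σ b / (2u), where σ is the stretching factor at the squared radius q supplied
    -- by `slopeRoot`.
    refine ⟨(σ : ℂ) / (2 * (ζ / b)), ⟨hu, by rw [hn]; exact h2⟩, ?_⟩
    rw [slope, cx_pivotBall b hu, hn, ← hσ]
    simp only
    field_simp

theorem det_conj_smul (b : ℂ) (L : ℂ →L[ℝ] ℂ) :
    ((ContinuousLinearMap.mul ℝ ℂ b).comp ((Complex.conjCLE : ℂ →L[ℝ] ℂ).comp L)).det =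
      -(‖b‖ ^ 2 * L.det) := by
  rw [det_complex, det_complex, Complex.sq_norm, Complex.normSq_apply]
  simp
  ring

/-- Since 1/u is the conjugate of u divided by |u|², the slope is b times the conjugate of a radial
map. That map has decreasing squared radius `slopeSq`, hence Jacobian ≤ 0, and conjugation changes
the sign once more. -/
theorem det_fderiv_slope_nonneg {b u : ℂ} (hu : u ∈ slopeDomain b) :
    DifferentiableAt ℝ (slope b) u ∧ 0 ≤ (fderiv ℝ (slope b) u).det := by
  have hq : 0 < ‖u‖ ^ 2 := pow_pos (norm_pos_iff.2 hu.1) 2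
  have hs : 0 ≤ ‖b‖ ^ 2 := sq_nonneg _
  set h : ℝ → ℝ := fun q => stretch (farRadius (‖b‖ ^ 2) q) / (2 * q) with hh
  have h1 : ContDiffAt ℝ ∞ (fun q => stretch (farRadius (‖b‖ ^ 2) q)) (‖u‖ ^ 2) :=
    ContDiffAt.comp (g := fun z : ℝ × ℝ => stretch (farRadius z.1 z.2))
      (f := fun q : ℝ => (‖b‖ ^ 2, q)) (‖u‖ ^ 2)
      (contDiffAt_stretch_farRadius hs hq hu.2) (contDiffAt_const.prodMk contDiffAt_id)
  have h2 : ContDiffAt ℝ ∞ h (‖u‖ ^ 2) :=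
    h1.div (contDiffAt_const.mul contDiffAt_id) (by positivity)
  have h3 := (h2.differentiableAt (by simp)).hasDerivAt
  obtain ⟨L, hL, hdet⟩ := hasFDerivAt_radial h3
  have h4 : HasFDerivAt (slope b)
      ((ContinuousLinearMap.mul ℝ ℂ b).comp ((Complex.conjCLE : ℂ →L[ℝ] ℂ).comp L)) u := by
    have h5 := ((ContinuousLinearMap.mul ℝ ℂ b).hasFDerivAt).comp u
      ((Complex.conjCLE : ℂ →L[ℝ] ℂ).hasFDerivAt.comp u hL)
    refine h5.congr_of_eventuallyEq ?_
    filter_upwards [isOpen_ne.mem_nhds hu.1] with v hv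
    have hv' : ((‖v‖ : ℂ)) ^ 2 = v * (starRingEnd ℂ) v := by
      rw [Complex.mul_conj, Complex.normSq_eq_norm_sq]; push_cast; rfl
    have hcv : (starRingEnd ℂ) v ≠ 0 := by simpa using hv
    have hv0 : v ≠ 0 := hv
    rw [slope, cx_pivotBall b hv]
    simp only [Function.comp, ContinuousLinearMap.mul_apply', ContinuousLinearEquiv.coe_coe,
      Complex.conjCLE_apply, Complex.real_smul, map_mul, Complex.conj_ofReal, hh]
    push_cast
    rw [hv']
    field_simp
  refine ⟨h4.differentiableAt, ?_⟩
  rw [h4.fderiv, det_conj_smul, hdet]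
  have h6 := hasDerivAt_mul_sq h3
  have hanti : AntitoneOn (fun q => q * h q ^ 2) (Set.Ici (‖u‖ ^ 2)) := by
    have heq : ∀ q ∈ Set.Ici (‖u‖ ^ 2), slopeSq (‖b‖ ^ 2) q = q * h q ^ 2 := by
      intro q hq'
      have : 0 < q := hq.trans_le hq'
      rw [slopeSq, hh]
      field_simp
      norm_num
    refine AntitoneOn.congr (f₁ := slopeSq (‖b‖ ^ 2)) ?_ heq
    intro p hp q hq' hpq
    have hp0 : 0 < p := hq.trans_le hp
    have hp1 : farRadius (‖b‖ ^ 2) p < 1 :=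
      ((farRadius_strictAntiOn hs).antitoneOn hq hp0 hp).trans_lt hu.2
    rcases eq_or_lt_of_le hpq with rfl | hlt
    · exact le_rfl
    · exact (slopeSq_lt hs hp0 hp1 hlt).2.le
  have h7 : h (‖u‖ ^ 2) ^ 2 + ‖u‖ ^ 2 * (2 * h (‖u‖ ^ 2) * deriv h (‖u‖ ^ 2)) ≤ 0 := by
    refine h6.hasDerivWithinAt.nonpos_of_antitoneOn (s := Set.Ici (‖u‖ ^ 2)) ?_ hanti
    rw [accPt_principal_iff_nhdsWithin]
    have : Set.Ici (‖u‖ ^ 2) \ {‖u‖ ^ 2} = Set.Ioi (‖u‖ ^ 2) := Set.Ici_sdiff_left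
    rw [this]; infer_instance
  nlinarith

end ProjSpace
end
-- The smoothed line along the line as a double average over translations
noncomputable section

namespace ProjSpace

open MeasureTheory DeRham

variable (B : Frame3)

theorem fderiv_slope {b u : ℂ} (hu : u ∈ slopeDomain b) (v : ℂ) :
    fderiv ℝ (slope b) u v = (cx (fderiv ℝ (pivotBall b) u v)).2 := by
  have h1 : HasFDerivAt (pivotBall b) (fderiv ℝ (pivotBall b) u) u :=
    ((contDiffAt_pivotBall b hu).differentiableAt (by simp)).hasFDerivAt
  have h2 : HasFDerivAt (slope b) ((ContinuousLinearMap.snd ℝ ℂ ℂ).comp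
      ((cx : R4 →L[ℝ] ℂ × ℂ).comp (fderiv ℝ (pivotBall b) u))) u :=
    (ContinuousLinearMap.snd ℝ ℂ ℂ).hasFDerivAt.comp u
      ((cx : R4 →L[ℝ] ℂ × ℂ).hasFDerivAt.comp u h1)
  rw [h2.fderiv]; rfl

theorem starForm_zero_one (p q : R4) : starForm (e4 0) (e4 1) ![p, q] =
    (cx p).2.re * (cx q).2.im - (cx p).2.im * (cx q).2.re := by
  rw [starForm_apply]
  simp [e4_apply, cx_apply]

theorem mpull_ballPoint_slope {κ : Form 2 (CP 2) 2} {f : R4 → ℝ}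
    (hκ : ∀ z, mpull (ballPoint (pivot B 1)) κ z = f z • starForm (e4 0) (e4 1)) {b u : ℂ}
    (hu : u ∈ slopeDomain b) : mpull (ballPoint B) κ (cx.symm (u, b)) ![e4 0, e4 1] =
      f (pivotBall b u) * (fderiv ℝ (slope b) u).det := by
  have hd : HasFDerivAt (fun u : ℂ => cx.symm (u, b)) pl u := by
    have h1 : HasFDerivAt (fun u : ℂ => (u, b)) (ContinuousLinearMap.inl ℝ ℂ ℂ) u :=
      hasFDerivAt_prodMk_left u b
    exact (cx.symm : ℂ × ℂ →L[ℝ] R4).hasFDerivAt.comp u h1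
  have h1 : mpull (ballPoint B) κ (cx.symm (u, b)) ![e4 0, e4 1] =
      mpull (fun u => ballPoint B (cx.symm (u, b))) κ u ![1, Complex.I] := by
    rw [mpull_comp_ballPoint B hd.differentiableAt, hd.fderiv,
      ContinuousAlternatingMap.compContinuousLinearMap_apply]
    congr 1
    funext i; fin_cases i
    · exact pl_one.symm
    · exact pl_I.symm
  have h2 : mpull (fun u => ballPoint B (cx.symm (u, b))) κ u =
      mpull (fun u => ballPoint (pivot B 1) (pivotBall b u)) κ u := by
    refine mpull_congr ?_ κ
    filter_upwards [(isOpen_slopeDomain b).mem_nhds hu] with v hv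
    exact (ballPoint_pivotBall B b hv.1 hv.2).symm
  rw [h1, h2, mpull_comp_ballPoint (pivot B 1)
    ((contDiffAt_pivotBall b hu).differentiableAt (by simp)), hκ,
    ContinuousAlternatingMap.compContinuousLinearMap_apply, det_complex, fderiv_slope hu,
    fderiv_slope hu, ← starForm_zero_one, ContinuousAlternatingMap.smul_apply, smul_eq_mul]
  congr 2
  funext i; fin_cases i <;> rfl

/-- In the pivoted ball κ is a multiple of the area form of the second coordinate ζ, so ζ = `slope b
u` is the natural variable on the line at height b. Parameters outside the slope domain give points
outside the ball, where κ vanishes, except for the null set u = 0. -/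
theorem integral_ballPoint_slope {κ : Form 2 (CP 2) 2} {f : R4 → ℝ}
    (hκ : ∀ z, mpull (ballPoint (pivot B 1)) κ z = f z • starForm (e4 0) (e4 1))
    (hκ0 : ∀ p, p ∉ linPoint (pivot B 1) '' Metric.ball 0 1 → κ p = 0) {b : ℂ} (hb : b ≠ 0) :
    ∫ u : ℂ, mpull (ballPoint B) κ (cx.symm (u, b)) ![e4 0, e4 1] =
      ∫ ζ : ℂ, f (cx.symm (reach (‖b‖ ^ 2) (ζ / b), ζ)) := by
  have hm := (isOpen_slopeDomain b).measurableSet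
  have h1 : ∫ u : ℂ, mpull (ballPoint B) κ (cx.symm (u, b)) ![e4 0, e4 1] =
      ∫ u in slopeDomain b, mpull (ballPoint B) κ (cx.symm (u, b)) ![e4 0, e4 1] := by
    refine (setIntegral_eq_integral_of_ae_compl_eq_zero ?_).symm
    have h0 : ∀ᵐ u : ℂ, u ≠ 0 := by
      rw [ae_iff]; simp
    filter_upwards [h0] with u hu hun
    have h2 := hκ0 _ (ballPoint_notMem B b hu (not_lt.1 fun h => hun ⟨hu, h⟩))
    rw [mpull_apply, h2]
    rfl
  have h2 : ∫ ζ : ℂ, f (cx.symm (reach (‖b‖ ^ 2) (ζ / b), ζ)) =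
      ∫ ζ in slope b '' slopeDomain b, f (cx.symm (reach (‖b‖ ^ 2) (ζ / b), ζ)) := by
    rw [image_slope hb]
    refine (setIntegral_eq_integral_of_ae_compl_eq_zero ?_).symm
    have h0 : ∀ᵐ u : ℂ, u ≠ 0 := by
      rw [ae_iff]; simp
    filter_upwards [h0] with u hu hun
    exact absurd hu hun
  rw [h1, h2, integral_image_eq_integral_abs_det_fderiv_smul volume hm
    (fun u hu => (det_fderiv_slope_nonneg hu).1.hasFDerivAt.hasFDerivWithinAt) (slope_injOn hb)]
  refine setIntegral_congr_fun hm fun u hu => ?_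
  rw [mpull_ballPoint_slope B hκ hu, abs_of_nonneg (det_fderiv_slope_nonneg hu).2, smul_eq_mul,
    mul_comm]
  congr 2
  exact pivotBall_eq hb hu

theorem ae_cx_snd_ne_zero : ∀ᵐ y : R4, (cx y).2 ≠ 0 := by
  have h : ∀ᵐ p : ℂ × ℂ, p.2 ≠ 0 :=
    Measure.quasiMeasurePreserving_snd.ae (p := fun u : ℂ => u ≠ 0) (by rw [ae_iff]; simp)
  exact measurePreserving_cx.quasiMeasurePreserving.ae h

theorem linePoint_pivot_notMem {s : ℂ} (hs : ‖s‖ < 1 / 2) :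
    linePoint (pivot B 1) s ∉ linPoint B '' Metric.closedBall 0 1 := by
  rintro ⟨x, hx, h⟩
  rcases eq_or_ne s 0 with rfl | h0
  · have h1 := linPoint_mem_linSource B x
    rw [h, linePoint, linPoint, mk_mem_linSource, linVec_pl, pivot_apply_zero] at h1
    simp [-Module.Basis.equivFun_apply, Module.Basis.equivFun_self] at h1
  · rw [linePoint_pivot B h0] at h
    have h2 := linPoint_injective _ h
    rw [h2, mem_closedBall_zero_iff, norm_pl, norm_inv, norm_mul, Complex.norm_ofNat] at hx
    have h3 : 0 < ‖s‖ := norm_pos_iff.2 h0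
    have h4 : 1 < (2 * ‖s‖)⁻¹ := (one_lt_inv₀ (by positivity)).2 (by linarith)
    linarith

/-- Inside the ball at [B₀] the displaced line is the line at the height of y, reparametrized by a
shift that the integral ignores; height 0 has measure zero. This computes the smoothed form along
the line when κ is the test form of a point. -/
theorem lineInt_smear_eq {w f : R4 → ℝ} (hw : ContDiff ℝ ∞ w) (hc : HasCompactSupport w)
    (hw1 : ∫ y, w y = 1) {κ : Form 2 (CP 2) 2} (hκs : IsSmooth κ)
    (hκ : ∀ z, mpull (ballPoint (pivot B 1)) κ z = f z • starForm (e4 0) (e4 1))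
    (hκ0 : ∀ p, p ∉ linPoint (pivot B 1) '' Metric.ball 0 1 → κ p = 0) :
    lineInt B (smear B w κ) =
      ∫ y, w y * ∫ ζ : ℂ, f (cx.symm (reach (‖(cx y).2‖ ^ 2) (ζ / (cx y).2), ζ)) := by
  -- The part |t| > 1 of the line does not move, and κ restricts to zero on the unmoved line.
  have hfar : ∫ s in Metric.ball (0 : ℂ) (2 * 1)⁻¹,
      mpull (linePoint (pivot B 1)) (smear B w κ) s ![1, Complex.I] = 0 := by
    have h1 : ∀ s ∈ Metric.ball (0 : ℂ) (2 * 1)⁻¹,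
        mpull (linePoint (pivot B 1)) (smear B w κ) s ![1, Complex.I] =
        mpull (linePoint (pivot B 1)) κ s ![1, Complex.I] := by
      intro s hs
      have h2 : linePoint (pivot B 1) s ∉ linPoint B '' Metric.closedBall 0 1 :=
        linePoint_pivot_notMem B (by simpa using hs)
      rw [mpull_apply, smear_of_notMem B hw1 _ h2, mpull_apply]
    rw [setIntegral_congr_fun Metric.isOpen_ball.measurableSet h1,
      setIntegral_ball_line (pivot B 1) _ (by norm_num)]
    refine integral_eq_zero_of_ae (Filter.Eventually.of_forall fun u => ?_)
    simp only
    rw [hκ, ContinuousAlternatingMap.smul_apply, starForm_zero_one, cx_e4.1, cx_e4.2.1]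
    simp
  obtain ⟨ε, hε⟩ := hc.isCompact.isBounded.subset_closedBall 0
  set F : R4 × ℂ → ℝ := fun z => w z.1 * mpull (fun t => moveL B z.1 (linePoint B t)) κ z.2
    ![1, Complex.I] with hF
  have hFc : Continuous F := by
    refine (hw.continuous.comp continuous_fst).mul ?_
    refine continuous_alt_iff.1 (continuous_iff_continuousAt.2 fun z => ?_) _
    exact (contDiffAt_mpull_moveL B hκs (z := z)
      (Filter.Eventually.of_forall fun t => contMDiff_linePoint B t)).continuousAt
  have hint : IntegrableOn F (Set.univ ×ˢ Metric.closedBall 0 1) := by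
    have h1 : IntegrableOn F (Metric.closedBall 0 ε ×ˢ Metric.closedBall 0 1) :=
      hFc.continuousOn.integrableOn_compact ((isCompact_closedBall _ _).prod (isCompact_closedBall _ _))
    refine h1.of_forall_sdiff_eq_zero (MeasurableSet.univ.prod Metric.isClosed_closedBall.measurableSet) ?_
    rintro ⟨y, t⟩ ⟨⟨-, ht⟩, hn⟩
    have : w y = 0 := by
      by_contra h0
      exact hn ⟨hε (subset_tsupport _ h0), ht⟩
    simp only [hF, this, zero_mul]
  rw [IntegrableOn, Measure.volume_eq_prod, ← Measure.prod_restrict, Measure.restrict_univ] at hint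
  have hdisc : disc '' Set.univ = Metric.ball 0 1 := by
    ext t
    constructor
    · rintro ⟨u, -, rfl⟩; simpa using norm_disc_lt u
    · intro ht
      obtain ⟨u, hu⟩ := exists_disc_eq (by simpa using ht)
      exact ⟨u, trivial, hu⟩
  rw [lineInt_eq_add B (isSmooth_smear B hw hc hκs) one_pos, hfar, add_zero]
  have h1 : ∀ t, mpull (linePoint B) (smear B w κ) t ![1, Complex.I] = ∫ y, F (y, t) := fun t =>
    mpull_smear_apply B hw.continuous hc hκs (contMDiff_linePoint B t) _
  simp_rw [h1]
  rw [integral_integral_swap (f := fun t y => F (y, t)) hint.swap]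
  refine integral_congr_ae ?_
  filter_upwards [ae_cx_snd_ne_zero] with y hy
  simp only [hF]
  rw [integral_const_mul]
  congr 1
  rw [← integral_ballPoint_slope B hκ hκ0 hy, setIntegral_congr_set
    (ball_ae_eq_closedBall volume (0 : ℂ) 1).symm, ← hdisc, setIntegral_image_two _ MeasurableSet.univ
    (fun u _ => contDiff_disc.differentiable (by simp) u) (fun u _ => det_fderiv_disc_nonneg u)
    injective_disc.injOn, Measure.restrict_univ,
    ← integral_add_right_eq_self (fun u => mpull (ballPoint B) κ (cx.symm (u, (cx y).2)) _) (cx y).1]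
  refine integral_congr_ae (Filter.Eventually.of_forall fun u => ?_)
  simp only
  have h3 : (fun u => moveL B y (linePoint B (disc u))) = fun u => ballPoint B (pl u + y) := by
    funext u
    rw [← ballPoint_pl, moveL_ballPoint]
  have h4 : pl u + y = cx.symm (u + (cx y).1, (cx y).2) := by
    rw [ContinuousLinearEquiv.eq_symm_apply, map_add, cx_pl]
    refine Prod.ext rfl ?_
    simp
  have hd : HasFDerivAt (fun u => pl u + y) pl u := pl.hasFDerivAt.add_const y
  have hM : MDifferentiableAt 𝓘(ℝ, ℂ) 𝓘(ℝ, Fin 2 → ℂ)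
      (fun t => moveL B y (linePoint B t)) (disc u) :=
    ((contMDiff_moveL B y _).comp _ (contMDiff_linePoint B _)).mdifferentiableAt (by simp)
  rw [← mpull_comp hM (contDiff_disc.differentiable (by simp) u), h3,
    mpull_comp_ballPoint B hd.differentiableAt, hd.fderiv,
    ContinuousAlternatingMap.compContinuousLinearMap_apply, h4]
  congr 1
  funext i; fin_cases i
  · exact pl_one
  · exact pl_I

end ProjSpace
end
noncomputable section

/-! ### The limit measure -/

namespace ProjSpace

open MeasureTheory DeRham

theorem continuousAt_reach {s : ℝ} {w : ℂ} (hs : 0 ≤ s) (hw : w ≠ 0) :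
    ContinuousWithinAt (fun z : ℝ × ℂ => reach z.1 z.2) {z | 0 ≤ z.1} (s, w) := by
  have hv : 0 < ‖w‖ ^ 2 := pow_pos (norm_pos_iff.2 hw) 2
  have h1 := (slopeRoot_spec hs hv).1
  have h2 : ContinuousWithinAt (fun z : ℝ × ℂ => slopeRoot z.1 (‖z.2‖ ^ 2)) {z | 0 ≤ z.1 ∧ z.2 ≠ 0}
      (s, w) := by
    have hf : ContinuousWithinAt (fun z : ℝ × ℂ => (z.1, ‖z.2‖ ^ 2)) {z | 0 ≤ z.1 ∧ z.2 ≠ 0} (s, w) :=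
      Continuous.continuousWithinAt (by fun_prop)
    exact ContinuousWithinAt.comp (g := fun z : ℝ × ℝ => slopeRoot z.1 z.2)
      (f := fun z : ℝ × ℂ => (z.1, ‖z.2‖ ^ 2)) (t := {z : ℝ × ℝ | 0 ≤ z.1 ∧ 0 < z.2})
      (continuousOn_slopeRoot (s, ‖w‖ ^ 2) ⟨hs, hv⟩) hf
      fun z hz => ⟨hz.1, pow_pos (norm_pos_iff.2 hz.2) 2⟩
  have h3 : ContinuousWithinAt (fun z : ℝ × ℂ => slopeRoot z.1 (‖z.2‖ ^ 2)) {z | 0 ≤ z.1} (s, w) := by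
    refine h2.mono_of_mem_nhdsWithin ?_
    have : {z : ℝ × ℂ | z.2 ≠ 0} ∈ 𝓝[{z | 0 ≤ z.1}] (s, w) :=
      mem_nhdsWithin_of_mem_nhds ((isOpen_ne.preimage continuous_snd).mem_nhds hw)
    filter_upwards [this, self_mem_nhdsWithin] with z h1 h2
    exact ⟨h2, h1⟩
  have h4 : ContinuousAt contract (slopeRoot s (‖w‖ ^ 2) + s) :=
    (contDiffAt_contract (by linarith)).continuousAt
  have h5 : ContinuousWithinAt (fun z : ℝ × ℂ => contract (slopeRoot z.1 (‖z.2‖ ^ 2) + z.1))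
      {z | 0 ≤ z.1} (s, w) :=
    ContinuousAt.comp_continuousWithinAt (g := contract)
      (f := fun z : ℝ × ℂ => slopeRoot z.1 (‖z.2‖ ^ 2) + z.1) h4
      (h3.add continuous_fst.continuousWithinAt)
  refine continuous_snd.continuousWithinAt.div
    (Complex.continuous_ofReal.continuousAt.comp_continuousWithinAt h5) ?_
  exact_mod_cast (contract_pos (show 0 ≤ slopeRoot s (‖w‖ ^ 2) + s by linarith)).ne'

/-- Continuous off the two coordinate axes, and zero on them, since division by zero is zero and
`reach s 0 = 0`. -/
theorem measurable_reach_div : Measurable fun p : ℂ × ℂ => reach (‖p.1‖ ^ 2) (p.2 / p.1) := by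
  classical
  have hS : IsOpen {p : ℂ × ℂ | p.1 ≠ 0 ∧ p.2 ≠ 0} :=
    (isOpen_ne.preimage continuous_fst).inter (isOpen_ne.preimage continuous_snd)
  have h1 : ContinuousOn (fun p : ℂ × ℂ => reach (‖p.1‖ ^ 2) (p.2 / p.1))
      {p | p.1 ≠ 0 ∧ p.2 ≠ 0} := by
    rintro p ⟨h1, h2⟩
    exact ContinuousWithinAt.comp (g := fun z : ℝ × ℂ => reach z.1 z.2)
      (f := fun p : ℂ × ℂ => (‖p.1‖ ^ 2, p.2 / p.1)) (t := {z | 0 ≤ z.1})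
      (continuousAt_reach (sq_nonneg ‖p.1‖) (div_ne_zero h2 h1))
      (((continuous_fst.norm.pow 2).continuousAt.prodMk
        (continuousAt_snd.div continuousAt_fst h1)).continuousWithinAt) fun z _ => sq_nonneg ‖z.1‖
  have h2 := h1.measurable_piecewise (g := fun _ => (0 : ℂ)) continuousOn_const hS.measurableSet
  refine (congrArg Measurable (funext fun p => ?_)).mp h2
  by_cases hp : p ∈ {p : ℂ × ℂ | p.1 ≠ 0 ∧ p.2 ≠ 0}
  · rw [Set.piecewise_eq_of_mem _ _ _ hp]
  · rw [Set.piecewise_eq_of_notMem _ _ _ hp]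
    have h3 : p.2 / p.1 = 0 := by
      by_contra h
      exact hp ⟨fun h0 => h (by rw [h0, div_zero]), fun h0 => h (by rw [h0, zero_div])⟩
    rw [h3, reach, zero_div]

/-- The measure whose density is the bump function. -/
def bumpMeasure : Measure R4 := volume.withDensity fun y => ENNReal.ofReal (evenBump.normed volume y)

theorem integral_bumpMeasure (g : R4 → ℝ) :
    ∫ y, g y ∂bumpMeasure = ∫ y, evenBump.normed volume y * g y := by
  rw [bumpMeasure, integral_withDensity_eq_integral_toReal_smul
    evenBump.continuous_normed.measurable.ennreal_ofReal
    (Filter.Eventually.of_forall fun _ => ENNReal.ofReal_lt_top)]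
  refine integral_congr_ae (Filter.Eventually.of_forall fun y => ?_)
  simp only
  rw [ENNReal.toReal_ofReal (evenBump.nonneg_normed y), smul_eq_mul]

instance : IsProbabilityMeasure bumpMeasure := by
  refine ⟨?_⟩
  rw [bumpMeasure, withDensity_apply _ MeasurableSet.univ, Measure.restrict_univ,
    ← ofReal_integral_eq_lintegral_ofReal evenBump.integrable_normed
      (Filter.Eventually.of_forall fun y => evenBump.nonneg_normed y), evenBump.integral_normed,
    ENNReal.ofReal_one]

theorem ae_bumpMeasure : ∀ᵐ y ∂bumpMeasure, (cx y).2 ≠ 0 :=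
  (withDensity_absolutelyContinuous _ _).ae_le ae_cx_snd_ne_zero

theorem ae_bumpMeasure_prod : ∀ᵐ z ∂bumpMeasure.prod bumpMeasure, (cx z.1).2 ≠ 0 ∧ (cx z.2).2 ≠ 0 :=
  (Measure.quasiMeasurePreserving_fst.ae ae_bumpMeasure).and
    (Measure.quasiMeasurePreserving_snd.ae ae_bumpMeasure)

/-- The position on the line at which the two moved lines meet. -/
def meetAt (ε : ℝ) (z : R4 × R4) : ℂ :=
  reach (‖(cx (ε • z.1)).2‖ ^ 2) ((cx (ε • z.2)).2 / (cx (ε • z.1)).2) - (cx (ε • z.2)).1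

theorem measurable_meetAt (ε : ℝ) : Measurable (meetAt ε) := by
  have h1 : Measurable fun z : R4 × R4 => ((cx (ε • z.1)).2, (cx (ε • z.2)).2) :=
    ((continuous_snd.comp (cx.continuous.comp (continuous_fst.const_smul ε))).prodMk
      (continuous_snd.comp (cx.continuous.comp (continuous_snd.const_smul ε)))).measurable
  have h2 : Measurable fun z : R4 × R4 => (cx (ε • z.2)).1 :=
    (continuous_fst.comp (cx.continuous.comp (continuous_snd.const_smul ε))).measurable
  exact (measurable_reach_div.comp h1).sub h2

/-- The quotient of the second coordinates is invariant under the common scaling by ε; only the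
squared height and the shift along the line tend to zero. This invariance makes the limit exist. -/
theorem tendsto_meetAt {z : R4 × R4} (h1 : (cx z.1).2 ≠ 0) (h2 : (cx z.2).2 ≠ 0) :
    Filter.Tendsto (fun ε => meetAt ε z) (𝓝[>] 0) (𝓝 (reach 0 ((cx z.2).2 / (cx z.1).2))) := by
  have hf : Filter.Tendsto (fun ε : ℝ => (‖(cx (ε • z.1)).2‖ ^ 2, (cx z.2).2 / (cx z.1).2)) (𝓝[>] 0)
      (𝓝[{p | 0 ≤ p.1}] (0, (cx z.2).2 / (cx z.1).2)) := by
    refine tendsto_nhdsWithin_iff.2 ⟨?_, Filter.Eventually.of_forall fun ε =>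
      sq_nonneg ‖(cx (ε • z.1)).2‖⟩
    have : Continuous fun ε : ℝ => (‖(cx (ε • z.1)).2‖ ^ 2, (cx z.2).2 / (cx z.1).2) :=
      ((continuous_snd.comp (cx.continuous.comp (continuous_id.smul continuous_const))).norm.pow
        2).prodMk continuous_const
    have h := this.tendsto 0
    simp only [zero_smul, map_zero, Prod.snd_zero, norm_zero, ne_eq, OfNat.ofNat_ne_zero,
      not_false_eq_true, zero_pow] at h
    exact h.mono_left nhdsWithin_le_nhds
  have h3 := (continuousAt_reach le_rfl (div_ne_zero h2 h1)).tendsto.comp hf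
  have h4 : Filter.Tendsto (fun ε : ℝ => (cx (ε • z.2)).1) (𝓝[>] 0) (𝓝 0) := by
    have : Continuous fun ε : ℝ => (cx (ε • z.2)).1 :=
      continuous_fst.comp (cx.continuous.comp (continuous_id.smul continuous_const))
    have h := this.tendsto 0
    simp only [zero_smul, map_zero, Prod.fst_zero] at h
    exact h.mono_left nhdsWithin_le_nhds
  have h5 := h3.sub h4
  rw [sub_zero] at h5
  refine h5.congr' ?_
  filter_upwards [self_mem_nhdsWithin] with ε hε
  have hε' : (ε : ℂ) ≠ 0 := by exact_mod_cast (ne_of_gt (Set.mem_Ioi.1 hε))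
  simp only [Function.comp, meetAt, map_smul, Prod.smul_snd, Complex.real_smul]
  rw [mul_div_mul_left _ _ hε']

/-- Fubini's theorem for the smoothed intersection. -/
theorem integral_shear {w f : R4 → ℝ} (hw : Continuous w) (hwc : HasCompactSupport w)
    (hf : Continuous f) (hfc : HasCompactSupport f) {Φ : ℂ → ℝ} (hΦ : Continuous Φ) {C : ℝ}
    (hC : ∀ u, |Φ u| ≤ C) {ρ : R4 × ℂ → ℂ} (hρ : Measurable ρ) :
    ∫ u : ℂ, (∫ y, w y * ∫ ζ : ℂ, f (cx.symm (ρ (y, ζ) - u, ζ))) * Φ u =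
      ∫ y, w y * ∫ x, f x * Φ (ρ (y, (cx x).2) - (cx x).1) := by
  set H : (R4 × ℂ) × ℂ → ℝ := fun z => w z.1.1 * f (cx.symm (z.2, z.1.2)) with hH
  set G : (R4 × ℂ) × ℂ → ℝ := fun z => H z * Φ (ρ z.1 - z.2) with hG
  set T : (R4 × ℂ) × ℂ → (R4 × ℂ) × ℂ := fun z => (z.1, ρ z.1 - z.2) with hT
  have hHi : Integrable H := by
    refine Continuous.integrable_of_hasCompactSupport (by fun_prop) ?_
    obtain ⟨r, hr⟩ := hwc.isCompact.isBounded.subset_closedBall 0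
    obtain ⟨s, hs⟩ := hfc.isCompact.isBounded.subset_closedBall 0
    refine HasCompactSupport.intro (((isCompact_closedBall (0 : R4) r).prod
      (isCompact_closedBall (0 : ℂ) s)).prod (isCompact_closedBall (0 : ℂ) s)) ?_
    rintro ⟨⟨y, ζ⟩, u⟩ hz
    by_contra h0
    have h1 := left_ne_zero_of_mul h0
    have h2 := right_ne_zero_of_mul h0
    have h3 : ‖cx.symm (u, ζ)‖ ≤ s := by simpa using hs (subset_tsupport _ h2)
    have h4 : ‖u‖ ^ 2 + ‖ζ‖ ^ 2 ≤ s ^ 2 := by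
      rw [← norm_sq_cx_symm (u, ζ)]
      exact pow_le_pow_left₀ (norm_nonneg _) h3 2
    have hs0 : 0 ≤ s := (norm_nonneg _).trans h3
    refine hz ⟨⟨hr (subset_tsupport _ h1), ?_⟩, ?_⟩
    · rw [mem_closedBall_zero_iff]
      exact abs_le_of_sq_le_sq' (by nlinarith [sq_nonneg ‖u‖]) hs0 |>.2
    · rw [mem_closedBall_zero_iff]
      exact abs_le_of_sq_le_sq' (by nlinarith [sq_nonneg ‖ζ‖]) hs0 |>.2
  -- In each fibre T is the reflection u ↦ ρ p - u, so it preserves the measure although ρ is only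
  -- measurable; it is an involution.
  have hTm : MeasurePreserving T := by
    have := (MeasurePreserving.id (volume : Measure (R4 × ℂ))).skew_product
      (g := fun p u => ρ p - u) (μc := (volume : Measure ℂ)) (μd := (volume : Measure ℂ))
      ((hρ.comp measurable_fst).sub measurable_snd)
      (Filter.Eventually.of_forall fun p => (Measure.measurePreserving_sub_left volume (ρ p)).map_eq)
    exact this
  have hGi : Integrable G := by
    refine hHi.mul_bdd (c := C) ?_ (Filter.Eventually.of_forall fun z => hC _)
    exact (hΦ.measurable.comp ((hρ.comp measurable_fst).sub measurable_snd)).aestronglyMeasurable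
  have hGT : Integrable (G ∘ T) := hTm.integrable_comp_of_integrable hGi
  have hGTa : ∀ z, (G ∘ T) z = w z.1.1 * f (cx.symm (ρ z.1 - z.2, z.1.2)) * Φ z.2 := fun z => by
    simp only [Function.comp, hG, hH, hT, sub_sub_cancel]
  have e1 : ∫ z, (G ∘ T) z = ∫ z, G z := by
    have hinj : MeasurableEmbedding T := by
      have : T ∘ T = id := funext fun z => by simp [hT]
      exact MeasurableEquiv.measurableEmbedding ⟨⟨T, T, congrFun this, congrFun this⟩,
        hTm.measurable, hTm.measurable⟩
    exact hTm.integral_comp hinj G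
  have e2 : ∫ z, (G ∘ T) z =
      ∫ u : ℂ, (∫ y, w y * ∫ ζ : ℂ, f (cx.symm (ρ (y, ζ) - u, ζ))) * Φ u := by
    rw [Measure.volume_eq_prod, integral_prod_symm _ hGT]
    refine integral_congr_ae ?_
    filter_upwards [hGT.prod_left_ae] with u hu
    rw [Measure.volume_eq_prod] at hu
    rw [Measure.volume_eq_prod, integral_prod _ hu, ← integral_mul_const]
    refine integral_congr_ae (Filter.Eventually.of_forall fun y => ?_)
    simp only [hGTa]
    rw [← integral_const_mul, ← integral_mul_const]
  have e3 : ∫ z, G z = ∫ y, w y * ∫ x, f x * Φ (ρ (y, (cx x).2) - (cx x).1) := by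
    have hGi' : Integrable (fun p : R4 × ℂ => ∫ u, G (p, u)) := hGi.integral_prod_left
    rw [Measure.volume_eq_prod, integral_prod _ hGi]
    rw [Measure.volume_eq_prod] at hGi' ⊢
    rw [integral_prod _ hGi']
    refine integral_congr_ae (Filter.Eventually.of_forall fun y => ?_)
    simp only [hG, hH]
    have hfi : Integrable (fun p : ℂ × ℂ => f (cx.symm p) * Φ (ρ (y, p.2) - p.1)) := by
      have h1 : Integrable (fun p : ℂ × ℂ => f (cx.symm p)) :=
        measurePreserving_cx_symm.integrable_comp_of_integrable
          (hf.integrable_of_hasCompactSupport hfc)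
      refine h1.mul_bdd (c := C) ?_ (Filter.Eventually.of_forall fun z => hC _)
      have h2 : Measurable fun p : ℂ × ℂ => ρ (y, p.2) - p.1 :=
        (hρ.comp (measurable_const.prodMk measurable_snd)).sub measurable_fst
      exact (hΦ.measurable.comp h2).aestronglyMeasurable
    have h3 : ∫ x, f x * Φ (ρ (y, (cx x).2) - (cx x).1) =
        ∫ p : ℂ × ℂ, f (cx.symm p) * Φ (ρ (y, p.2) - p.1) := by
      rw [← measurePreserving_cx_symm.integral_comp
        (cx.symm.toHomeomorph.measurableEmbedding)]
      simp only [ContinuousLinearEquiv.apply_symm_apply]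
    rw [Measure.volume_eq_prod] at hfi
    rw [h3, Measure.volume_eq_prod, integral_prod_symm _ hfi, ← integral_const_mul]
    refine integral_congr_ae (Filter.Eventually.of_forall fun ζ => ?_)
    simp only
    rw [← integral_const_mul]
    simp only [mul_assoc]
  rw [← e2, e1, e3]

theorem integral_epsBump_epsBump {ε : ℝ} (hε : 0 < ε) {Φ : ℂ → ℝ} (hΦ : Continuous Φ) {C : ℝ}
    (hC : ∀ u, |Φ u| ≤ C) :
    ∫ y, epsBump ε y * ∫ x, epsBump ε x *
        Φ (reach (‖(cx y).2‖ ^ 2) ((cx x).2 / (cx y).2) - (cx x).1) =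
      ∫ z, Φ (meetAt ε z) ∂bumpMeasure.prod bumpMeasure := by
  have hi : Integrable (fun z => Φ (meetAt ε z)) (bumpMeasure.prod bumpMeasure) :=
    Integrable.of_bound (hΦ.measurable.comp (measurable_meetAt ε)).aestronglyMeasurable C
      (Filter.Eventually.of_forall fun z => hC _)
  rw [integral_prod _ hi, integral_epsBump_mul hε, integral_bumpMeasure]
  refine integral_congr_ae (Filter.Eventually.of_forall fun y => ?_)
  simp only
  rw [integral_epsBump_mul hε, integral_bumpMeasure]
  rfl

theorem tendsto_integral_meetAt {Φ : ℂ → ℝ} (hΦ : Continuous Φ) {C : ℝ} (hC : ∀ u, |Φ u| ≤ C) :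
    Filter.Tendsto (fun ε => ∫ z, Φ (meetAt ε z) ∂bumpMeasure.prod bumpMeasure) (𝓝[>] 0)
      (𝓝 (∫ z, Φ (reach 0 ((cx z.2).2 / (cx z.1).2)) ∂bumpMeasure.prod bumpMeasure)) := by
  refine tendsto_integral_filter_of_dominated_convergence (fun _ => C)
    (Filter.Eventually.of_forall fun ε =>
      (hΦ.measurable.comp (measurable_meetAt ε)).aestronglyMeasurable)
    (Filter.Eventually.of_forall fun ε => Filter.Eventually.of_forall fun z => hC _)
    (integrable_const C) ?_
  filter_upwards [ae_bumpMeasure_prod] with z hz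
  exact (hΦ.tendsto _).comp (tendsto_meetAt hz.1 hz.2)

end ProjSpace
end
noncomputable section

/-! ### The self-intersection of the line -/

namespace ProjSpace

open MeasureTheory DeRham

variable (B : Frame3)

/-- The value of a form of degree zero along the line, in the coordinate of the ball of the pivoted
chart. -/
def alongLine (φ : Form 2 (CP 2) 0) (u : ℂ) : ℝ := φ (ballPoint (pivot B 1) (pl u)) ![]

theorem continuous_mpull_zero {g : ℂ → CP 2} {φ : Form 2 (CP 2) 0} (hφ : IsSmooth φ)
    (hg : ContMDiff 𝓘(ℝ, ℂ) 𝓘(ℝ, Fin 2 → ℂ) ∞ g) : Continuous fun t => φ (g t) ![] := by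
  have h1 : Continuous (mpull g φ) := continuous_iff_continuousAt.2 fun _ => (contDiffAt_mpull hφ
    (Filter.Eventually.of_forall fun y => hg y)).continuousAt
  refine (continuous_alt_iff.1 h1 ![]).congr fun t => ?_
  rw [mpull_apply]
  congr 1
  exact Subsingleton.elim _ _

theorem alongLine_eq (φ : Form 2 (CP 2) 0) (u : ℂ) :
    alongLine B φ u = φ (linePoint (pivot B 1) (disc u)) ![] := by
  rw [alongLine, ballPoint_pl]

theorem continuous_alongLine {φ : Form 2 (CP 2) 0} (hφ : IsSmooth φ) : Continuous (alongLine B φ) := by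
  simp only [funext (alongLine_eq B φ)]
  exact (continuous_mpull_zero hφ (contMDiff_linePoint (pivot B 1))).comp contDiff_disc.continuous

theorem exists_bound_alongLine {φ : Form 2 (CP 2) 0} (hφ : IsSmooth φ) :
    ∃ C, ∀ u, |alongLine B φ u| ≤ C := by
  obtain ⟨C, hC⟩ := (isCompact_closedBall (0 : ℂ) 1).exists_bound_of_continuousOn
    (continuous_mpull_zero hφ (contMDiff_linePoint (pivot B 1))).continuousOn
  refine ⟨C, fun u => ?_⟩
  rw [alongLine_eq, ← Real.norm_eq_abs]
  exact hC _ (by simpa using (norm_disc_lt u).le)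

/-- The limit point, along the line, of the intersection of the two moved lines. -/
def meetPoint (z : R4 × R4) : ℂ := reach 0 ((cx z.2).2 / (cx z.1).2)

theorem measurable_meetPoint : AEMeasurable meetPoint (bumpMeasure.prod bumpMeasure) :=
  aemeasurable_of_tendsto_metrizable_ae (𝓝[>] (0 : ℝ)) (fun ε => (measurable_meetAt ε).aemeasurable)
    (by filter_upwards [ae_bumpMeasure_prod] with z hz using tendsto_meetAt hz.1 hz.2)

theorem integrable_meetPoint {φ : Form 2 (CP 2) 0} (hφ : IsSmooth φ) :
    Integrable (fun z => alongLine B φ (meetPoint z)) (bumpMeasure.prod bumpMeasure) := by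
  obtain ⟨C, hC⟩ := exists_bound_alongLine B hφ
  exact Integrable.of_bound ((continuous_alongLine B hφ).measurable.comp_aemeasurable
    measurable_meetPoint).aestronglyMeasurable C (Filter.Eventually.of_forall fun z => hC _)

/-- The self-intersection of the line. -/
def meetCurrent : Current 2 (CP 2) 0 where
  toLinearMap :=
    { toFun := fun φ => ∫ z, alongLine B φ.1 (meetPoint z) ∂bumpMeasure.prod bumpMeasure
      map_add' := fun φ ψ => by
        rw [← integral_add (integrable_meetPoint B φ.2.1) (integrable_meetPoint B ψ.2.1)]
        rfl
      map_smul' := fun c φ => by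
        rw [RingHom.id_apply, smul_eq_mul, ← integral_const_mul]
        rfl }
  continuous' := by
    classical
    intro e he K hKe hK
    have hout : ∀ (φ : testForms 2 (CP 2) 0), ∀ p ∉ tsupport φ.1, φ.1 p ![] = 0 := by
      intro φ p hp
      rw [image_eq_zero_of_notMem_tsupport hp]
      rfl
    -- An average is bounded by the supremum, whence the constant 1; for empty K the bound b may be
    -- negative, and the form is zero.
    refine ⟨0, if K.Nonempty then 1 else 0, fun φ hφ b hb => ?_⟩
    have hb' : ∀ y ∈ K, ‖pullback e.symm φ.1 y‖ ≤ b := fun y hy => by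
      simpa using hb 0 le_rfl y hy
    have hle : ∀ p, |φ.1 p ![]| ≤ (if K.Nonempty then 1 else 0) * b := by
      intro p
      by_cases hp : p ∈ tsupport φ.1
      · obtain ⟨y, hy, rfl⟩ := hφ hp
        rw [if_pos ⟨y, hy⟩, one_mul]
        refine le_trans ?_ (hb' y hy)
        have h1 := (pullback e.symm φ.1 y).le_opNorm ![]
        have h2 : pullback e.symm φ.1 y ![] = φ.1 (e.symm y) ![] := by
          rw [pullback, ContinuousAlternatingMap.compContinuousLinearMap_apply]
          congr 1
          exact Subsingleton.elim _ _
        rw [h2] at h1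
        simpa using h1
      · rw [hout φ p hp, abs_zero]
        split_ifs with hne
        · obtain ⟨y, hy⟩ := hne
          rw [one_mul]
          exact (norm_nonneg _).trans (hb' y hy)
        · rw [zero_mul]
    change |∫ z, alongLine B φ.1 (meetPoint z) ∂bumpMeasure.prod bumpMeasure| ≤ _
    have h := norm_integral_le_of_norm_le_const (μ := bumpMeasure.prod bumpMeasure)
      (f := fun z => alongLine B φ.1 (meetPoint z)) (C := (if K.Nonempty then 1 else 0) * b)
      (Filter.Eventually.of_forall fun z => hle _)
    simpa using h

theorem meetCurrent_apply (φ : testForms 2 (CP 2) 0) : meetCurrent B φ =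
    ∫ z, alongLine B φ.1 (meetPoint z) ∂bumpMeasure.prod bumpMeasure := rfl

/-- The limit points lie on an annulus of the line. -/
theorem exists_linePoint_eq {w : ℂ} (hw : w ≠ 0) :
    ∃ t, 1 / 2 ≤ ‖t‖ ∧ ‖t‖ ≤ 1 ∧ ballPoint (pivot B 1) (pl (reach 0 w)) = linePoint B t := by
  obtain ⟨h1, h2, h3⟩ := slopeRoot_spec le_rfl (pow_pos (norm_pos_iff.2 hw) 2)
  obtain ⟨q, hq⟩ : ∃ q, q = slopeRoot 0 (‖w‖ ^ 2) := ⟨_, rfl⟩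
  obtain ⟨σ, hσ⟩ : ∃ σ, σ = stretch (farRadius 0 q) := ⟨_, rfl⟩
  rw [← hq] at h1 h2 h3
  have hs : 0 < σ := hσ ▸ stretch_pos h2
  have hs' : (σ : ℂ) ≠ 0 := by exact_mod_cast hs.ne'
  have hc := contract_pos h1.le
  have hc' : (contract q : ℂ) ≠ 0 := by exact_mod_cast hc.ne'
  set u : ℂ := σ / (2 * w) with hu
  have hu0 : u ≠ 0 := div_ne_zero hs' (mul_ne_zero two_ne_zero hw)
  have hn : ‖u‖ ^ 2 = q := by
    rw [slopeSq, ← hσ] at h3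
    rw [hu, norm_div, norm_mul, Complex.norm_ofNat, Complex.norm_real, Real.norm_eq_abs, div_pow,
      sq_abs, mul_pow, ← h3]
    field_simp
    norm_num
  have hp : pivotBall 0 u = pl (reach 0 w) := by
    rw [pl_apply, ContinuousLinearEquiv.eq_symm_apply, cx_pivotBall 0 hu0, hn, norm_zero,
      zero_pow two_ne_zero, add_zero, ← hσ, reach, ← hq, add_zero]
    refine Prod.ext ?_ (by simp)
    simp only [hu]
    field_simp
  have hfar : farRadius (‖(0 : ℂ)‖ ^ 2) (‖u‖ ^ 2) < 1 := by simpa [hn] using h2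
  have h4 : ballPoint (pivot B 1) (pl (reach 0 w)) = linePoint B (disc u) := by
    rw [← hp, ballPoint_pivotBall B 0 hu0 hfar, ← ballPoint_pl, pl_apply]
  refine ⟨disc u, ?_, (norm_disc_lt u).le, h4⟩
  -- The point also lies in the ball of the pivoted chart, which the line meets only for |t| ≥ 1/2.
  by_contra h
  refine linePoint_notMem B (not_le.1 h) ?_
  rw [← h4]
  exact ⟨toBall (pl (reach 0 w)), by simpa using (norm_toBall_lt _).le, rfl⟩

/-- The current is the average over a probability measure carried by the annulus. -/
theorem meetCurrent_le {φ : testForms 2 (CP 2) 0} {C : ℝ}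
    (h : ∀ t, 1 / 2 ≤ ‖t‖ → ‖t‖ ≤ 1 → φ.1 (linePoint B t) ![] ≤ C) : meetCurrent B φ ≤ C := by
  rw [meetCurrent_apply]
  have h1 : ∫ z, alongLine B φ.1 (meetPoint z) ∂bumpMeasure.prod bumpMeasure ≤
      ∫ _, C ∂bumpMeasure.prod bumpMeasure := by
    refine integral_mono_ae (integrable_meetPoint B φ.2.1) (integrable_const C) ?_
    filter_upwards [ae_bumpMeasure_prod] with z hz
    obtain ⟨t, ht1, ht2, ht⟩ := exists_linePoint_eq B (div_ne_zero hz.2 hz.1)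
    rw [alongLine, meetPoint, ht]
    exact h t ht1 ht2
  simpa using h1

/-- On |t| ≤ 1/2 the integrand vanishes; the rest is the whole disc of the pivoted ball, where
`lineInt_smear_eq` writes the form as a double average. Fubini with the shear of `integral_shear`
makes the position of the meeting point the argument of the test function. -/
theorem lineInt_wedge_eq {ε : ℝ} (hε : 0 < ε) {α : Form 2 (CP 2) 2} (hα : IsSmooth α)
    (h1 : ∀ u, ‖disc u‖ < 1 / 2 → mpull (ballPoint B) α (pl u) ![e4 0, e4 1] = 0)
    (h2 : ∀ (x : R4) (κ : Form 2 (CP 2) 2), IsSmooth κ →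
      (∀ z, mpull (ballPoint (pivot B 1)) κ z = epsBump ε (x - z) • starForm (e4 0) (e4 1)) →
      (∀ p, p ∉ linPoint (pivot B 1) '' Metric.ball 0 1 → κ p = 0) →
      mpull (ballPoint (pivot B 1)) α x ![e4 0, e4 1] = lineInt B (smear B (epsBump ε) κ))
    {φ : Form 2 (CP 2) 0} (hφ : IsSmooth φ) : lineInt B (wedge α φ) =
      ∫ z, alongLine B φ (meetAt ε z) ∂bumpMeasure.prod bumpMeasure := by
  have hw := contDiff_epsBump ε
  have hc := hasCompactSupport_epsBump hε
  have hwedge : ∀ (B' : Frame3) (u : ℂ), mpull (ballPoint B') (wedge α φ) (pl u) ![e4 0, e4 1] =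
      mpull (ballPoint B') α (pl u) ![e4 0, e4 1] * φ (ballPoint B' (pl u)) ![] := by
    intro B' u
    rw [mpull_wedge, wedgeAlt_two_zero, mpull_apply (ballPoint B') φ]
    congr 2
    exact Subsingleton.elim _ _
  have hnear : ∫ t in Metric.closedBall (0 : ℂ) (1 / 2),
      mpull (linePoint B) (wedge α φ) t ![1, Complex.I] = 0 := by
    rw [setIntegral_closedBall_line B _ (by norm_num)]
    refine (setIntegral_congr_fun (g := fun _ => (0 : ℝ))
      (Metric.isOpen_ball.preimage contDiff_disc.continuous).measurableSet fun u hu => ?_).trans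
      (by simp)
    simp only
    rw [hwedge, h1 u (by simpa using hu), zero_mul]
  have huniv : disc ⁻¹' Metric.ball 0 (2 * (1 / 2) : ℝ)⁻¹ = Set.univ := by
    refine Set.eq_univ_of_forall fun u => ?_
    have := norm_disc_lt u
    simpa using this
  have hval : ∀ u : ℂ, mpull (ballPoint (pivot B 1)) α (pl u) ![e4 0, e4 1] =
      ∫ y, epsBump ε y * ∫ ζ : ℂ, epsBump ε
        (cx.symm (reach (‖(cx y).2‖ ^ 2) (ζ / (cx y).2) - u, ζ)) := by
    intro u
    -- The test form of the point with ball coordinate u on the line.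
    obtain ⟨κ, hκ, hκ1, hκ0⟩ := exists_push (pivot B 1)
      (A := fun z => epsBump ε (pl u - z) • starForm (e4 0) (e4 1))
      ((hw.comp (contDiff_const.sub contDiff_id)).smul contDiff_const)
      ((hc.comp_homeomorph (Homeomorph.subLeft (pl u))).smul_right)
    rw [h2 _ κ hκ hκ1 hκ0, lineInt_smear_eq B (f := fun z => epsBump ε (pl u - z)) hw hc
      (integral_epsBump hε) hκ hκ1 hκ0]
    refine integral_congr_ae (Filter.Eventually.of_forall fun y => ?_)
    simp only
    congr 1
    refine integral_congr_ae (Filter.Eventually.of_forall fun ζ => ?_)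
    simp only
    rw [← epsBump_neg, neg_sub]
    congr 1
    rw [pl_apply, ← map_sub]
    simp
  obtain ⟨C, hC⟩ := exists_bound_alongLine B hφ
  rw [lineInt_eq_add B (isSmooth_wedge hα hφ) (r := 1 / 2) (by norm_num), hnear, zero_add,
    setIntegral_ball_line (pivot B 1) _ (by norm_num), huniv, Measure.restrict_univ,
    ← integral_epsBump_epsBump hε (continuous_alongLine B hφ) hC,
    ← integral_shear (ρ := fun p => reach (‖(cx p.1).2‖ ^ 2) (p.2 / (cx p.1).2)) hw.continuous hc
      hw.continuous hc (continuous_alongLine B hφ) hC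
      (measurable_reach_div.comp (((continuous_snd.comp (cx.continuous.comp continuous_fst)).prodMk
        continuous_snd).measurable))]
  refine integral_congr_ae (Filter.Eventually.of_forall fun u => ?_)
  simp only
  rw [hwedge, hval]
  rfl

theorem linePoint_notMem_pivot_two (t : ℂ) :
    linePoint B t ∉ linPoint (pivot B 2) '' Metric.closedBall 0 1 := by
  rintro ⟨x, hx, h⟩
  have h1 := linPoint_mem_linSource (pivot B 2) x
  rw [h, linePoint, linPoint, mk_mem_linSource, equivFun_pivot, equivFun_linVec] at h1
  simp [cx_pl] at h1

theorem lineInt_smear_pivot_two {ε : ℝ} (hε : 0 < ε) (η : Form 2 (CP 2) 2) :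
    lineInt B (smear (pivot B 2) (epsBump ε) η) = lineInt B η := by
  refine integral_congr_ae (Filter.Eventually.of_forall fun t => ?_)
  simp only
  rw [mpull_apply, smear_of_notMem (pivot B 2) (integral_epsBump hε) η
    (linePoint_notMem_pivot_two B t), mpull_apply]

/-- The basis defining the current may differ from the one defining the data, so that different data
can be compared on one and the same current. The third ball plays no role, as the line does not meet
it. -/
theorem isIntersection_meetCurrent {B' : Frame3} (hB : ∀ η, lineInt B' η = lineInt B η) :
    (planeData B).IsIntersection (k := 2) (l := 0) (j := 2) rfl (lineCurrent B') (lineCurrent B')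
      (meetCurrent B) := by
  classical
  obtain ⟨α, hα⟩ := (eventually_exists_form B).choice
  refine ⟨α, ?_, fun φ => ?_⟩
  · filter_upwards [hα, self_mem_nhdsWithin] with ε h hε
    refine ⟨h.1, fun e he φ hφ _ => ?_⟩
    rw [integral_chart_eq_formInt B rfl he, ← h.2.1 φ hφ.1, DeRhamData.smoothing,
      dual_planeData B hε, eval_lineCurrent, hB, lineInt_smear_pivot_two B hε]
    exact isSmooth_smear_epsBump _ hε (isSmooth_smear_epsBump _ hε (isSmooth_smear_epsBump _ hε hφ.1))
  · obtain ⟨C, hC⟩ := exists_bound_alongLine B φ.2.1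
    refine (tendsto_integral_meetAt (continuous_alongLine B φ.2.1) hC).congr' ?_
    filter_upwards [hα, self_mem_nhdsWithin] with ε h hε
    have h1 : IsSmooth (wedge (α ε) φ.1) := isSmooth_wedge h.1 φ.2.1
    rw [eval_lineCurrent B' h1, hB]
    exact (lineInt_wedge_eq B hε h.1 h.2.2.1 h.2.2.2 φ.2.1).symm

end ProjSpace
end
noncomputable section

/-! ### Comparison of the intersections for different frames -/

namespace ProjSpace

open MeasureTheory DeRham

/-- A function, as a form of degree zero. -/
def functionForm (f : CP 2 → ℝ) : Form 2 (CP 2) 0 := fun p =>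
  ContinuousAlternatingMap.constOfIsEmpty ℝ (Fin 2 → ℂ) (Fin 0) (f p)

theorem isSmooth_functionForm {f : CP 2 → ℝ} (hf : ContMDiff 𝓘(ℝ, Fin 2 → ℂ) 𝓘(ℝ, ℝ) ∞ f) :
    IsSmooth (functionForm f) := by
  intro e he y hy
  have h1 : ContMDiffAt 𝓘(ℝ, Fin 2 → ℂ) 𝓘(ℝ, ℝ) ∞ (fun y => f (e.symm y)) y :=
    (hf _).comp y (contMDiffAt_symm_of_mem_maximalAtlas
      (IsManifold.subset_maximalAtlas he) hy)
  refine ContDiffAt.contDiffWithinAt (contDiffAt_alt_iff.2 fun v => ?_)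
  exact h1.contDiffAt

/-- A smooth function, as a test form. -/
def testFunction {f : CP 2 → ℝ} (hf : ContMDiff 𝓘(ℝ, Fin 2 → ℂ) 𝓘(ℝ, ℝ) ∞ f) :
    testForms 2 (CP 2) 0 := ⟨functionForm f, mem_testForms (isSmooth_functionForm hf)⟩

theorem testFunction_apply {f : CP 2 → ℝ} (hf : ContMDiff 𝓘(ℝ, Fin 2 → ℂ) 𝓘(ℝ, ℝ) ∞ f) (p : CP 2) :
    (testFunction hf).1 p ![] = f p := rfl

theorem le_meetCurrent (B : Frame3) {φ : testForms 2 (CP 2) 0} {C : ℝ}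
    (h : ∀ t, 1 / 2 ≤ ‖t‖ → ‖t‖ ≤ 1 → C ≤ φ.1 (linePoint B t) ![]) : C ≤ meetCurrent B φ := by
  have h1 : meetCurrent B (-φ) ≤ -C := meetCurrent_le B fun t h1 h2 => neg_le_neg (h t h1 h2)
  have h2 : meetCurrent B (-φ) = -meetCurrent B φ := (meetCurrent B).toLinearMap.map_neg φ
  linarith

theorem support_meetCurrent (B : Frame3) :
    (meetCurrent B).support ⊆ linePoint B '' Metric.closedBall 0 1 := by
  intro x hx
  by_contra hn
  have hc : IsClosed (linePoint B '' Metric.closedBall 0 1) :=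
    ((isCompact_closedBall (0 : ℂ) 1).image (contMDiff_linePoint B).continuous).isClosed
  obtain ⟨φ, hφ, hne⟩ := hx _ hc.isOpen_compl hn
  have h0 : ∀ t : ℂ, ‖t‖ ≤ 1 → φ.1 (linePoint B t) ![] = 0 := by
    intro t ht
    have : linePoint B t ∉ tsupport φ.1 := fun h => hφ h ⟨t, by simpa using ht, rfl⟩
    rw [image_eq_zero_of_notMem_tsupport this]
    rfl
  exact hne (le_antisymm (meetCurrent_le B fun t _ ht => (h0 t ht).le)
    (le_meetCurrent B fun t _ ht => (h0 t ht).ge))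

theorem exists_frame {a b : Fin 3 → ℂ} (hab : LinearIndependent ℂ ![a, b]) :
    ∃ B : Frame3, B 0 = a ∧ B 1 = b := by
  obtain ⟨c, hc⟩ := exists_linearIndependent_snoc_of_lt_finrank hab (by simp)
  refine ⟨basisOfLinearIndependentOfCardEqFinrank hc (by simp), ?_, ?_⟩ <;>
    rw [coe_basisOfLinearIndependentOfCardEqFinrank]
  · exact Fin.snoc_castSucc (α := fun _ => Fin 3 → ℂ) c ![a, b] 0
  · exact Fin.snoc_castSucc (α := fun _ => Fin 3 → ℂ) c ![a, b] 1

/-- Complete B₀ + t₀ B₁ and c B₁ to a basis. -/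
theorem exists_frame_affine (B : Frame3) (t₀ : ℂ) {c : ℂ} (hc : c ≠ 0) :
    ∃ B' : Frame3, ∀ u, linePoint B' u = linePoint B (t₀ + c * u) := by
  have hB : LinearIndependent ℂ ![B 0, B 1] := by
    have := B.linearIndependent.comp ![0, 1] (by decide)
    convert this using 1
    funext i; fin_cases i <;> rfl
  have h : LinearIndependent ℂ ![B 0 + t₀ • B 1, c • B 1] := by
    rw [LinearIndependent.pair_iff] at hB ⊢
    intro s t hst
    have h1 := hB s (s * t₀ + t * c) (by rw [← hst]; module)
    refine ⟨h1.1, ?_⟩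
    simpa [h1.1, hc] using h1.2
  obtain ⟨B', h0, h1⟩ := exists_frame h
  refine ⟨B', fun u => ?_⟩
  simp only [linePoint, linPoint]
  congr 1
  rw [linVec_pl, linVec_pl, h0, h1]
  module

theorem coordRatio_zero_linePoint (B : Frame3) (t : ℂ) :
    coordRatio B 0 (linePoint B t) = 1 / (1 + ‖t‖ ^ 2) := by
  rw [linePoint, coordRatio_zero_linPoint, norm_sq_pl]

/-- The function 1 / (1 + |t|²) separates the two: it is at most 4/5 for |t| ≥ 1/2, and at least
64/65 for |t| ≤ 1/8. -/
theorem meetCurrent_ne (B B' : Frame3) (h : ∀ u, linePoint B' u = linePoint B (0 + 1 / 8 * u)) :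
    meetCurrent B ≠ meetCurrent B' := by
  intro he
  set φ := testFunction (contMDiff_coordRatio B 0) with hφ
  have h1 : meetCurrent B φ ≤ 4 / 5 := by
    refine meetCurrent_le B fun t ht _ => ?_
    rw [hφ, testFunction_apply, coordRatio_zero_linePoint, div_le_div_iff₀ (by positivity) (by norm_num)]
    nlinarith
  have h2 : 64 / 65 ≤ meetCurrent B' φ := by
    refine le_meetCurrent B' fun t _ ht => ?_
    rw [h, hφ, testFunction_apply, coordRatio_zero_linePoint, zero_add, norm_mul,
      div_le_div_iff₀ (by norm_num) (by positivity)]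
    have : ‖(1 / 8 : ℂ)‖ = 1 / 8 := by norm_num
    rw [this]
    nlinarith [norm_nonneg t]
  rw [he] at h1
  linarith

theorem linePoint_mem_line (B : Frame3) (t : ℂ) : linePoint B t ∈ line (B 0) (B 1) := by
  change (linePoint B t).submodule ≤ _
  rw [linePoint, linPoint, Projectivization.submodule_mk, Submodule.span_singleton_le_iff_mem,
    linVec_pl, Submodule.mem_span_pair]
  exact ⟨1, t, by rw [one_smul]⟩

/-- The affine parametrization misses [B₁]. In that case V is also a neighbourhood of all points
near [B₁], and one of these on the line is parametrized. -/
theorem exists_linePoint_mem (B : Frame3) {p : CP 2} (hp : p ∈ line (B 0) (B 1)) {V : Set (CP 2)}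
    (hV : V ∈ 𝓝 p) : ∃ t, V ∈ 𝓝 (linePoint B t) := by
  induction p using Projectivization.ind with
  | h v hv =>
    change Projectivization.submodule _ ≤ _ at hp
    rw [Projectivization.submodule_mk, Submodule.span_singleton_le_iff_mem,
      Submodule.mem_span_pair] at hp
    obtain ⟨x, y, rfl⟩ := hp
    rcases eq_or_ne x 0 with rfl | hx
    · have hy : y ≠ 0 := by
        rintro rfl
        exact hv (by simp)
      have h0 : linePoint (pivot B 1) 0 =
          Projectivization.mk ℂ ((0 : ℂ) • B 0 + y • B 1) hv := by
        refine (Projectivization.mk_eq_mk_iff' ℂ _ _ _ _).2 ⟨y⁻¹, ?_⟩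
        rw [linVec_pl, pivot_apply_zero, zero_smul, zero_smul, zero_add, add_zero, smul_smul,
          inv_mul_cancel₀ hy, one_smul]
      rw [← h0] at hV
      have h1 : ∀ᶠ s in 𝓝 (0 : ℂ), V ∈ 𝓝 (linePoint (pivot B 1) s) :=
        (contMDiff_linePoint (pivot B 1)).continuous.continuousAt.eventually
          (eventually_eventually_nhds.2 hV)
      have h2 : ∀ᶠ s in 𝓝[≠] (0 : ℂ), V ∈ 𝓝 (linePoint (pivot B 1) s) :=
        h1.filter_mono nhdsWithin_le_nhds
      obtain ⟨s, hs, hs0⟩ := (h2.and self_mem_nhdsWithin).exists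
      exact ⟨(2 * s)⁻¹, by rwa [← linePoint_pivot B hs0]⟩
    · refine ⟨y / x, ?_⟩
      have h0 : linePoint B (y / x) = Projectivization.mk ℂ (x • B 0 + y • B 1) hv := by
        refine (Projectivization.mk_eq_mk_iff' ℂ _ _ _ _).2 ⟨x⁻¹, ?_⟩
        rw [linVec_pl, smul_add, smul_smul, smul_smul, inv_mul_cancel₀ hx, one_smul,
          div_eq_inv_mul]
      rwa [h0]

end ProjSpace
end

open ProjSpace DeRham in
theorem theorem3p9 (a b : Fin 3 → ℂ) (hab : LinearIndependent ℂ ![a, b]) :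
    ∃ T : Current 2 (CP 2) 2, IsLineCurrent hab T ∧
      (∃ (U U' : DeRhamData 2 (CP 2)) (S S' : Current 2 (CP 2) 0),
        U.IsIntersection (k := 2) (l := 0) (j := 2) rfl T T S ∧
        U'.IsIntersection (k := 2) (l := 0) (j := 2) rfl T T S' ∧ S ≠ S') ∧
      ∀ p ∈ line a b, ∀ V ∈ 𝓝 p, ∃ (U : DeRhamData 2 (CP 2)) (S : Current 2 (CP 2) 0),
        U.IsIntersection (k := 2) (l := 0) (j := 2) rfl T T S ∧
        (∃ φ, S φ ≠ 0) ∧ S.support ⊆ V ∩ line a b := by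
  obtain ⟨B, rfl, rfl⟩ := exists_frame hab
  refine ⟨lineCurrent B, isLineCurrent_lineCurrent B hab rfl rfl, ?_, ?_⟩
  · obtain ⟨B', h⟩ := exists_frame_affine B 0 (c := 1 / 8) (by norm_num)
    exact ⟨planeData B, planeData B', meetCurrent B, meetCurrent B',
      isIntersection_meetCurrent B fun _ => rfl,
      isIntersection_meetCurrent B' fun η =>
        (lineInt_eq_of_affine B B' (by norm_num) h η).symm, meetCurrent_ne B B' h⟩
  · intro p hp V hV
    obtain ⟨t₀, ht₀⟩ := exists_linePoint_mem B hp hV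
    obtain ⟨δ, hδ, hball⟩ := Metric.mem_nhds_iff.1
      ((contMDiff_linePoint B).continuous.continuousAt.preimage_mem_nhds ht₀)
    have hc : ((δ / 2 : ℝ) : ℂ) ≠ 0 := by exact_mod_cast (half_pos hδ).ne'
    -- The closed unit disc in the new coordinate becomes the disc of radius δ / 2 about t₀, which
    -- stays inside V.
    obtain ⟨B', h⟩ := exists_frame_affine B t₀ hc
    refine ⟨planeData B', meetCurrent B', isIntersection_meetCurrent B' fun η =>
      (lineInt_eq_of_affine B B' hc h η).symm,
      ⟨testFunction (f := fun _ => 1) contMDiff_const, ?_⟩, ?_⟩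
    · have h1 : 1 ≤ meetCurrent B' (testFunction (f := fun _ => 1) contMDiff_const) :=
        le_meetCurrent B' fun t _ _ => (testFunction_apply (f := fun _ => 1) contMDiff_const _).ge
      exact (zero_lt_one.trans_le h1).ne'
    · refine (support_meetCurrent B').trans ?_
      rintro _ ⟨u, hu, rfl⟩
      rw [h]
      refine ⟨hball ?_, linePoint_mem_line B _⟩
      rw [mem_ball_iff_norm, add_sub_cancel_left, norm_mul, Complex.norm_real, Real.norm_eq_abs,
        abs_of_pos (half_pos hδ)]
      have hu' : ‖u‖ ≤ 1 := by simpa using hu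
      nlinarith
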